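/- \textbf{Setting.} A quantum algorithm is a program for a classical random access machine (logarithmic cost) that controls a quantum memory by elementary gates (Toffoli, CNOT, $X$, $H$, $T$) and measurements. It \emph{solves a problem with bounded error in time $t$} if on each input it halts with probability $1$, its output is correct with probability at least $2/3$, and its expected running time on that input is at most $t$. For reals $v\ge 0$ and $0<\gamma<1$, a number $d$ is a $\gamma$-approximation of $v$ if $(1-\gamma)v<d<(1+\gamma)v$ in case $v>0$, and if $d=0$ in case $v=0$. An \emph{error parameter} is a function $\gamma:\mathbb N\to\mathbb R$ with $\gamma(n)\in[2^{-n},0.4999)$ for all sufficiently large $n$; below, only those $n$ with $\gamma(n)\in[2^{-n},0.4999)$ are considered, and we write $\gamma$ for $\gamma(n)$. \textbf{$\gamma$-\#QSETH} is the assertion: for each constant $\delta>0$ there is a constant $c>0$ such that no bounded-error quantum algorithm, given a CNF formula $\phi$ on $n$ variables with at most $cn^2$ clauses and with $\hat h$ satisfying assignments, outputs an integer that is a $\gamma$-approximation of $\hat h$ in time \[ p(|\phi|)\cdot\max\Big\{1,\tfrac1\gamma\sqrt{\tfrac{2^n-\hat h}{\hat h}}\Big\}^{1-\delta}\ \text{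 if }\gamma\hat h>1,\qquad p(|\phi|)\cdot 2^{n(1-\delta)}\ \text{ otherwise,} \] for some polynomial $p$, where $|\phi|$ is the number of variables, clauses and literals of $\phi$. \textbf{Hardness of strong simulation with multiplicative error $\gamma$} is the assertion: for each constant $\delta>0$, no bounded-error quantum algorithm, given a quantum circuit $C$ on $n$ qubits (a sequence of Toffoli, CNOT, $X$, $H$ and $T$ gates) and $x\in\{0,1\}^n$, outputs a (rational) $\gamma$-approximation of $|\langle 0^n|C|x\rangle|$ in time \[ p(|C|)\cdot\max\Big\{1,\tfrac1\gamma\sqrt{\tfrac{2^n-\hat h}{\hat h}}\Big\}^{1-\delta}\ \text{ if }\gamma\hat h\ge1,\qquad p(|C|)\cdot 2^{n(1-\delta)}\ \text{ otherwise,} \] for some polynomial $p$, where $\hat h=2^n\,|\langle 0^n|C|x\rangle|$ and $|C|$ is the number of qubits and gates of $C$. \textbf{Theorem.} \begin{enumerate} \item For each constant $\gamma\in(0,0.4999)$: if $\gamma$-\#QSETH holds, then strong simulation with multiplicative error $\gamma$ is hard. \item If $\gamma$-\#QSETH holds for every error parameter $\gamma=\gamma(n)$, then for every error parameter $\gamma=\gamma(n)$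 strong simulation with multiplicative error $\gamma$ is hard. \end{enumerate} -/

import Mathlib

open scoped ENNReal

noncomputable section

/-! ### Quantum gates and circuits -/

namespace QSim

/-- Elementary gates, on wires named by the elements of `Q`. -/
inductive Gate (Q : Type) : Type
  | X (i : Q)
  | H (i : Q)
  | T (i : Q)
  | CNOT (c t : Q)
  | TOFFOLI (a b t : Q)

/-- The wires a gate touches. -/
def Gate.wires {Q : Type} : Gate Q → List Q
  | .X i => [i]
  | .H i => [i]
  | .T i => [i]
  | .CNOT c t => [c, t]
  | .TOFFOLI a b t => [a, b, t]

/-- Renaming of wires. -/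
def Gate.map {Q R : Type} (f : Q → R) : Gate Q → Gate R
  | .X i => .X (f i)
  | .H i => .H (f i)
  | .T i => .T (f i)
  | .CNOT c t => .CNOT (f c) (f t)
  | .TOFFOLI a b t => .TOFFOLI (f a) (f b) (f t)

/-- A family of amplitudes in the computational basis of the qubits named by `Q`. -/
abbrev Amp (Q : Type) : Type := (Q → Bool) → ℂ

/-- The basis state `|x⟩`. -/
def ket {Q : Type} [DecidableEq (Q → Bool)] (x : Q → Bool) : Amp Q := Pi.single x 1

/-- The action of a gate. `H` is the Hadamard gate and `T` is `diag(1, exp(iπ/4))`. A controlled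
gate whose target is also one of its controls acts as the identity, so every gate is unitary. -/
def Gate.apply {Q : Type} [DecidableEq Q] : Gate Q → Amp Q → Amp Q
  | .X i, ψ => fun x => ψ (Function.update x i (!x i))
  | .H i, ψ => fun x =>
      (ψ (Function.update x i false) + (if x i then -1 else 1) * ψ (Function.update x i true))
        / (Real.sqrt 2 : ℂ)
  | .T i, ψ => fun x => (if x i then Complex.exp (Complex.I * Real.pi / 4) else 1) * ψ x
  | .CNOT c t, ψ => fun x =>
      if t = c then ψ x else ψ (Function.update x t (xor (x t) (x c)))
  | .TOFFOLI a b t, ψ => fun x =>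
      if t = a ∨ t = b then ψ x else ψ (Function.update x t (xor (x t) (x a && x b)))

/-- A quantum circuit on `n` qubits: its gates, in the order in which they are applied. -/
abbrev Circuit (n : ℕ) : Type := List (Gate (Fin n))

/-- `C|ψ⟩`. -/
def Circuit.run {n : ℕ} (C : Circuit n) (ψ : Amp (Fin n)) : Amp (Fin n) :=
  C.foldl (fun φ g => g.apply φ) ψ

/-- `|⟨0ⁿ|C|x⟩|`. -/
def Circuit.absAmplitude {n : ℕ} (C : Circuit n) (x : Fin n → Bool) : ℝ :=
  ‖C.run (ket x) (fun _ => false)‖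

/-! ### CNF formulas -/

/-- A CNF formula on `n` variables: a list of clauses, each of them a list of literals. The literal
`(v, true)` is the variable `v`, the literal `(v, false)` is its negation. -/
abbrev CNF (n : ℕ) : Type := List (List (Fin n × Bool))

/-- The truth value of a formula under an assignment. -/
def CNF.eval {n : ℕ} (φ : CNF n) (x : Fin n → Bool) : Bool :=
  φ.all fun cl => cl.any fun l => x l.1 == l.2

/-- The number of satisfying assignments. -/
def CNF.count {n : ℕ} (φ : CNF n) : ℕ :=
  (Finset.univ.filter fun x : Fin n → Bool => φ.eval x = true).card

/-! ### Quantum algorithms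

A quantum algorithm is a program for a classical random access machine with a quantum memory.
The classical memory consists of banks `0, 1, 2, …`, each with cells `0, 1, 2, …` that hold natural
numbers; cell `0` of bank `r` also serves as register `r`. The quantum memory has a qubit `(b, j)`
for every bank `b` and every index `j`. Every operation is charged its logarithmic cost: one plus
the binary lengths of the numbers it handles. -/

/-- Instructions. In `gate g`, the wire `(b, a)` of `g` stands for the qubit of bank `b` whose index
is the content of register `a`. -/
inductive Instr : Type
  | const (r c : ℕ)
  | add (r a b : ℕ)
  | sub (r a b : ℕ)
  | half (r a : ℕ)
  | load (r b a : ℕ)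
  | store (b a r : ℕ)
  | gate (g : Gate (ℕ × ℕ))

/-- Programs. `measure r b a` measures the qubit of bank `b` whose index is in register `a` and puts
the outcome into register `r`. `cond r` branches on, and `loop r` repeats while, register `r` is
nonzero. `call b P` runs the procedure `P` with fresh local memory (zero cells and qubits in state
`|0⟩`), except that bank `0` of `P` is bank `b` of the caller, passed by reference. -/
inductive Prog : Type
  | skip
  | instr (i : Instr)
  | measure (r b a : ℕ)
  | seq (P P' : Prog)
  | cond (r : ℕ) (P P' : Prog)
  | loop (r : ℕ) (P : Prog)
  | call (b : ℕ) (P : Prog)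

/-- Configurations: the classical memory (bank, then cell), the state of the quantum memory, and
the time spent so far. -/
structure Config : Type where
  mem : ℕ → ℕ → ℕ
  qubits : Amp (ℕ × ℕ)
  time : ℕ

/-- The content of register `r`. -/
def Config.reg (σ : Config) (r : ℕ) : ℕ := σ.mem r 0

/-- Write `v` into cell `j` of bank `b`. -/
def Config.write (σ : Config) (b j v : ℕ) : Config :=
  { σ with mem := Function.update σ.mem b (Function.update (σ.mem b) j v) }

/-- Let `t` units of time pass. -/
def Config.tick (σ : Config) (t : ℕ) : Config := { σ with time := σ.time + t }

/-- The quantum memory with all qubits in state `|0⟩`. -/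
def zeroQubits : Amp (ℕ × ℕ) :=
  open Classical in ket fun _ => false

/-- The effect of an instruction. -/
def Instr.exec (σ : Config) : Instr → Config
  | .const r c => (σ.write r 0 c).tick (1 + c.size)
  | .add r a b =>
      (σ.write r 0 (σ.reg a + σ.reg b)).tick (1 + (σ.reg a).size + (σ.reg b).size)
  | .sub r a b =>
      (σ.write r 0 (σ.reg a - σ.reg b)).tick (1 + (σ.reg a).size + (σ.reg b).size)
  | .half r a => (σ.write r 0 (σ.reg a / 2)).tick (1 + (σ.reg a).size)
  | .load r b a =>
      (σ.write r 0 (σ.mem b (σ.reg a))).tick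
        (1 + (σ.reg a).size + (σ.mem b (σ.reg a)).size)
  | .store b a r =>
      (σ.write b (σ.reg a) (σ.reg r)).tick (1 + (σ.reg a).size + (σ.reg r).size)
  | .gate g =>
      ({ σ with qubits := (g.map fun w => (w.1, σ.reg w.2)).apply σ.qubits } : Config).tick
        (1 + (g.wires.map fun w => (σ.reg w.2).size).sum)

/-- The probability of the outcome `o` when qubit `q` is measured in the state `ψ`. -/
def outcomeProb (ψ : Amp (ℕ × ℕ)) (q : ℕ × ℕ) (o : Bool) : ℝ≥0∞ :=
  ∑' x : ℕ × ℕ → Bool, if x q = o then ENNReal.ofReal (‖ψ x‖ ^ 2) else 0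

/-- The normalized state after outcome `o`. -/
def collapse (ψ : Amp (ℕ × ℕ)) (q : ℕ × ℕ) (o : Bool) : Amp (ℕ × ℕ) :=
  fun x => if x q = o then ψ x / (Real.sqrt (outcomeProb ψ q o).toReal : ℂ) else 0

/-- `P.expect f σ` is the expectation, over the measurement outcomes, of the value of `f` at the
final configuration when `P` is started in `σ`; runs that do not halt contribute `0`. In the case of
a loop, the `k`-th function takes into account the runs in which the body is executed less than
`k` times. -/
def Prog.expect : Prog → (Config → ℝ≥0∞) → Config → ℝ≥0∞
  | .skip, f, σ => f σ
  | .instr i, f, σ => f (i.exec σ)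
  | .measure r b a, f, σ =>
      ∑ o : Bool, outcomeProb σ.qubits (b, σ.reg a) o *
        f ((({ σ with qubits := collapse σ.qubits (b, σ.reg a) o } : Config).write r 0
          o.toNat).tick (1 + (σ.reg a).size))
  | .seq P P', f, σ => P.expect (fun τ => P'.expect f τ) σ
  | .cond r P P', f, σ =>
      if σ.reg r ≠ 0 then P.expect f (σ.tick (1 + (σ.reg r).size))
      else P'.expect f (σ.tick (1 + (σ.reg r).size))
  | .loop r P, f, σ =>
      ⨆ k : ℕ, Nat.rec (motive := fun _ => Config → ℝ≥0∞) (fun _ => 0)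
        (fun _ rest τ =>
          if τ.reg r ≠ 0 then P.expect rest (τ.tick (1 + (τ.reg r).size))
          else f (τ.tick (1 + (τ.reg r).size))) k σ
  | .call b P, f, σ =>
      P.expect
        (fun τ => f { mem := Function.update σ.mem b (τ.mem 0)
                      qubits := σ.qubits
                      time := τ.time })
        { mem := fun a => if a = 0 then σ.mem b else fun _ => 0
          qubits := zeroQubits
          time := σ.time + 1 }

/-- The initial configuration on the input `w`, which is written into bank `0`. -/
def start (w : List ℕ) : Config where
  mem := fun b j => if b = 0 then w.getD j 0 else 0
  qubits := zeroQubits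
  time := 0

/-- On input `w` the program `P` halts with probability one, its final configuration is `good` with
probability at least `2/3`, and its expected running time is at most `t`. -/
def Prog.Succeeds (P : Prog) (w : List ℕ) (good : Config → Prop) (t : ℝ) : Prop :=
  P.expect (fun _ => 1) (start w) = 1 ∧
  2 / 3 ≤ P.expect (Set.indicator {τ | good τ} fun _ => 1) (start w) ∧
  P.expect (fun τ => (τ.time : ℝ≥0∞)) (start w) ≤ ENNReal.ofReal t

/-! ### Inputs -/

/-- A formula as a list of numbers: the number of variables, the number of clauses, and the clauses,
each of them preceded by its length. -/
def CNF.encode {n : ℕ} (φ : CNF n) : List ℕ :=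
  [n, φ.length] ++
    φ.flatMap fun cl => cl.length :: cl.map fun l => 2 * (l.1 : ℕ) + l.2.toNat

/-- The size of a formula: variables, clauses and literals. -/
def CNF.size {n : ℕ} (φ : CNF n) : ℕ := n + φ.length + (φ.map List.length).sum

/-- A gate as a list of four numbers. -/
def Gate.encode {n : ℕ} : Gate (Fin n) → List ℕ
  | .X i => [0, i, 0, 0]
  | .H i => [1, i, 0, 0]
  | .T i => [2, i, 0, 0]
  | .CNOT c t => [3, c, t, 0]
  | .TOFFOLI a b t => [4, a, b, t]

/-- A circuit `C` and a basis state `x` as a list of numbers: the number of qubits, the number of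
gates, the bits of `x`, and the gates. -/
def Circuit.encode {n : ℕ} (C : Circuit n) (x : Fin n → Bool) : List ℕ :=
  [n, C.length] ++ List.ofFn (fun i => (x i).toNat) ++ C.flatMap fun g => g.encode

/-- The size of a circuit: qubits and gates. -/
def Circuit.size {n : ℕ} (C : Circuit n) : ℕ := n + C.length

/-! ### The two problems and their hardness -/

/-- `d` approximates `v ≥ 0` with multiplicative error `γ`: `(1-γ)v < d < (1+γ)v`, and `d = 0` in
the case `v = 0`, in which the open interval is empty. -/
def MulApprox (γ v d : ℝ) : Prop :=
  if v = 0 then d = 0 else (1 - γ) * v < d ∧ d < (1 + γ) * v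

/-- The interval `[2⁻ⁿ, 0.4999)` of error parameters. -/
def errorRange (n : ℕ) : Set ℝ := Set.Ico (1 / 2 ^ n) 0.4999

/-- `max {1, (1/γ)√((2ⁿ-h)/h)}`. -/
def approxTime (n : ℕ) (γ h : ℝ) : ℝ := max 1 (1 / γ * Real.sqrt ((2 ^ n - h) / h))

/-- The assertion of `γ`-#QSETH for an error parameter `γ = γ(n)`: for each `δ > 0` there is `c > 0`
such that no bounded-error quantum algorithm solves `γ`-#CNFSAT on the formulas with at most `c n²`
clauses in time polynomial in the size of the formula times `max {1, (1/γ)√((2ⁿ-h)/h)} ^ (1-δ)` if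
`γ h > 1` and times `2 ^ (n(1-δ))` otherwise, where `h` is the number of satisfying assignments.
The output is the integer in register `0`. -/
def GammaSharpQSETH (γ : ℕ → ℝ) : Prop :=
  ∀ δ : ℝ, 0 < δ → ∃ c : ℝ, 0 < c ∧
    ¬ ∃ (A : Prog) (p : Polynomial ℕ), ∀ n : ℕ, γ n ∈ errorRange n →
      ∀ φ : CNF n, (φ.length : ℝ) ≤ c * (n : ℝ) ^ 2 →
        A.Succeeds φ.encode
          (fun τ => MulApprox (γ n) φ.count (τ.mem 0 0))
          ((p.eval φ.size : ℕ) *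
            (if 1 < γ n * φ.count then approxTime n (γ n) φ.count else 2 ^ n) ^ (1 - δ))

/-- No bounded-error quantum algorithm solves strong simulation with multiplicative error
`γ = γ(n)` in time polynomial in the size of the circuit times
`max {1, (1/γ)√((2ⁿ-h)/h)} ^ (1-δ)` if `γ h ≥ 1` and times `2 ^ (n(1-δ))` otherwise, where
`h = 2ⁿ |⟨0ⁿ|C|x⟩|`, whatever `δ > 0`.
The output is the quotient of the numbers in the first two cells of bank `0`. -/
def StrongSimulationHard (γ : ℕ → ℝ) : Prop :=
  ∀ δ : ℝ, 0 < δ →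
    ¬ ∃ (A : Prog) (p : Polynomial ℕ), ∀ n : ℕ, γ n ∈ errorRange n →
      ∀ (C : Circuit n) (x : Fin n → Bool),
        A.Succeeds (C.encode x)
          (fun τ => MulApprox (γ n) (C.absAmplitude x) ((τ.mem 0 0 : ℝ) / (τ.mem 0 1 : ℝ)))
          ((p.eval C.size : ℕ) *
            (if 1 ≤ γ n * (C.absAmplitude x * 2 ^ n)
              then approxTime n (γ n) (C.absAmplitude x * 2 ^ n) else 2 ^ n) ^ (1 - δ))

end QSim

end

/-!
# Hardness of strong simulation from the hardness of approximate counting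

Both parts are proved by contraposition: a fast strong simulation `A` is turned into a fast
algorithm that approximates the number `#φ` of satisfying assignments of a formula `φ`.

**The circuit.** For a formula `φ` in `n` variables, a number `a < 2 ^ (n + 1)` and any `p` there is
a circuit of polynomial size on `n + 5 + p` qubits whose amplitude `⟨0|C|0⟩` has the absolute value
`|#φ - a| / 2 ^ (n + 2)` (`shiftCircuit_absAmplitude`). It is essential that the number of qubits
exceeds `n` by a constant only, since the running time allowed to the simulation is exponential in
it. Thus no ancilla can be spent on each clause. A conjunction is evaluated with three work qubits
instead, by a commutator identity (`Adds.and`) whose recursive use leads to quadratically many gates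
(`andOps`). The subtraction of `a` is done by interference: a formula in `n + 2` variables is
evaluated between two layers of Hadamard gates, and one of these variables, the sign, has a phase
attached to it (`hadamard_conj`). The assignments with sign `0` stand for the solutions of `φ`, those
with sign `1` for exactly `a` strings, which are described by a formula too (`Leads`,
`signed_count`).

**Estimating a distance.** The quotient produced by `A` for this circuit, multiplied by `2 ^ (n + 2)`
and rounded, is within `γ * |#φ - a| + 1 / 2` of `|#φ - a|` with probability `2 / 3`
(`sampleProg_spec`). The good values form an interval. A binary search that decides each comparison
by a majority of fresh samples therefore finds a good value, and fails with exponentially small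
probability (`votes_spec`, `searchProg_spec`).

**Removing the rounding error.** The distance to `#φ` is estimated for a sequence of numbers `a`
that approach `#φ` from below (`countProg`, `Plan`).

* For a constant `γ` they are `0, 1, …, K` with `K = ⌊1 / γ⌋`. If `#φ ≤ K`, one of the distances is
  zero, and this is recognized. Otherwise the last estimate plus `K` is the output; its error is less
  than `γ * (#φ - K) + 1 / 2`, and `γ * K > 1 / 2` (`constant_plan`). In the time bound, `K` idle
  qubits bring `2 ^ N` times the amplitude into the regime in which the faster time is granted, and
  both the additional qubits and the shift cost a constant factor only (`simBound_shift_le`).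
* If all error parameters are admitted, it suffices to refute the hypothesis for the smallest one,
  `2⁻ⁿ`, where the time allowed is always `2 ^ (n * (1 - δ))`. This leaves time to find `#φ` exactly:
  each step advances `a` by half of the estimated distance, and as the error is below `0.4999` this
  removes at least a quarter of the distance (`halving_plan`).

**The programs.** All of this has to be carried out by a program in the given machine model. The code
around the simulation is deterministic; the predicate `Det` counts unit steps and derives the
logarithmic cost from the fact that a unit step lengthens numbers by one bit at most. Randomized code
is handled by `Spec`, which adds up failure probabilities and expected times. The numbers that `A`
produces are not bounded in advance, but writing long numbers takes time, so that their expected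
length is bounded by the expected running time of `A` (`Prog.expect_le_of_size`, `Spec.call_det`).
The pieces are put together in `exists_countProg`.
-/

open scoped ENNReal

noncomputable section

namespace QSim

/-! ### The expectation transformer -/

/-- The contribution to the expectation of `f` after `loop r P` of the runs in which the body is
executed less than `k` times. -/
def Prog.loopApprox (r : ℕ) (P : Prog) (f : Config → ℝ≥0∞) : ℕ → Config → ℝ≥0∞
  | 0 => fun _ => 0
  | k + 1 => fun τ =>
      if τ.reg r ≠ 0 then P.expect (P.loopApprox r f k) (τ.tick (1 + (τ.reg r).size))
      else f (τ.tick (1 + (τ.reg r).size))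

theorem Prog.expect_loop (r : ℕ) (P : Prog) (f : Config → ℝ≥0∞) (σ : Config) :
    (Prog.loop r P).expect f σ = ⨆ k, P.loopApprox r f k σ := by
  have h : ∀ k, P.loopApprox r f k = Nat.rec (motive := fun _ => Config → ℝ≥0∞) (fun _ => 0)
        (fun _ rest τ =>
          if τ.reg r ≠ 0 then P.expect rest (τ.tick (1 + (τ.reg r).size))
          else f (τ.tick (1 + (τ.reg r).size))) k := by
    intro k
    induction k with
    | zero => rfl
    | succ k ih => simp only [Prog.loopApprox, ih]
  simp only [Prog.expect, h]

theorem Prog.expect_mono (P : Prog) : ∀ {f g : Config → ℝ≥0∞}, (∀ τ, f τ ≤ g τ) →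
    ∀ σ, P.expect f σ ≤ P.expect g σ := by
  induction P with
  | skip => intro f g h σ; exact h σ
  | instr i => intro f g h σ; exact h _
  | measure r b a =>
    intro f g h σ
    simp only [Prog.expect]
    exact Finset.sum_le_sum fun o _ => mul_le_mul_right (h _) _
  | seq P P' ih ih' => intro f g h σ; exact ih (fun τ => ih' h τ) σ
  | cond r P P' ih ih' =>
    intro f g h σ
    simp only [Prog.expect]
    split_ifs
    · exact ih h _
    · exact ih' h _
  | loop r P ih =>
    intro f g h σ
    rw [Prog.expect_loop, Prog.expect_loop]
    refine iSup_mono fun k => ?_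
    induction k generalizing σ with
    | zero => exact le_rfl
    | succ k ihk =>
      simp only [Prog.loopApprox]
      split_ifs
      · exact ih ihk _
      · exact h _
  | call b P ih => intro f g h σ; exact ih (fun τ => h _) _

theorem Prog.loopApprox_mono (r : ℕ) (P : Prog) (f : Config → ℝ≥0∞) :
    Monotone (P.loopApprox r f) := by
  refine monotone_nat_of_le_succ fun k => ?_
  induction k with
  | zero => intro σ; exact zero_le
  | succ k ih =>
    intro σ
    rw [Prog.loopApprox, Prog.loopApprox]
    dsimp only
    split_ifs
    · exact P.expect_mono ih _
    · exact le_rfl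

/-- Monotone convergence. -/
theorem Prog.expect_iSup (P : Prog) : ∀ {F : ℕ → Config → ℝ≥0∞}, Monotone F →
    ∀ σ, P.expect (fun τ => ⨆ n, F n τ) σ = ⨆ n, P.expect (F n) σ := by
  induction P with
  | skip => intro F _ σ; rfl
  | instr i => intro F _ σ; rfl
  | measure r b a =>
    intro F hF σ
    simp only [Prog.expect, ENNReal.mul_iSup]
    exact ENNReal.finsetSum_iSup_of_monotone fun o m n hmn =>
      mul_le_mul_right (hF hmn _) _
  | seq P P' ih ih' =>
    intro F hF σ
    simp only [Prog.expect, ih' hF]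
    exact ih (F := fun n τ => P'.expect (F n) τ)
      (fun m n hmn τ => P'.expect_mono (fun υ => hF hmn υ) τ) σ
  | cond r P P' ih ih' =>
    intro F hF σ
    simp only [Prog.expect]
    split_ifs
    · exact ih hF _
    · exact ih' hF _
  | loop r P ih =>
    intro F hF σ
    simp only [Prog.expect_loop]
    rw [iSup_comm]
    refine iSup_congr fun k => ?_
    have mono : ∀ k, Monotone fun n => P.loopApprox r (F n) k := by
      intro k
      induction k with
      | zero => intro m n _ τ; exact le_rfl
      | succ k ihk =>
        intro m n hmn τ
        simp only [Prog.loopApprox]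
        split_ifs
        · exact P.expect_mono (fun υ => ihk hmn υ) _
        · exact hF hmn _
    induction k generalizing σ with
    | zero => simp [Prog.loopApprox]
    | succ k ihk =>
      simp only [Prog.loopApprox]
      split_ifs
      · rw [← ih (mono k)]
        congr 1
        funext τ
        exact ihk τ
      · rfl
  | call b P ih =>
    intro F hF σ
    simp only [Prog.expect]
    exact ih (F := fun n τ => F n { mem := Function.update σ.mem b (τ.mem 0)
                                    qubits := σ.qubits, time := τ.time })
      (fun m n hmn τ => hF hmn _) _

/-- Executing the body once: the expectation is a fixed point, by monotone convergence. -/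
theorem Prog.expect_loop_unfold (r : ℕ) (P : Prog) (f : Config → ℝ≥0∞) (σ : Config) :
    (Prog.loop r P).expect f σ =
      if σ.reg r ≠ 0 then
        P.expect ((Prog.loop r P).expect f) (σ.tick (1 + (σ.reg r).size))
      else f (σ.tick (1 + (σ.reg r).size)) := by
  have h : (Prog.loop r P).expect f = fun τ => ⨆ k, P.loopApprox r f k τ := by
    funext τ; exact P.expect_loop r f τ
  rw [h]
  dsimp only
  have h2 : ⨆ k, P.loopApprox r f k σ = ⨆ k, P.loopApprox r f (k + 1) σ :=
    (Monotone.iSup_nat_add (f := fun k => P.loopApprox r f k σ)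
      (fun _ _ h => Prog.loopApprox_mono r P f h σ) 1).symm
  rw [h2]
  simp only [Prog.loopApprox]
  split_ifs with h0
  · rw [P.expect_iSup (Prog.loopApprox_mono r P f)]
  · simp

theorem Prog.expect_add (P : Prog) : ∀ (f g : Config → ℝ≥0∞) (σ : Config),
    P.expect (fun τ => f τ + g τ) σ = P.expect f σ + P.expect g σ := by
  induction P with
  | skip => intro f g σ; rfl
  | instr i => intro f g σ; rfl
  | measure r b a =>
    intro f g σ
    simp only [Prog.expect, mul_add, Finset.sum_add_distrib]
  | seq P P' ih ih' => intro f g σ; simp only [Prog.expect, ih', ih]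
  | cond r P P' ih ih' =>
    intro f g σ
    simp only [Prog.expect]
    split_ifs
    · exact ih _ _ _
    · exact ih' _ _ _
  | loop r P ih =>
    intro f g σ
    simp only [Prog.expect_loop]
    have mono : ∀ f : Config → ℝ≥0∞, Monotone fun k => P.loopApprox r f k σ :=
      fun f m n h => Prog.loopApprox_mono r P f h σ
    rw [ENNReal.iSup_add_iSup_of_monotone (mono f) (mono g)]
    refine iSup_congr fun k => ?_
    clear mono
    induction k generalizing σ with
    | zero => simp [Prog.loopApprox]
    | succ k ihk =>
      simp only [Prog.loopApprox]
      split_ifs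
      · rw [← ih]
        congr 1
        funext τ
        exact ihk τ
      · rfl
  | call b P ih => intro f g σ; exact ih _ _ _

theorem Prog.expect_const_mul (P : Prog) : ∀ (c : ℝ≥0∞) (f : Config → ℝ≥0∞) (σ : Config),
    P.expect (fun τ => c * f τ) σ = c * P.expect f σ := by
  induction P with
  | skip => intro c f σ; rfl
  | instr i => intro c f σ; rfl
  | measure r b a =>
    intro c f σ
    simp only [Prog.expect, Finset.mul_sum]
    exact Finset.sum_congr rfl fun o _ => by ring
  | seq P P' ih ih' => intro c f σ; simp only [Prog.expect, ih', ih]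
  | cond r P P' ih ih' =>
    intro c f σ
    simp only [Prog.expect]
    split_ifs
    · exact ih _ _ _
    · exact ih' _ _ _
  | loop r P ih =>
    intro c f σ
    simp only [Prog.expect_loop, ENNReal.mul_iSup]
    refine iSup_congr fun k => ?_
    induction k generalizing σ with
    | zero => simp [Prog.loopApprox]
    | succ k ihk =>
      simp only [Prog.loopApprox]
      split_ifs
      · rw [← ih]
        congr 1
        funext τ
        exact ihk τ
      · rfl
  | call b P ih => intro c f σ; exact ih _ _ _

theorem Config.tick_tick (σ : Config) (s t : ℕ) : (σ.tick s).tick t = (σ.tick t).tick s := by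
  simp [Config.tick, Nat.add_right_comm]

/-- The clock is never read: starting with a later clock just shifts the final clock. -/
theorem Prog.expect_tick (P : Prog) : ∀ (f : Config → ℝ≥0∞) (t : ℕ) (σ : Config),
    P.expect f (σ.tick t) = P.expect (fun τ => f (τ.tick t)) σ := by
  induction P with
  | skip => intro f t σ; rfl
  | instr i =>
    intro f t σ
    simp only [Prog.expect]
    congr 1
    cases i <;> simp [Instr.exec, Config.tick, Config.reg, Config.write, Nat.add_right_comm]
  | measure r b a =>
    intro f t σ
    simp only [Prog.expect]
    refine Finset.sum_congr rfl fun o _ => ?_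
    simp only [Config.tick, Config.reg, Config.write, Nat.add_right_comm]
  | seq P P' ih ih' => intro f t σ; simp only [Prog.expect, ih, ih']
  | cond r P P' ih ih' =>
    intro f t σ
    simp only [Prog.expect, Config.tick_tick σ t, ih, ih']
    rfl
  | loop r P ih =>
    intro f t σ
    simp only [Prog.expect_loop]
    refine iSup_congr fun k => ?_
    induction k generalizing σ with
    | zero => rfl
    | succ k ihk =>
      simp only [Prog.loopApprox, Config.tick_tick σ t]
      have h : (σ.tick t).reg r = σ.reg r := rfl
      rw [h]
      split_ifs
      · rw [ih]
        congr 1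
        funext τ
        exact ihk τ
      · rw [Config.tick_tick]
  | call b P ih =>
    intro f t σ
    simp only [Prog.expect]
    have h : ({ mem := fun a => if a = 0 then (σ.tick t).mem b else fun _ => 0
                qubits := zeroQubits
                time := (σ.tick t).time + 1 } : Config) =
        ({ mem := fun a => if a = 0 then σ.mem b else fun _ => 0
           qubits := zeroQubits
           time := σ.time + 1 } : Config).tick t := by
      simp [Config.tick, Nat.add_right_comm]
    rw [h, ih]
    rfl

/-- All cells hold numbers of binary length at most `z`. -/
def SizeLE (m : ℕ → ℕ → ℕ) (z : ℕ) : Prop := ∀ b j, (m b j).size ≤ z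

theorem SizeLE.mono {m : ℕ → ℕ → ℕ} {y z : ℕ} (h : SizeLE m y) (hyz : y ≤ z) : SizeLE m z :=
  fun b j => (h b j).trans hyz

theorem SizeLE.update {m : ℕ → ℕ → ℕ} {z b j v : ℕ} (h : SizeLE m z) (hv : v.size ≤ z) :
    SizeLE (Function.update m b (Function.update (m b) j v)) z := by
  intro b' j'
  by_cases hb : b' = b
  · subst hb
    by_cases hj : j' = j
    · subst hj; simpa using hv
    · simpa [hj] using h b' j'
  · simpa [hb] using h b' j'

theorem size_add_le (a b : ℕ) : (a + b).size ≤ max a.size b.size + 1 := by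
  rw [Nat.size_le]
  have ha := Nat.lt_size_self a
  have hb := Nat.lt_size_self b
  have ha' := Nat.pow_le_pow_right (n := 2) (by norm_num) (le_max_left a.size b.size)
  have hb' := Nat.pow_le_pow_right (n := 2) (by norm_num) (le_max_right a.size b.size)
  rw [pow_succ]
  omega

theorem size_half_le (a : ℕ) : (a / 2).size ≤ a.size := Nat.size_le_size (Nat.div_le_self _ _)

/-- Writing a long number takes long: the binary lengths of the cells exceed those at the start by
the running time at most. Hence two integrands need only be compared where this holds. The lower
bound `t₀` for the time serves the induction: on return from a procedure the memory of the caller is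
restored, and its bound, which refers to the time of the call, has to be still valid. -/
theorem Prog.expect_le_of_size (P : Prog) (M : ℕ) : ∀ {f g : Config → ℝ≥0∞} (t₀ : ℕ),
    (∀ τ : Config, SizeLE τ.mem (M + τ.time) → t₀ ≤ τ.time → f τ ≤ g τ) →
    ∀ σ : Config, SizeLE σ.mem (M + σ.time) → t₀ ≤ σ.time → P.expect f σ ≤ P.expect g σ := by
  have tick : ∀ (σ : Config) (t : ℕ), SizeLE σ.mem (M + σ.time) →
      SizeLE (σ.tick t).mem (M + (σ.tick t).time) := fun σ t h =>
    h.mono (by change M + σ.time ≤ M + (σ.time + t); omega)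
  have write : ∀ (σ : Config) (b j v t : ℕ), SizeLE σ.mem (M + σ.time) →
      v.size ≤ M + (σ.time + t) →
      SizeLE ((σ.write b j v).tick t).mem (M + ((σ.write b j v).tick t).time) :=
    fun σ b j v t h hv => (h.mono (by change M + σ.time ≤ M + (σ.time + t); omega)).update hv
  induction P with
  | skip => intro f g t₀ h σ hσ ht; exact h σ hσ ht
  | instr i =>
    intro f g t₀ h σ hσ ht
    have hr : ∀ r, (σ.reg r).size ≤ M + σ.time := fun r => hσ r 0
    refine h _ ?_ ?_
    · cases i with
      | const r c => exact write σ _ _ _ _ hσ (by omega)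
      | add r a b =>
        have := size_add_le (σ.reg a) (σ.reg b)
        have ha := hr a
        have hb := hr b
        exact write σ _ _ _ _ hσ (by omega)
      | sub r a b =>
        have := Nat.size_le_size (Nat.sub_le (σ.reg a) (σ.reg b))
        have ha := hr a
        exact write σ _ _ _ _ hσ (by omega)
      | half r a =>
        have := size_half_le (σ.reg a)
        have ha := hr a
        exact write σ _ _ _ _ hσ (by omega)
      | load r b a =>
        have := hσ b (σ.reg a)
        exact write σ _ _ _ _ hσ (by omega)
      | store b a r =>
        have := hr r
        exact write σ _ _ _ _ hσ (by omega)
      | gate g => exact tick ⟨σ.mem, _, σ.time⟩ _ hσ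
    · cases i <;> exact ht.trans (Nat.le_add_right _ _)
  | measure r b a =>
    intro f g t₀ h σ hσ ht
    simp only [Prog.expect]
    refine Finset.sum_le_sum fun o _ => mul_le_mul_right (h _ ?_ ?_) _
    · refine write ⟨σ.mem, _, σ.time⟩ _ _ _ _ hσ ?_
      have : o.toNat.size ≤ 1 := by cases o <;> simp
      dsimp only
      omega
    · exact ht.trans (Nat.le_add_right _ _)
  | seq P P' ih ih' =>
    intro f g t₀ h σ hσ ht
    exact ih t₀ (fun τ hτ hτ' => ih' t₀ h τ hτ hτ') σ hσ ht
  | cond r P P' ih ih' =>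
    intro f g t₀ h σ hσ ht
    simp only [Prog.expect]
    split_ifs
    · exact ih t₀ h _ (tick σ _ hσ) (ht.trans (Nat.le_add_right _ _))
    · exact ih' t₀ h _ (tick σ _ hσ) (ht.trans (Nat.le_add_right _ _))
  | loop r P ih =>
    intro f g t₀ h σ hσ ht
    rw [Prog.expect_loop, Prog.expect_loop]
    refine iSup_mono fun k => ?_
    induction k generalizing σ with
    | zero => exact le_rfl
    | succ k ihk =>
      simp only [Prog.loopApprox]
      split_ifs
      · exact ih t₀ ihk _ (tick σ _ hσ) (ht.trans (Nat.le_add_right _ _))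
      · exact h _ (tick σ _ hσ) (ht.trans (Nat.le_add_right _ _))
  | call b P ih =>
    intro f g t₀ h σ hσ ht
    simp only [Prog.expect]
    let ret : Config → Config := fun τ =>
      { mem := Function.update σ.mem b (τ.mem 0), qubits := σ.qubits, time := τ.time }
    refine ih (f := fun τ => f (ret τ)) (g := fun τ => g (ret τ)) σ.time
      (fun τ hτ hτ' => h (ret τ) ?_ (ht.trans hτ')) _ ?_ (Nat.le_succ σ.time)
    · intro b' j
      by_cases hb : b' = b
      · subst hb; simpa [ret] using hτ 0 j
      · simpa [ret, hb] using (hσ b' j).trans (by omega)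
    · intro b' j
      by_cases hb : b' = 0
      · subst hb; simpa using (hσ b j).trans (by omega)
      · simp [hb]

/-! ### Deterministic classical code -/

/-- The contents of the classical memory: bank, then cell. -/
abbrev Mem : Type := ℕ → ℕ → ℕ

/-- Write `v` into cell `j` of bank `b`. -/
def upd (m : Mem) (b j v : ℕ) : Mem := Function.update m b (Function.update (m b) j v)

@[simp] theorem upd_self (m : Mem) (b j v : ℕ) : upd m b j v b = Function.update (m b) j v := by
  simp [upd]

theorem upd_of_ne (m : Mem) {b b' : ℕ} (j v : ℕ) (h : b' ≠ b) : upd m b j v b' = m b' := by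
  simp [upd, h]

/-- The effect of a classical instruction on the memory. -/
def Instr.memExec (m : Mem) : Instr → Mem
  | .const r c => upd m r 0 c
  | .add r a b => upd m r 0 (m a 0 + m b 0)
  | .sub r a b => upd m r 0 (m a 0 - m b 0)
  | .half r a => upd m r 0 (m a 0 / 2)
  | .load r b a => upd m r 0 (m b (m a 0))
  | .store b a r => upd m b (m a 0) (m r 0)
  | .gate _ => m

/-- Whether an instruction leaves the quantum memory alone. -/
def Instr.isClassical : Instr → Bool
  | .gate _ => false
  | _ => true

/-- The number of unit steps charged for an instruction: constants are charged their length. -/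
def Instr.steps : Instr → ℕ
  | .const _ c => 1 + c.size
  | _ => 1

/-- Straight-line code. -/
def blk : List Instr → Prog
  | [] => .skip
  | i :: l => .seq (.instr i) (blk l)

/-- The effect of straight-line classical code on the memory. -/
def execs : List Instr → Mem → Mem
  | [], m => m
  | i :: l, m => execs l (i.memExec m)

/-- The unit steps of straight-line code. -/
def blkSteps : List Instr → ℕ
  | [] => 0
  | i :: l => i.steps + blkSteps l

/-- Started with memory `m`, the code `P` runs deterministically, without touching the quantum
memory, within `k` unit steps, and ends with a memory satisfying `R`. Unit steps bound the
logarithmic cost because a step lengthens the numbers in memory by at most one bit: if at the start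
all numbers have length at most `z`, then each of the steps costs at most `2 * (z + k) + 1`. -/
def Det (P : Prog) (m : Mem) (k : ℕ) (R : Mem → Prop) : Prop :=
  ∃ m' t, R m' ∧ (∀ q s f, P.expect f ⟨m, q, s⟩ = f ⟨m', q, s + t⟩) ∧
    ∀ z, SizeLE m z → t ≤ k * (2 * (z + k) + 1) ∧ SizeLE m' (z + k)

theorem Det.mono {P : Prog} {m : Mem} {k k' : ℕ} {R R' : Mem → Prop} (h : Det P m k R)
    (hk : k ≤ k') (hR : ∀ m', R m' → R' m') : Det P m k' R' := by
  obtain ⟨m', t, h1, h2, h3⟩ := h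
  refine ⟨m', t, hR _ h1, h2, fun z hz => ⟨(h3 z hz).1.trans ?_, (h3 z hz).2.mono (by omega)⟩⟩
  exact Nat.mul_le_mul hk (by omega)

theorem Det.imp {P : Prog} {m : Mem} {k : ℕ} {R R' : Mem → Prop} (h : Det P m k R)
    (hR : ∀ m', R m' → R' m') : Det P m k R' := h.mono le_rfl hR

theorem Det.skip {m : Mem} {R : Mem → Prop} (h : R m) : Det .skip m 0 R :=
  ⟨m, 0, h, fun _ _ _ => rfl, fun z hz => ⟨by simp, hz⟩⟩

theorem Det.seq {P P' : Prog} {m : Mem} {k k' : ℕ} {R : Mem → Prop}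
    (h : Det P m k fun m' => Det P' m' k' R) : Det (.seq P P') m (k + k') R := by
  obtain ⟨m₁, t₁, ⟨m₂, t₂, h4, h5, h6⟩, h2, h3⟩ := h
  refine ⟨m₂, t₁ + t₂, h4, fun q s f => ?_, fun z hz => ?_⟩
  · simp only [Prog.expect, h2, h5, Nat.add_assoc]
  · obtain ⟨h7, h8⟩ := h3 z hz
    obtain ⟨h9, h10⟩ := h6 _ h8
    refine ⟨?_, h10.mono (by omega)⟩
    have e1 : k * (2 * (z + k) + 1) ≤ k * (2 * (z + (k + k')) + 1) :=
      Nat.mul_le_mul_left _ (by omega)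
    have e2 : k' * (2 * (z + k + k') + 1) ≤ k' * (2 * (z + (k + k')) + 1) :=
      Nat.mul_le_mul_left _ (by omega)
    rw [Nat.add_mul]
    omega

theorem Det.instr {i : Instr} {m : Mem} {R : Mem → Prop} (hi : i.isClassical = true)
    (h : R (i.memExec m)) : Det (.instr i) m i.steps R := by
  have key : ∀ t, (∀ q s f, Prog.expect (.instr i) f ⟨m, q, s⟩ = f ⟨i.memExec m, q, s + t⟩) →
      (∀ z, SizeLE m z → t ≤ i.steps * (2 * (z + i.steps) + 1) ∧
        SizeLE (i.memExec m) (z + i.steps)) → Det (.instr i) m i.steps R :=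
    fun t h1 h2 => ⟨_, t, h, h1, h2⟩
  cases i with
  | const r c =>
    refine key _ (fun q s f => rfl) fun z hz => ?_
    simp only [Instr.steps, Instr.memExec]
    exact ⟨Nat.le_mul_of_pos_right _ (by omega), (hz.mono (by omega)).update (by omega)⟩
  | add r a b =>
    refine key (1 + (m a 0).size + (m b 0).size)
      (fun q s f => by
        simp only [Prog.expect, Instr.exec, Config.tick, Config.write, Config.reg, upd,
          Instr.memExec]) fun z hz => ?_
    simp only [Instr.steps, Instr.memExec]
    have := size_add_le (m a 0) (m b 0)
    have ha := hz a 0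
    have hb := hz b 0
    exact ⟨by omega, (hz.mono (by omega)).update (by omega)⟩
  | sub r a b =>
    refine key (1 + (m a 0).size + (m b 0).size)
      (fun q s f => by
        simp only [Prog.expect, Instr.exec, Config.tick, Config.write, Config.reg, upd,
          Instr.memExec]) fun z hz => ?_
    simp only [Instr.steps, Instr.memExec]
    have := Nat.size_le_size (Nat.sub_le (m a 0) (m b 0))
    have ha := hz a 0
    have hb := hz b 0
    exact ⟨by omega, (hz.mono (by omega)).update (by omega)⟩
  | half r a =>
    refine key (1 + (m a 0).size)
      (fun q s f => by
        simp only [Prog.expect, Instr.exec, Config.tick, Config.write, Config.reg, upd,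
          Instr.memExec]) fun z hz => ?_
    simp only [Instr.steps, Instr.memExec]
    have := size_half_le (m a 0)
    have ha := hz a 0
    exact ⟨by omega, (hz.mono (by omega)).update (by omega)⟩
  | load r b a =>
    refine key (1 + (m a 0).size + (m b (m a 0)).size)
      (fun q s f => by
        simp only [Prog.expect, Instr.exec, Config.tick, Config.write, Config.reg, upd,
          Instr.memExec]) fun z hz => ?_
    simp only [Instr.steps, Instr.memExec]
    have ha := hz a 0
    have hb := hz b (m a 0)
    exact ⟨by omega, (hz.mono (by omega)).update (by omega)⟩
  | store b a r =>
    refine key (1 + (m a 0).size + (m r 0).size)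
      (fun q s f => by
        simp only [Prog.expect, Instr.exec, Config.tick, Config.write, Config.reg, upd,
          Instr.memExec]) fun z hz => ?_
    simp only [Instr.steps, Instr.memExec]
    have ha := hz a 0
    have hb := hz r 0
    exact ⟨by omega, (hz.mono (by omega)).update (by omega)⟩
  | gate g => simp [Instr.isClassical] at hi

/-- The hypothesis that all instructions are classical holds by computation for concrete code. -/
theorem Det.blk {l : List Instr} {m : Mem} {R : Mem → Prop}
    (h : R (execs l m)) (hl : l.all Instr.isClassical = true := by rfl) :
    Det (blk l) m (blkSteps l) R := by
  induction l generalizing m with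
  | nil => exact Det.skip h
  | cons i l ih =>
    simp only [List.all_cons, Bool.and_eq_true] at hl
    exact Det.seq (Det.instr hl.1 (ih h hl.2))

theorem Det.cond_true {r : ℕ} {P P' : Prog} {m : Mem} {k : ℕ} {R : Mem → Prop} (hr : m r 0 ≠ 0)
    (h : Det P m k R) : Det (.cond r P P') m (1 + k) R := by
  obtain ⟨m', t, h1, h2, h3⟩ := h
  refine ⟨m', 1 + (m r 0).size + t, h1, fun q s f => ?_, fun z hz => ?_⟩
  · simp only [Prog.expect, Config.reg, Config.tick, h2, ne_eq, hr, not_false_eq_true, if_true,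
      Nat.add_assoc]
  · obtain ⟨h4, h5⟩ := h3 z hz
    have := hz r 0
    refine ⟨?_, h5.mono (by omega)⟩
    have e1 : k * (2 * (z + k) + 1) ≤ k * (2 * (z + (1 + k)) + 1) :=
      Nat.mul_le_mul_left _ (by omega)
    rw [Nat.add_mul]
    omega

theorem Det.cond_false {r : ℕ} {P P' : Prog} {m : Mem} {k : ℕ} {R : Mem → Prop} (hr : m r 0 = 0)
    (h : Det P' m k R) : Det (.cond r P P') m (1 + k) R := by
  obtain ⟨m', t, h1, h2, h3⟩ := h
  refine ⟨m', 1 + (m r 0).size + t, h1, fun q s f => ?_, fun z hz => ?_⟩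
  · simp only [Prog.expect, Config.reg, Config.tick, h2, ne_eq, hr, not_true_eq_false, if_false,
      Nat.add_assoc]
  · obtain ⟨h4, h5⟩ := h3 z hz
    have := hz r 0
    refine ⟨?_, h5.mono (by omega)⟩
    have e1 : k * (2 * (z + k) + 1) ≤ k * (2 * (z + (1 + k)) + 1) :=
      Nat.mul_le_mul_left _ (by omega)
    rw [Nat.add_mul]
    omega

theorem Det.loop_true {r : ℕ} {P : Prog} {m : Mem} {k k' : ℕ} {R : Mem → Prop} (hr : m r 0 ≠ 0)
    (h : Det P m k fun m' => Det (.loop r P) m' k' R) : Det (.loop r P) m (1 + (k + k')) R := by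
  obtain ⟨m', t, h1, h2, h3⟩ := Det.cond_true (P' := .skip) hr (Det.seq h)
  refine ⟨m', t, h1, fun q s f => ?_, h3⟩
  rw [← h2 q s f, Prog.expect_loop_unfold]
  simp only [Prog.expect, Config.reg, ne_eq, hr, not_false_eq_true, if_true]

theorem Det.loop_false {r : ℕ} {P : Prog} {m : Mem} {R : Mem → Prop} (hr : m r 0 = 0) (h : R m) :
    Det (.loop r P) m 1 R := by
  obtain ⟨m', t, h1, h2, h3⟩ := Det.cond_false (P := .skip) (P' := .skip) hr (Det.skip h)
  refine ⟨m', t, h1, fun q s f => ?_, h3⟩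
  rw [← h2 q s f, Prog.expect_loop_unfold]
  simp only [Prog.expect, Config.reg, ne_eq, hr, not_true_eq_false, if_false]

/-- A loop, by an invariant `I c` in which `c` bounds the number of remaining unit steps. -/
theorem Det.loop {r : ℕ} {P : Prog} {R : Mem → Prop} (I : ℕ → Mem → Prop)
    (hI : ∀ c m, I c m → (m r 0 = 0 ∧ R m ∧ 1 ≤ c) ∨
      (m r 0 ≠ 0 ∧ ∃ c₁ c₂, 1 + c₁ + c₂ ≤ c ∧ Det P m c₁ (I c₂)))
    {c : ℕ} {m : Mem} (h : I c m) : Det (.loop r P) m c R := by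
  induction c using Nat.strong_induction_on generalizing m with
  | _ c ih =>
    rcases hI c m h with ⟨h0, h1, h2⟩ | ⟨h0, c₁, c₂, hc, h1⟩
    · exact (Det.loop_false h0 h1).mono h2 fun _ => id
    · refine (Det.loop_true h0 (h1.imp fun m' hm' => ih c₂ (by omega) hm')).mono (by omega)
        fun _ => id

/-! ### A union-bound logic for randomized code -/

/-- The indicator of the failure of `Q`; its expectation is the probability that `Q` fails. -/
def bad (Q : Mem → Prop) (m : Mem) : ℝ≥0∞ := open Classical in if Q m then 0 else 1

theorem bad_of {Q : Mem → Prop} {m : Mem} (h : Q m) : bad Q m = 0 := by simp [bad, h]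

theorem bad_of_not {Q : Mem → Prop} {m : Mem} (h : ¬ Q m) : bad Q m = 1 := by simp [bad, h]

theorem bad_le_one (Q : Mem → Prop) (m : Mem) : bad Q m ≤ 1 := by
  unfold bad; split_ifs <;> simp

theorem bad_mono {Q Q' : Mem → Prop} {m : Mem} (h : Q m → Q' m) : bad Q' m ≤ bad Q m := by
  unfold bad
  split_ifs <;> simp_all

/-- Started with memory `m`, the code `P` halts with probability one; its final memory surely
satisfies `I` and, except with probability `ε`, also `Q`; and its expected running time is at most
`T`. That `I` holds surely is expressed by saying that integrands need only be compared on final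
memories satisfying `I`. -/
structure Spec (P : Prog) (m : Mem) (I Q : Mem → Prop) (ε T : ℝ≥0∞) : Prop where
  halts : ∀ q s, P.expect (fun _ => 1) ⟨m, q, s⟩ = 1
  sure : ∀ q s (f g : Config → ℝ≥0∞), (∀ τ : Config, I τ.mem → f τ ≤ g τ) →
    P.expect f ⟨m, q, s⟩ ≤ P.expect g ⟨m, q, s⟩
  fail : ∀ q s, P.expect (fun τ => bad Q τ.mem) ⟨m, q, s⟩ ≤ ε
  time : ∀ q s, P.expect (fun τ => (τ.time : ℝ≥0∞)) ⟨m, q, s⟩ ≤ s + T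

theorem Prog.expect_const_of_halts {P : Prog} {σ : Config} (h : P.expect (fun _ => 1) σ = 1)
    (c : ℝ≥0∞) : P.expect (fun _ => c) σ = c := by
  have := P.expect_const_mul c (fun _ => 1) σ
  simpa [h] using this

theorem Spec.mono {P : Prog} {m : Mem} {I I' Q Q' : Mem → Prop} {ε ε' T T' : ℝ≥0∞}
    (h : Spec P m I Q ε T) (hI : ∀ m', I m' → I' m') (hQ : ∀ m', I m' → Q m' → Q' m')
    (hε : ε ≤ ε') (hT : T ≤ T') : Spec P m I' Q' ε' T' where
  halts := h.halts
  sure q s f g hfg := h.sure q s f g fun τ hτ => hfg τ (hI _ hτ)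
  fail q s := (h.sure q s _ _ fun τ hτ => bad_mono (hQ _ hτ)).trans ((h.fail q s).trans hε)
  time q s := (h.time q s).trans (by gcongr)

/-- The union bound: `P'` achieves `Q'` on the assumption that `P` has achieved `Q`. -/
theorem Spec.seq {P P' : Prog} {m : Mem} {I I' Q Q' : Mem → Prop} {ε ε' T T' : ℝ≥0∞}
    (h : Spec P m I Q ε T)
    (h' : ∀ m', I m' → Spec P' m' I' (fun m'' => Q m' → Q' m'') ε' T') :
    Spec (.seq P P') m I' Q' (ε + ε') (T + T') where
  halts q s := by
    simp only [Prog.expect]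
    refine le_antisymm ?_ ?_
    · exact (h.sure q s _ (fun _ => 1) fun τ hτ => ((h' τ.mem hτ).halts _ _).le).trans
        (h.halts q s).le
    · exact (h.halts q s).ge.trans
        (h.sure q s (fun _ => 1) _ fun τ hτ => ((h' τ.mem hτ).halts _ _).ge)
  sure q s f g hfg := h.sure q s _ _ fun τ hτ => (h' τ.mem hτ).sure _ _ f g hfg
  fail q s := by
    simp only [Prog.expect]
    calc _ ≤ P.expect (fun τ => bad Q τ.mem + ε') ⟨m, q, s⟩ := by
          refine h.sure q s _ _ fun τ hτ => ?_
          have h2 := h' τ.mem hτ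
          by_cases hQ : Q τ.mem
          · rw [bad_of hQ, zero_add]
            refine le_trans ?_ (h2.fail τ.qubits τ.time)
            exact P'.expect_mono (fun υ => bad_mono fun hh => hh hQ) _
          · rw [bad_of_not hQ]
            refine le_trans ?_ le_self_add
            exact (P'.expect_mono (fun υ => bad_le_one _ _) _).trans (h2.halts _ _).le
      _ = P.expect (fun τ => bad Q τ.mem) ⟨m, q, s⟩ + ε' := by
          rw [P.expect_add, Prog.expect_const_of_halts (h.halts q s)]
      _ ≤ ε + ε' := by gcongr; exact h.fail q s
  time q s := by
    simp only [Prog.expect]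
    calc _ ≤ P.expect (fun τ => (τ.time : ℝ≥0∞) + T') ⟨m, q, s⟩ :=
          h.sure q s _ _ fun τ hτ => (h' τ.mem hτ).time _ _
      _ = P.expect (fun τ => (τ.time : ℝ≥0∞)) ⟨m, q, s⟩ + T' := by
          rw [P.expect_add, Prog.expect_const_of_halts (h.halts q s)]
      _ ≤ s + T + T' := by gcongr; exact h.time q s
      _ = _ := add_assoc _ _ _

/-- The cost of `k` unit steps on a memory with numbers of length at most `z`. -/
def stepCost (k z : ℕ) : ℕ := k * (2 * (z + k) + 1)

theorem stepCost_mono {k k' z z' : ℕ} (hk : k ≤ k') (hz : z ≤ z') :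
    stepCost k z ≤ stepCost k' z' := Nat.mul_le_mul hk (by omega)

/-- Deterministic code does not fail. -/
theorem Spec.of_det {P : Prog} {m : Mem} {k z : ℕ} {R : Mem → Prop} (h : Det P m k R)
    (hz : SizeLE m z) :
    Spec P m (fun m' => R m' ∧ SizeLE m' (z + k)) (fun _ => True) 0 (stepCost k z) := by
  obtain ⟨m', t, h1, h2, h3⟩ := h
  obtain ⟨h4, h5⟩ := h3 z hz
  refine ⟨fun q s => h2 q s _, fun q s f g hfg => ?_, fun q s => ?_, fun q s => ?_⟩
  · rw [h2, h2]; exact hfg _ ⟨h1, h5⟩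
  · rw [h2, bad_of trivial]
  · rw [h2, Nat.cast_add]
    gcongr
    exact h4

/-- Code that first runs deterministically. -/
theorem Spec.det_seq {P P' : Prog} {m : Mem} {k z : ℕ} {R I Q : Mem → Prop} {ε T : ℝ≥0∞}
    (h : Det P m k R) (hz : SizeLE m z)
    (h' : ∀ m', R m' → SizeLE m' (z + k) → Spec P' m' I Q ε T) :
    Spec (.seq P P') m I Q ε (stepCost k z + T) :=
  ((Spec.of_det h hz).seq (Q' := Q) fun m' hm' =>
    (h' m' hm'.1 hm'.2).mono (fun _ => id) (fun _ _ hh _ => hh) le_rfl le_rfl).mono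
    (fun _ => id) (fun _ _ => id) (by rw [zero_add]) le_rfl

theorem Spec.cond_true {r z : ℕ} {P P' : Prog} {m : Mem} {I Q : Mem → Prop} {ε T : ℝ≥0∞}
    (hr : m r 0 ≠ 0) (hz : SizeLE m z) (h : Spec P m I Q ε T) :
    Spec (.cond r P P') m I Q ε ((1 + z : ℕ) + T) := by
  have e : ∀ q s f, Prog.expect (.cond r P P') f ⟨m, q, s⟩ =
      P.expect f ⟨m, q, s + (1 + (m r 0).size)⟩ := fun q s f => by
    simp only [Prog.expect, Config.reg, Config.tick, ne_eq, hr, not_false_eq_true, if_true]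
  refine ⟨fun q s => ?_, fun q s f g hfg => ?_, fun q s => ?_, fun q s => ?_⟩
  · rw [e, h.halts]
  · rw [e, e]; exact h.sure _ _ f g hfg
  · rw [e]; exact h.fail _ _
  · rw [e]
    refine (h.time _ _).trans ?_
    have := hz r 0
    rw [← add_assoc (s : ℝ≥0∞), ← Nat.cast_add]
    exact add_le_add_left (Nat.cast_le.2 (by omega)) T

theorem Spec.cond_false {r z : ℕ} {P P' : Prog} {m : Mem} {I Q : Mem → Prop} {ε T : ℝ≥0∞}
    (hr : m r 0 = 0) (hz : SizeLE m z) (h : Spec P' m I Q ε T) :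
    Spec (.cond r P P') m I Q ε ((1 + z : ℕ) + T) := by
  have e : ∀ q s f, Prog.expect (.cond r P P') f ⟨m, q, s⟩ =
      P'.expect f ⟨m, q, s + (1 + (m r 0).size)⟩ := fun q s f => by
    simp only [Prog.expect, Config.reg, Config.tick, ne_eq, hr, not_true_eq_false, if_false]
  refine ⟨fun q s => ?_, fun q s f g hfg => ?_, fun q s => ?_, fun q s => ?_⟩
  · rw [e, h.halts]
  · rw [e, e]; exact h.sure _ _ f g hfg
  · rw [e]; exact h.fail _ _
  · rw [e]
    refine (h.time _ _).trans ?_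
    have := hz r 0
    rw [← add_assoc (s : ℝ≥0∞), ← Nat.cast_add]
    exact add_le_add_left (Nat.cast_le.2 (by omega)) T

theorem Spec.skip {m : Mem} {I Q : Mem → Prop} (hI : I m) (hQ : Q m) : Spec .skip m I Q 0 0 where
  halts _ _ := rfl
  sure _ _ _ _ hfg := hfg _ hI
  fail _ _ := (bad_of hQ).le
  time _ _ := le_self_add

theorem Spec.of_expect_eq {P P' : Prog} {m : Mem} {I Q : Mem → Prop} {ε T : ℝ≥0∞}
    (h : Spec P m I Q ε T) (e : ∀ f σ, P'.expect f σ = P.expect f σ) : Spec P' m I Q ε T := by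
  refine ⟨fun q s => ?_, fun q s f g hfg => ?_, fun q s => ?_, fun q s => ?_⟩
  · rw [e]; exact h.halts q s
  · rw [e, e]; exact h.sure q s f g hfg
  · rw [e]; exact h.fail q s
  · rw [e]; exact h.time q s

theorem Prog.expect_loop_eq_cond (r : ℕ) (P : Prog) (f : Config → ℝ≥0∞) (σ : Config) :
    (Prog.loop r P).expect f σ = (Prog.cond r (.seq P (.loop r P)) .skip).expect f σ := by
  rw [Prog.expect_loop_unfold]
  rfl

theorem Spec.loop_true {r z : ℕ} {P : Prog} {m : Mem} {I Q : Mem → Prop} {ε T : ℝ≥0∞}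
    (hr : m r 0 ≠ 0) (hz : SizeLE m z) (h : Spec (.seq P (.loop r P)) m I Q ε T) :
    Spec (.loop r P) m I Q ε ((1 + z : ℕ) + T) :=
  (Spec.cond_true hr hz h).of_expect_eq (Prog.expect_loop_eq_cond r P)

theorem Spec.loop_false {r z : ℕ} {P : Prog} {m : Mem} {I Q : Mem → Prop}
    (hr : m r 0 = 0) (hz : SizeLE m z) (hI : I m) (hQ : Q m) :
    Spec (.loop r P) m I Q 0 ((1 + z : ℕ)) := by
  have := (Spec.cond_false (P := .seq P (.loop r P)) hr hz (Spec.skip hI hQ)).of_expect_eq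
    (Prog.expect_loop_eq_cond r P)
  simpa using this

/-- The memory in which a procedure starts. -/
def frame (w : ℕ → ℕ) : Mem := fun a => if a = 0 then w else fun _ => 0

/-- Of the memory of the procedure only bank `0` survives, as bank `b` of the caller. -/
theorem Spec.call {P : Prog} {m : Mem} {b : ℕ} {I Q : Mem → Prop} {ε T : ℝ≥0∞}
    (h : Spec P (frame (m b)) I Q ε T) :
    Spec (.call b P) m (fun m' => ∃ v, I v ∧ m' = Function.update m b (v 0))
      (fun m' => ∃ v, I v ∧ Q v ∧ m' = Function.update m b (v 0)) ε (1 + T) := by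
  have e : ∀ q s f, Prog.expect (.call b P) f ⟨m, q, s⟩ =
      P.expect (fun τ => f ⟨Function.update m b (τ.mem 0), q, τ.time⟩)
        ⟨frame (m b), zeroQubits, s + 1⟩ := fun q s f => rfl
  refine ⟨fun q s => ?_, fun q s f g hfg => ?_, fun q s => ?_, fun q s => ?_⟩
  · rw [e]; exact h.halts _ _
  · rw [e, e]
    exact h.sure _ _ _ _ fun τ hτ => hfg _ ⟨τ.mem, hτ, rfl⟩
  · rw [e]
    refine le_trans ?_ (h.fail zeroQubits (s + 1))
    refine h.sure _ _ _ _ fun τ hτ => ?_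
    by_cases hQ : Q τ.mem
    · exact (bad_of ⟨τ.mem, hτ, hQ, rfl⟩).le.trans zero_le
    · rw [bad_of_not hQ]; exact bad_le_one _ _
  · rw [e]
    refine (h.time _ _).trans ?_
    push_cast
    rw [add_assoc]

/-- A list of numbers as the contents of a bank. -/
def asBank (l : List ℕ) : ℕ → ℕ := fun j => l.getD j 0

theorem start_eq (w : List ℕ) : start w = ⟨frame (asBank w), zeroQubits, 0⟩ := by
  simp only [start, Config.mk.injEq, and_true]
  funext b j
  by_cases hb : b = 0 <;> simp [frame, asBank, hb]

/-- A call of an algorithm of unknown nature, followed by deterministic code that may have to handle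
numbers produced by it. The length of these is bounded by the running time of the algorithm, so the
expected running time stays under control if the number `k` of unit steps is independent of it. -/
theorem Spec.call_det {A P' : Prog} {m : Mem} {w : List ℕ} {b k z : ℕ} {good : (ℕ → ℕ) → Prop}
    {t : ℝ} {I Q : Mem → Prop} {R : (ℕ → ℕ) → Mem → Prop}
    (hA : A.Succeeds w (fun τ => good (τ.mem 0)) t) (hb : m b = asBank w) (hz : SizeLE m z)
    (h' : ∀ v, Det P' (Function.update m b v) k (R v))
    (hI : ∀ v m', R v m' → I m') (hQ : ∀ v m', good v → R v m' → Q m') :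
    Spec (.seq (.call b A) P') m I Q (1 / 3)
      ((1 + stepCost k z : ℕ) + (2 * k + 1 : ℕ) * ENNReal.ofReal t) := by
  choose M' T' hR hexp hcost using h'
  obtain ⟨hh, hg, ht⟩ := hA
  rw [start_eq] at hh hg ht
  -- The run of `A` starts with a clock that shows `s + 1` and can be moved to zero.
  have e : ∀ q s f, Prog.expect (.seq (.call b A) P') f ⟨m, q, s⟩ =
      A.expect (fun τ => f ⟨M' (τ.mem 0), q, τ.time + (s + 1) + T' (τ.mem 0)⟩)
        ⟨frame (asBank w), zeroQubits, 0⟩ := fun q s f => by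
    have h1 : (⟨frame (asBank w), zeroQubits, s + 1⟩ : Config) =
        (⟨frame (asBank w), zeroQubits, 0⟩ : Config).tick (s + 1) := by simp [Config.tick]
    calc _ = A.expect (fun τ => P'.expect f ⟨Function.update m b (τ.mem 0), q, τ.time⟩)
            ⟨frame (m b), zeroQubits, s + 1⟩ := rfl
      _ = _ := by
        rw [hb, h1, Prog.expect_tick]
        congr 1
        funext τ
        rw [hexp]
        rfl
  refine ⟨fun q s => ?_, fun q s f g hfg => ?_, fun q s => ?_, fun q s => ?_⟩
  · rw [e]; exact hh
  · rw [e, e]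
    exact A.expect_mono (fun τ => hfg _ (hI _ _ (hR _))) _
  · rw [e]
    dsimp only
    -- The success of `A` and the failure of the whole exclude each other.
    have hsum : A.expect (Set.indicator {τ | good (τ.mem 0)} fun _ => 1)
          ⟨frame (asBank w), zeroQubits, 0⟩ +
        A.expect (fun τ => bad Q (M' (τ.mem 0))) ⟨frame (asBank w), zeroQubits, 0⟩ ≤ 1 := by
      rw [← A.expect_add]
      refine le_trans ?_ hh.le
      refine A.expect_mono (fun τ => ?_) _
      by_cases hgood : good (τ.mem 0)
      · rw [bad_of (hQ _ _ hgood (hR _)), add_zero]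
        have : τ ∈ {τ : Config | good (τ.mem 0)} := hgood
        rw [Set.indicator_of_mem this]
      · have : τ ∉ {τ : Config | good (τ.mem 0)} := hgood
        rw [Set.indicator_of_notMem this, zero_add]
        exact bad_le_one _ _
    have h3 : (2 / 3 : ℝ≥0∞) + 1 / 3 = 1 := by
      rw [ENNReal.div_add_div_same]
      norm_num
      exact ENNReal.div_self (by norm_num) (by norm_num)
    have h4 : (2 / 3 : ℝ≥0∞) + A.expect (fun τ => bad Q (M' (τ.mem 0)))
        ⟨frame (asBank w), zeroQubits, 0⟩ ≤ 2 / 3 + 1 / 3 := by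
      rw [h3]
      exact le_trans (by gcongr) hsum
    exact (ENNReal.add_le_add_iff_left (by finiteness)).1 h4
  · rw [e]
    dsimp only
    have hz' : SizeLE (frame (asBank w)) z := fun b' j => by
      by_cases hb' : b' = 0
      · have := hz b j
        rw [hb] at this
        simpa [frame, hb'] using this
      · simp [frame, hb']
    -- On final memories of `A` the numbers have length at most `z` plus the time spent, so that the
    -- steps of `P'` cost at most a constant plus `2 * k` times the time spent by `A`.
    calc _ ≤ A.expect (fun τ => ((s + (1 + stepCost k z) : ℕ) : ℝ≥0∞) +
            ((2 * k + 1 : ℕ) : ℝ≥0∞) * (τ.time : ℝ≥0∞)) ⟨frame (asBank w), zeroQubits, 0⟩ := by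
          refine A.expect_le_of_size z 0 (fun τ hτ _ => ?_) _ (by simpa using hz') le_rfl
          have hs : SizeLE (Function.update m b (τ.mem 0)) (z + τ.time) := fun b' j => by
            by_cases hb' : b' = b
            · subst hb'; simpa using hτ 0 j
            · simpa [hb'] using (hz b' j).trans (Nat.le_add_right _ _)
          have h1 := (hcost (τ.mem 0) _ hs).1
          have h2 : k * (2 * (z + τ.time + k) + 1) = stepCost k z + 2 * k * τ.time := by
            unfold stepCost; ring
          have h3 : τ.time + (s + 1) + T' (τ.mem 0) ≤
              s + (1 + stepCost k z) + (2 * k + 1) * τ.time := by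
            rw [h2] at h1
            have : (2 * k + 1) * τ.time = 2 * k * τ.time + τ.time := by ring
            omega
          exact_mod_cast h3
      _ = ((s + (1 + stepCost k z) : ℕ) : ℝ≥0∞) + ((2 * k + 1 : ℕ) : ℝ≥0∞) *
            A.expect (fun τ => (τ.time : ℝ≥0∞)) ⟨frame (asBank w), zeroQubits, 0⟩ := by
          rw [A.expect_add, Prog.expect_const_of_halts hh, A.expect_const_mul]
      _ ≤ _ := by
          rw [Nat.cast_add, add_assoc]
          gcongr

/-! ### Conjunctions with three work qubits -/

/-- The action of a list of gates. -/
def runGates {Q : Type} [DecidableEq Q] (l : List (Gate Q)) (ψ : Amp Q) : Amp Q :=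
  l.foldl (fun φ g => g.apply φ) ψ

theorem runGates_append {Q : Type} [DecidableEq Q] (l l' : List (Gate Q)) (ψ : Amp Q) :
    runGates (l ++ l') ψ = runGates l' (runGates l ψ) := List.foldl_append

theorem runGates_cons {Q : Type} [DecidableEq Q] (g : Gate Q) (l : List (Gate Q)) (ψ : Amp Q) :
    runGates (g :: l) ψ = runGates l (g.apply ψ) := rfl

/-- The gates in `l` add the product of wire `i` and of `f`, a function of all wires, to wire `j`
modulo two. -/
def Adds {Q : Type} [DecidableEq Q] (l : List (Gate Q)) (i j : Q) (f : (Q → Bool) → Bool) : Prop :=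
  ∀ ψ x, runGates l ψ x = ψ (Function.update x j (xor (x j) (x i && f x)))

/-- `f` does not depend on the wire `w`. -/
def Ignores {Q : Type} [DecidableEq Q] (f : (Q → Bool) → Bool) (w : Q) : Prop :=
  ∀ x b, f (Function.update x w b) = f x

/-- The commutator identity behind computation in constant width: two copies of the gates for `f`
and two copies of the gates for `g`, with a third wire `k` in an arbitrary state as an intermediate
target, give the gates for the conjunction, and restore the third wire. -/
theorem Adds.and {Q : Type} [DecidableEq Q] {A B : List (Gate Q)} {i j k : Q}
    {f g : (Q → Bool) → Bool} (hij : i ≠ j) (hik : i ≠ k) (hjk : j ≠ k)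
    (hA : Adds A i k f) (hB : Adds B k j g)
    (hfj : Ignores f j) (hfk : Ignores f k) (hgj : Ignores g j) (hgk : Ignores g k) :
    Adds (A ++ (B ++ (A ++ B))) i j fun x => f x && g x := by
  intro ψ x
  rw [runGates_append, runGates_append, runGates_append, hB, hA, hB, hA]
  congr 1
  have e1 : ∀ x b b', f (Function.update (Function.update x j b) k b') = f x :=
    fun x b b' => by rw [hfk, hfj]
  have e2 : ∀ x b b', g (Function.update (Function.update x j b) k b') = g x :=
    fun x b b' => by rw [hgk, hgj]
  funext w
  simp only [hfj _ _, e1, e2, Function.update_apply, hij, hik, hjk, hjk.symm, if_true, if_false]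
  by_cases h1 : w = j
  · subst h1
    simp only [hjk, if_false, if_true]
    cases x w <;> cases x k <;> cases x i <;> cases f x <;> cases g x <;> rfl
  · by_cases h2 : w = k
    · subst h2
      simp only [h1, if_false, if_true]
      cases x w <;> cases x i <;> cases f x <;> rfl
    · simp [h1, h2]

/-- Gates for the conjunction of the items `lo, …, lo + len - 1` (at least one), given gates
`leaf i j l` for the single items `l`. The wires `i`, `j` are two of the three work qubits `0`, `1`,
`2`; a range is split in two halves. -/
def andOps {γ : Type} (leaf : ℕ → ℕ → ℕ → List γ) (i j lo len : ℕ) : List γ :=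
  if _h : len / 2 ≠ 0 then
    let A := andOps leaf i (3 - i - j) lo (len / 2)
    let B := andOps leaf (3 - i - j) j (lo + len / 2) (len - len / 2)
    A ++ (B ++ (A ++ B))
  else leaf i j lo
termination_by len
decreasing_by all_goals omega

theorem andOps_of_half {γ : Type} (leaf : ℕ → ℕ → ℕ → List γ) (i j lo : ℕ) {len : ℕ}
    (h : len / 2 ≠ 0) :
    andOps leaf i j lo len = andOps leaf i (3 - i - j) lo (len / 2) ++
      (andOps leaf (3 - i - j) j (lo + len / 2) (len - len / 2) ++
      (andOps leaf i (3 - i - j) lo (len / 2) ++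
        andOps leaf (3 - i - j) j (lo + len / 2) (len - len / 2))) := by
  rw [andOps, dif_pos h]

theorem andOps_of_leaf {γ : Type} (leaf : ℕ → ℕ → ℕ → List γ) (i j lo : ℕ) {len : ℕ}
    (h : len / 2 = 0) : andOps leaf i j lo len = leaf i j lo := by
  rw [andOps, dif_neg (by simpa using h)]

/-- Two different work qubits. -/
def WorkPair (i j : ℕ) : Prop := i < 3 ∧ j < 3 ∧ i ≠ j

theorem WorkPair.left {i j : ℕ} (h : WorkPair i j) : WorkPair i (3 - i - j) := by
  unfold WorkPair at *; omega

theorem WorkPair.right {i j : ℕ} (h : WorkPair i j) : WorkPair (3 - i - j) j := by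
  unfold WorkPair at *; omega

/-- Renaming of the wires in a list of gates. -/
def mapGates {Q R : Type} (e : Q → R) (l : List (Gate Q)) : List (Gate R) := l.map (Gate.map e)

theorem mapGates_append {Q R : Type} (e : Q → R) (l l' : List (Gate Q)) :
    mapGates e (l ++ l') = mapGates e l ++ mapGates e l' := List.map_append

theorem range_all_congr {P P' : ℕ → Bool} {n : ℕ} (h : ∀ t < n, P t = P' t) :
    (List.range n).all P = (List.range n).all P' := by
  rw [Bool.eq_iff_iff, List.all_eq_true, List.all_eq_true]
  refine forall₂_congr fun t ht => ?_
  rw [h t (List.mem_range.1 ht)]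

theorem range_all_split (P : ℕ → Bool) (a b lo : ℕ) :
    ((List.range (a + b)).all fun t => P (lo + t)) =
      (((List.range a).all fun t => P (lo + t)) &&
        (List.range b).all fun t => P (lo + a + t)) := by
  rw [List.range_add, List.all_append, List.all_map]
  congr 2
  funext t
  simp [Nat.add_assoc]

/-- The gates of `andOps` compute the conjunction, if the items do not depend on the work qubits. -/
theorem andOps_adds {Q : Type} [DecidableEq Q] (e : ℕ → Q)
    (he : ∀ i j, i < 3 → j < 3 → e i = e j → i = j)
    (leaf : ℕ → ℕ → ℕ → List (Gate ℕ)) (v : ℕ → (Q → Bool) → Bool) :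
    ∀ len lo i j, WorkPair i j → 1 ≤ len →
    (∀ i j l, WorkPair i j → lo ≤ l → l < lo + len →
      Adds (mapGates e (leaf i j l)) (e i) (e j) (v l)) →
    (∀ l k, lo ≤ l → l < lo + len → k < 3 → Ignores (v l) (e k)) →
    Adds (mapGates e (andOps leaf i j lo len)) (e i) (e j)
      fun x => (List.range len).all fun t => v (lo + t) x := by
  intro len
  induction len using Nat.strong_induction_on with
  | _ len ih =>
    intro lo i j hij hlen hleaf hign
    by_cases h : len / 2 ≠ 0
    · rw [andOps_of_half leaf i j lo h]
      simp only [mapGates_append]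
      have hA := ih (len / 2) (by omega) lo i (3 - i - j) hij.left (by omega)
        (fun i j l h1 h2 h3 => hleaf i j l h1 h2 (by omega))
        (fun l k h1 h2 => hign l k h1 (by omega))
      have hB := ih (len - len / 2) (by omega) (lo + len / 2) (3 - i - j) j hij.right (by omega)
        (fun i j l h1 h2 h3 => hleaf i j l h1 (by omega) (by omega))
        (fun l k h1 h2 => hign l k (by omega) (by omega))
      have ig : ∀ lo' len', lo ≤ lo' → lo' + len' ≤ lo + len → ∀ k, k < 3 →
          Ignores (fun x => (List.range len').all fun t => v (lo' + t) x) (e k) := by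
        intro lo' len' h1 h2 k hk x b
        refine range_all_congr fun t ht => ?_
        exact hign _ _ (by omega) (by omega) hk x b
      obtain ⟨h1, h2, h3⟩ := id hij
      have hk : 3 - i - j < 3 := by omega
      have := Adds.and (fun hh => h3 (he _ _ h1 h2 hh))
        (fun hh => by have := he _ _ h1 hk hh; omega)
        (fun hh => by have := he _ _ h2 hk hh; omega) hA hB
        (ig _ _ le_rfl (by omega) _ h2) (ig _ _ le_rfl (by omega) _ hk)
        (ig _ _ (by omega) (by omega) _ h2) (ig _ _ (by omega) (by omega) _ hk)
      have hl : len / 2 + (len - len / 2) = len := by omega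
      intro ψ x
      rw [this ψ x]
      dsimp only
      rw [← range_all_split (fun l => v l x), hl]
    · have h' : len / 2 = 0 := by simpa using h
      have h1 : len = 1 := by omega
      subst h1
      rw [andOps_of_leaf leaf i j lo h']
      have := hleaf i j lo hij le_rfl (by omega)
      simpa using this

/-- Gates for the negation of a literal. The code of a literal is `2 * w + b`, where `w` is its wire
and `b` its sign. -/
def litOps (lit : ℕ → ℕ) (i j l : ℕ) : List (Gate ℕ) :=
  (if lit l % 2 = 1 then [.CNOT i j] else []) ++ [.TOFFOLI i (lit l / 2) j]

/-- Gates for a clause, which is the negation of a conjunction of negated literals. -/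
def clauseOps (lit cst cln : ℕ → ℕ) (i j l : ℕ) : List (Gate ℕ) :=
  .CNOT i j :: andOps (litOps lit) i j (cst l) (cln l)

/-- The negation of the literal with code `c`. -/
def negLit {Q : Type} (e : ℕ → Q) (c : ℕ) (x : Q → Bool) : Bool :=
  xor (x (e (c / 2))) (decide (c % 2 = 1))

theorem litOps_adds {Q : Type} [DecidableEq Q] (e : ℕ → Q)
    (he : ∀ i j, i < 3 → j < 3 → e i = e j → i = j) (lit : ℕ → ℕ) {i j l : ℕ}
    (hij : WorkPair i j) (hl : ∀ k < 3, e (lit l / 2) ≠ e k) :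
    Adds (mapGates e (litOps lit i j l)) (e i) (e j) (negLit e (lit l)) := by
  obtain ⟨h1, h2, h3⟩ := hij
  have hij : e j ≠ e i := fun h => h3 (he _ _ h2 h1 h).symm
  have hw : e j ≠ e (lit l / 2) := (hl j h2).symm
  intro ψ x
  unfold litOps negLit
  by_cases hb : lit l % 2 = 1
  · simp only [hb, if_true, mapGates, Gate.map, List.cons_append, List.nil_append, List.map_cons,
      List.map_nil, runGates, List.foldl, Gate.apply, hij, hw, if_false, or_self,
      Function.update_self, Function.update_idem, decide_true, Function.update_of_ne hij.symm]
    congr 2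
    cases x (e j) <;> cases x (e i) <;> cases x (e (lit l / 2)) <;> rfl
  · simp only [hb, if_false, mapGates, Gate.map, List.nil_append, List.map_cons,
      List.map_nil, runGates, List.foldl, Gate.apply, hij, hw, or_self, decide_false,
      Bool.xor_false]

theorem negLit_ignores {Q : Type} [DecidableEq Q] (e : ℕ → Q) (c : ℕ) (w : Q)
    (h : e (c / 2) ≠ w) : Ignores (negLit e c) w := by
  intro x b
  simp [negLit, Function.update_of_ne h]

/-- The truth value of a clause: its literals have the codes `lit s`, …, `lit (s + len - 1)`. -/
def clauseVal {Q : Type} (e : ℕ → Q) (lit : ℕ → ℕ) (s len : ℕ) (x : Q → Bool) : Bool :=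
  !(List.range len).all fun t => negLit e (lit (s + t)) x

/-- By De Morgan: the controlled negation in front turns the conjunction of the negated literals
into the disjunction of the literals. -/
theorem clauseOps_adds {Q : Type} [DecidableEq Q] (e : ℕ → Q)
    (he : ∀ i j, i < 3 → j < 3 → e i = e j → i = j) (lit cst cln : ℕ → ℕ) {i j l : ℕ}
    (hij : WorkPair i j) (h0 : 1 ≤ cln l)
    (hl : ∀ t < cln l, ∀ k < 3, e (lit (cst l + t) / 2) ≠ e k) :
    Adds (mapGates e (clauseOps lit cst cln i j l)) (e i) (e j)
      (clauseVal e lit (cst l) (cln l)) := by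
  have hA := andOps_adds e he (litOps lit) (fun l => negLit e (lit l)) (cln l) (cst l) i j hij h0
    (fun i j t hij ht ht' => litOps_adds e he lit hij fun k hk => by
      have := hl (t - cst l) (by omega) k hk
      rwa [Nat.add_sub_cancel' ht] at this)
    (fun t k ht ht' hk => negLit_ignores e _ _ (by
      have := hl (t - cst l) (by omega) k hk
      rwa [Nat.add_sub_cancel' ht] at this))
  have hne : e j ≠ e i := fun h => hij.2.2 (he _ _ hij.2.1 hij.1 h).symm
  intro ψ x
  have : mapGates e (clauseOps lit cst cln i j l) =
      .CNOT (e i) (e j) :: mapGates e (andOps (litOps lit) i j (cst l) (cln l)) := rfl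
  rw [this, runGates_cons, hA]
  simp only [Gate.apply, hne, if_false, Function.update_self, Function.update_idem,
    Function.update_of_ne hne.symm, clauseVal]
  congr 2
  generalize ((List.range (cln l)).all fun t => negLit e (lit (cst l + t)) x) = b
  cases x (e j) <;> cases x (e i) <;> cases b <;> rfl

/-- Gates for a formula in conjunctive normal form given by tables: clause `l < M` has the literals
in the cells `cst l`, …, `cst l + cln l - 1` of the table `lit`. -/
theorem cnfOps_adds {Q : Type} [DecidableEq Q] (e : ℕ → Q)
    (he : ∀ i j, i < 3 → j < 3 → e i = e j → i = j) (lit cst cln : ℕ → ℕ) {M : ℕ} (hM : 1 ≤ M)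
    (h0 : ∀ l < M, 1 ≤ cln l)
    (hl : ∀ l < M, ∀ t < cln l, ∀ k < 3, e (lit (cst l + t) / 2) ≠ e k) :
    Adds (mapGates e (andOps (clauseOps lit cst cln) 0 1 0 M)) (e 0) (e 1)
      fun x => (List.range M).all fun l => clauseVal e lit (cst l) (cln l) x := by
  have := andOps_adds e he (clauseOps lit cst cln) (fun l => clauseVal e lit (cst l) (cln l)) M 0
    0 1 ⟨by norm_num, by norm_num, by norm_num⟩ hM
    (fun i j l hij _ hl' => clauseOps_adds e he lit cst cln hij (h0 l (by omega))
      (hl l (by omega)))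
    (fun l k _ hl' hk x b => by
      unfold clauseVal
      congr 1
      refine range_all_congr fun t ht => ?_
      exact negLit_ignores e _ _ (hl l (by omega) t ht k hk) x b)
  simpa using this

/-! ### The amplitude of the counting circuit -/

/-- The Hadamard transform on the wires in `S`. -/
def hadamard {Q : Type} [DecidableEq Q] [Fintype Q] (S : Finset Q) (ψ : Amp Q) : Amp Q := fun x =>
  ((Real.sqrt 2 : ℂ)⁻¹) ^ S.card *
    ∑ y : Q → Bool, if ∀ i ∉ S, y i = x i then
      (∏ i ∈ S, if (x i && y i) = true then (-1 : ℂ) else 1) * ψ y else 0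

/-- The Hadamard transform is built up wire by wire. -/
theorem hadamard_insert {Q : Type} [DecidableEq Q] [Fintype Q] {S : Finset Q} {i : Q} (hi : i ∉ S)
    (ψ : Amp Q) : (Gate.H i).apply (hadamard S ψ) = hadamard (insert i S) ψ := by
  funext x
  simp only [Gate.apply, hadamard, Finset.card_insert_of_notMem hi, Finset.prod_insert hi]
  rw [pow_succ, mul_assoc, div_eq_inv_mul, mul_left_comm, mul_left_comm _ (Real.sqrt 2 : ℂ)⁻¹,
    ← mul_add]
  congr 2
  rw [Finset.mul_sum, ← Finset.sum_add_distrib]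
  refine Finset.sum_congr rfl fun y _ => ?_
  have key : ∀ b, (∀ j ∉ S, y j = Function.update x i b j) ↔
      (y i = b ∧ ∀ j ∉ insert i S, y j = x j) := by
    intro b
    constructor
    · intro h
      refine ⟨by simpa using h i hi, fun j hj => ?_⟩
      rw [Finset.mem_insert, not_or] at hj
      simpa [hj.1] using h j hj.2
    · rintro ⟨h1, h2⟩ j hj
      by_cases hji : j = i
      · subst hji; simpa using h1
      · simpa [hji] using h2 j (by simp [hji, hj])
  have prod : ∀ b, (∏ j ∈ S, if (Function.update x i b j && y j) = true then (-1 : ℂ) else 1) =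
      ∏ j ∈ S, if (x j && y j) = true then (-1 : ℂ) else 1 := by
    intro b
    refine Finset.prod_congr rfl fun j hj => ?_
    have : j ≠ i := fun h => hi (h ▸ hj)
    simp [this]
  simp only [key, prod]
  by_cases hy : ∀ j ∉ insert i S, y j = x j
  · simp only [and_iff_left hy, if_pos hy]
    cases y i <;> cases x i <;> simp
  · have hy' : ∀ b, ¬ (y i = b ∧ ∀ j ∉ insert i S, y j = x j) := fun b h => hy h.2
    simp only [if_neg hy, if_neg (hy' _), mul_zero, add_zero]

theorem runGates_hadamard {Q : Type} [DecidableEq Q] [Fintype Q] (l : List Q) (hl : l.Nodup)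
    (ψ : Amp Q) : runGates (l.map Gate.H) ψ = hadamard l.toFinset ψ := by
  induction l using List.reverseRecOn with
  | nil =>
    funext x
    have : ∀ y : Q → Bool, (∀ i, y i = x i) ↔ y = x := fun y => funext_iff.symm
    simp [runGates, hadamard, this]
  | append_singleton l i ih =>
    rw [List.nodup_append] at hl
    rw [List.map_append, runGates_append, ih hl.1]
    have hi : i ∉ l.toFinset := by
      rw [List.mem_toFinset]
      exact fun h => hl.2.2 i h i (by simp) rfl
    have : (l ++ [i]).toFinset = insert i l.toFinset := by ext; simp
    rw [this, ← hadamard_insert hi]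
    rfl

/-- Conjugation by Hadamard gates turns gates `W` that add `f` to the wire `s` into a signed number
of solutions. The amplitude of the transition from `x₀` to `x₁` is considered, where `x₁` is zero on
`S`, and where `s` is flipped: so the paths through `y` with `f y = 1` are the only ones to
contribute. Each of them has the sign `∏ i ∈ S, (-1) ^ (y i * x₀ i)`. -/
theorem hadamard_conj {Q : Type} [DecidableEq Q] [Fintype Q] (S : Finset Q) (W : List (Gate Q))
    (f : (Q → Bool) → Bool) {r s : Q} (hW : Adds W r s f) (hr : r ∉ S) (hs : s ∉ S)
    (x₀ x₁ : Q → Bool) (h0s : x₀ s = true)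
    (h1r : x₁ r = true) (h1s : x₁ s = false) (h1S : ∀ i ∈ S, x₁ i = false)
    (h01 : ∀ i ∉ S, i ≠ s → x₀ i = x₁ i) :
    hadamard S (runGates W (hadamard S (Pi.single x₀ 1))) x₁ =
      ((Real.sqrt 2 : ℂ)⁻¹) ^ S.card * ((Real.sqrt 2 : ℂ)⁻¹) ^ S.card *
        ∑ y : Q → Bool, if (∀ i ∉ S, y i = x₁ i) ∧ f y = true then
          ∏ i ∈ S, (if (y i && x₀ i) = true then (-1 : ℂ) else 1) else 0 := by
  -- the first layer of Hadamard gates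
  have inner : ∀ y, hadamard S (Pi.single x₀ 1) y = ((Real.sqrt 2 : ℂ)⁻¹) ^ S.card *
      if ∀ i ∉ S, x₀ i = y i then
        ∏ i ∈ S, (if (y i && x₀ i) = true then (-1 : ℂ) else 1) else 0 := by
    intro y
    unfold hadamard
    congr 1
    rw [Finset.sum_eq_single x₀]
    · simp
    · intro b _ hb
      simp [Pi.single_eq_of_ne hb]
    · simp
  conv_lhs => unfold hadamard
  rw [mul_assoc]
  congr 1
  rw [Finset.mul_sum]
  refine Finset.sum_congr rfl fun y _ => ?_
  have p1 : (∏ i ∈ S, if (x₁ i && y i) = true then (-1 : ℂ) else 1) = 1 :=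
    Finset.prod_eq_one fun i hi => by simp [h1S i hi]
  rw [p1, one_mul, hW]
  by_cases hy : ∀ i ∉ S, y i = x₁ i
  · rw [if_pos hy]
    have hyr : y r = true := (hy r hr).trans h1r
    have hys : y s = false := (hy s hs).trans h1s
    have e1 : xor (y s) (y r && f y) = f y := by simp [hyr, hys]
    have hh := inner (Function.update y s (f y))
    unfold hadamard at hh
    rw [e1, hh]
    congr 1
    have p2 : (∏ i ∈ S, if (Function.update y s (f y) i && x₀ i) = true then (-1 : ℂ) else 1) =
        ∏ i ∈ S, if (y i && x₀ i) = true then (-1 : ℂ) else 1 := by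
      refine Finset.prod_congr rfl fun j hj => ?_
      have : j ≠ s := fun h => hs (h ▸ hj)
      simp [this]
    -- The state `y` after `W` belongs to a state before `W` in which `s` holds `f y`; it is
    -- reached from `x₀` only if this value is one.
    have c : (∀ i ∉ S, x₀ i = Function.update y s (f y) i) ↔ f y = true := by
      constructor
      · intro h
        have := h s hs
        rw [h0s] at this
        simpa using this.symm
      · intro h i hi
        by_cases his : i = s
        · subst his; simp [h, h0s]
        · simp [his, h01 i hi his, hy i hi]
    simp only [c, p2]
    exact if_congr ⟨fun h => ⟨hy, h⟩, And.right⟩ rfl rfl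
  · rw [if_neg hy, if_neg fun h => hy h.1, mul_zero]

/-- The circuit that computes a signed count, on the input zero. Its wires are the three work qubits
`0`, `1`, `2`, then `p` idle ones, then the sign `3 + p`, then `n + 1` variables; the list `ops` of
gates evaluates a formula in the sign and the variables. The idle wires do not change the amplitude,
but they increase `2 ^ N` times the amplitude, where `N` is the number of wires. -/
def countCircuit (n p : ℕ) (ops : List (Gate ℕ)) : List (Gate ℕ) :=
  [.X (3 + p), .X 0, .X 1] ++ ((List.range (n + 2)).map fun t => .H (3 + p + t)) ++ ops ++
    ((List.range (n + 2)).map fun t => .H (3 + p + t)) ++ [.X 0]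

/-- The number of wires of the counting circuit. -/
abbrev wires (n p : ℕ) : ℕ := n + 4 + p + 1

/-- The wire with a given number. -/
def wire (n p : ℕ) (w : ℕ) : Fin (wires n p) := Fin.ofNat (wires n p) w

theorem wire_val {n p w : ℕ} (h : w < wires n p) : (wire n p w : ℕ) = w := Nat.mod_eq_of_lt h

theorem wire_inj {n p w w' : ℕ} (h : w < wires n p) (h' : w' < wires n p)
    (e : wire n p w = wire n p w') : w = w' := by
  rw [← wire_val h, ← wire_val h', e]

theorem wire_ne {n p w w' : ℕ} (h : w < wires n p) (h' : w' < wires n p) (hne : w ≠ w') :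
    wire n p w ≠ wire n p w' := fun e => hne (wire_inj h h' e)

/-- The assignment of the wires that belongs to a sign bit and `n + 1` variables. -/
def assign (n p : ℕ) (zu : Bool × (Fin (n + 1) → Bool)) : Fin (wires n p) → Bool := fun i =>
  if (i : ℕ) = 0 then true else if (i : ℕ) < 3 + p then false else if (i : ℕ) = 3 + p then zu.1
  else zu.2 (Fin.ofNat (n + 1) (i - (4 + p)))

/-- The amplitude is `2 ^ (-(n + 2))` times the number of solutions with sign `0` minus the number
of solutions with sign `1`. -/
theorem countCircuit_amplitude (n p : ℕ) (ops : List (Gate ℕ))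
    (f : (Fin (wires n p) → Bool) → Bool)
    (hops : Adds (mapGates (wire n p) ops) (wire n p 0) (wire n p 1) f) :
    Circuit.run (mapGates (wire n p) (countCircuit n p ops)) (ket fun _ => false) (fun _ => false) =
      ((2 : ℂ)⁻¹) ^ (n + 2) * ∑ zu : Bool × (Fin (n + 1) → Bool),
        if f (assign n p zu) = true then (if zu.1 = true then (-1 : ℂ) else 1) else 0 := by
  set e := wire n p with he
  set l := (List.range (n + 2)).map fun t => e (3 + p + t) with hl
  have hlt : ∀ w, w < 4 + p → w < wires n p := fun w h => by unfold wires; omega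
  have hN : ∀ t, t < n + 2 → 3 + p + t < wires n p := fun t h => by unfold wires; omega
  have hnd : l.Nodup := by
    refine List.Nodup.map_on ?_ List.nodup_range
    intro a ha b hb hab
    rw [List.mem_range] at ha hb
    have := wire_inj (hN a ha) (hN b hb) hab
    omega
  have hrun : Circuit.run (mapGates e (countCircuit n p ops)) (ket fun _ => false) =
      runGates (mapGates e (countCircuit n p ops)) (Pi.single (fun _ => false) 1) := by
    unfold Circuit.run runGates ket
    congr
  have hmap : mapGates e (countCircuit n p ops) =
      [.X (e (3 + p)), .X (e 0), .X (e 1)] ++ l.map Gate.H ++ mapGates e ops ++ l.map Gate.H ++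
        [.X (e 0)] := by
    simp only [mapGates, countCircuit, hl, List.map_append, List.map_map]
    rfl
  rw [hrun, hmap]
  simp only [runGates_append, runGates_hadamard l hnd]
  set S := l.toFinset with hS
  have memS : ∀ i : Fin (wires n p), i ∈ S ↔ 3 + p ≤ (i : ℕ) := by
    intro i
    simp only [hS, List.mem_toFinset, hl, List.mem_map, List.mem_range]
    constructor
    · rintro ⟨t, ht, rfl⟩
      rw [wire_val (hN t ht)]
      omega
    · intro h
      have hi := i.isLt
      unfold wires at hi
      refine ⟨i - (3 + p), by omega, ?_⟩
      apply Fin.ext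
      rw [wire_val (by unfold wires; omega)]
      omega
  have hcard : S.card = n + 2 := by
    rw [hS, List.toFinset_card_of_nodup hnd, hl]
    simp
  -- The basis state after the first negations, in which the sign wire is set, which gives the
  -- solutions their signs; and the basis state before the last negation.
  set x₀ : Fin (wires n p) → Bool :=
    Function.update (Function.update (Function.update (fun _ => false) (e 1) true) (e 0) true)
      (e (3 + p)) true with hx₀
  set x₁ : Fin (wires n p) → Bool := Function.update (fun _ => false) (e 0) true with hx₁
  have v0 : (e 0 : ℕ) = 0 := wire_val (hlt 0 (by omega))
  have v1 : (e 1 : ℕ) = 1 := wire_val (hlt 1 (by omega))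
  have vz : (e (3 + p) : ℕ) = 3 + p := wire_val (hlt _ (by omega))
  have ne01 : e 0 ≠ e 1 := wire_ne (hlt _ (by omega)) (hlt _ (by omega)) (by omega)
  have ne0z : e 0 ≠ e (3 + p) := wire_ne (hlt _ (by omega)) (hlt _ (by omega)) (by omega)
  have ne1z : e 1 ≠ e (3 + p) := wire_ne (hlt _ (by omega)) (hlt _ (by omega)) (by omega)
  have hinit : runGates [.X (e (3 + p)), .X (e 0), .X (e 1)] (Pi.single (fun _ => false) 1) =
      (Pi.single x₀ 1 : Amp (Fin (wires n p))) := by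
    funext x
    simp only [runGates, List.foldl, Gate.apply, Pi.single_apply]
    refine if_congr ?_ rfl rfl
    simp only [funext_iff]
    refine forall_congr' fun i => ?_
    simp only [hx₀, Function.update_apply]
    by_cases h1 : i = e (3 + p)
    · subst h1; simp [ne0z.symm, ne1z.symm]
    · by_cases h2 : i = e 0
      · subst h2; simp [ne01, h1]
      · by_cases h3 : i = e 1
        · subst h3; simp [h1, h2]
        · simp [h1, h2, h3]
  rw [hinit]
  have hlast : ∀ φ : Amp (Fin (wires n p)), runGates [.X (e 0)] φ (fun _ => false) = φ x₁ := by
    intro φ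
    simp [runGates, Gate.apply, hx₁]
  rw [hlast]
  rw [hadamard_conj S (mapGates e ops) f hops (by rw [memS]; omega) (by rw [memS]; omega)
    x₀ x₁ (by simp [hx₀, ne1z, ne01.symm]) (by simp [hx₁])
    (by simp [hx₁, ne01.symm])
    (fun i hi => by
      rw [memS] at hi
      have : i ≠ e 0 := fun h => by rw [h] at hi; omega
      simp [hx₁, this])
    (fun i hi h1 => by
      rw [memS] at hi
      have hz : i ≠ e (3 + p) := fun h => hi (by rw [h, vz])
      simp only [hx₀, hx₁, Function.update_apply, h1, hz, if_false])]
  rw [hcard, ← mul_pow]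
  have hsq : ((Real.sqrt 2 : ℂ)⁻¹) * ((Real.sqrt 2 : ℂ)⁻¹) = (2 : ℂ)⁻¹ := by
    rw [← mul_inv, ← Complex.ofReal_mul, Real.mul_self_sqrt (by norm_num)]
    norm_num
  rw [hsq]
  congr 1
  -- In the product of signs only the sign wire counts.
  have hsign : ∀ y : Fin (wires n p) → Bool,
      (∏ i ∈ S, if (y i && x₀ i) = true then (-1 : ℂ) else 1) =
        if y (e (3 + p)) = true then -1 else 1 := by
    intro y
    rw [Finset.prod_eq_single (e (3 + p))]
    · simp [hx₀]
    · intro i hi hne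
      rw [memS] at hi
      have h0 : i ≠ e 0 := fun h => by rw [h] at hi; omega
      have h1 : i ≠ e 1 := fun h => by rw [h] at hi; omega
      simp [hx₀, hne, h0, h1]
    · intro h
      exact absurd ((memS _).2 vz.ge) h
  simp only [hsign]
  have x1v : ∀ i, x₁ i = decide ((i : ℕ) = 0) := by
    intro i
    have : i = e 0 ↔ (i : ℕ) = 0 := by rw [Fin.ext_iff, v0]
    simp [hx₁, Function.update_apply, this]
  symm
  rw [← Finset.sum_filter, ← Finset.sum_filter]
  -- The states that are summed over agree with `x₁` on the work qubits and idle wires; they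
  -- correspond to the values of the sign and of the variables.
  refine Finset.sum_bij (fun zu _ => assign n p zu) ?_ ?_ ?_ ?_
  · intro zu hzu
    rw [Finset.mem_filter] at hzu ⊢
    refine ⟨Finset.mem_univ _, fun i hi => ?_, hzu.2⟩
    rw [memS] at hi
    rw [x1v]
    by_cases h0 : (i : ℕ) = 0 <;> simp [assign, h0]
    omega
  · intro zu _ zu' _ h
    refine Prod.ext ?_ (funext fun j => ?_)
    · have := congrFun h (e (3 + p))
      simpa [assign, vz] using this
    · have hj := j.isLt
      have vj : (e (4 + p + j) : ℕ) = 4 + p + j := wire_val (by unfold wires; omega)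
      have := congrFun h (e (4 + p + j))
      have hj' : (Fin.ofNat (n + 1) (j : ℕ)) = j := Fin.ext (Nat.mod_eq_of_lt hj)
      have c1 : ¬ (4 + p + (j : ℕ) = 0) := by omega
      have c2 : ¬ (4 + p + (j : ℕ) < 3 + p) := by omega
      have c3 : ¬ (4 + p + (j : ℕ) = 3 + p) := by omega
      have c4 : 4 + p + (j : ℕ) - (4 + p) = j := by omega
      simp only [assign, vj, c1, c2, c3, c4, if_false] at this
      rwa [hj'] at this
  · intro y hy
    rw [Finset.mem_filter] at hy
    have hy1 := hy.2.1
    have hya : assign n p (y (e (3 + p)), fun j => y (e (4 + p + j))) = y := by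
      funext i
      have hi := i.isLt
      unfold wires at hi
      unfold assign
      dsimp only
      by_cases h0 : (i : ℕ) = 0
      · rw [if_pos h0, hy1 i (by rw [memS]; omega), x1v]
        simp [h0]
      · rw [if_neg h0]
        by_cases h1 : (i : ℕ) < 3 + p
        · rw [if_pos h1, hy1 i (by rw [memS]; omega), x1v]
          simp [h0]
        · rw [if_neg h1]
          by_cases h2 : (i : ℕ) = 3 + p
          · rw [if_pos h2]
            congr 1
            exact Fin.ext (vz.trans h2.symm)
          · rw [if_neg h2]
            congr 1
            apply Fin.ext
            have : ((Fin.ofNat (n + 1) (i - (4 + p)) : Fin (n + 1)) : ℕ) = i - (4 + p) :=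
              Nat.mod_eq_of_lt (by omega)
            rw [this, wire_val (by unfold wires; omega)]
            omega
    refine ⟨(y (e (3 + p)), fun j => y (e (4 + p + j))), ?_, hya⟩
    rw [Finset.mem_filter]
    exact ⟨Finset.mem_univ _, by rw [hya]; exact hy.2.2⟩
  · intro zu _
    simp [assign, vz]

/-! ### The signed count of the shifted formula -/

/-- The truth value of a formula given by the codes of its literals. -/
def evalCodes {Q : Type} (e : ℕ → Q) (cls : List (List ℕ)) (x : Q → Bool) : Bool :=
  cls.all fun cl => !cl.all fun c => negLit e c x

/-- The positions at which the clauses start when all of them are written one after another. -/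
def starts (cls : List (List ℕ)) : List ℕ :=
  (List.range cls.length).map fun i => (cls.take i).flatten.length

theorem asBank_lt {l : List ℕ} {i : ℕ} (h : i < l.length) : asBank l i = l[i] := by
  simp [asBank, h]

/-- The literals of the clause with number `l` can be found by means of the tables. -/
theorem starts_spec {cls : List (List ℕ)} {l : ℕ} (hl : l < cls.length) :
    asBank (cls.map List.length) l = cls[l].length ∧
      ∀ t, (ht : t < cls[l].length) →
        asBank cls.flatten (asBank (starts cls) l + t) = cls[l][t] := by
  have hst : asBank (starts cls) l = (cls.take l).flatten.length := by
    rw [asBank_lt (by simp [starts, hl])]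
    simp [starts]
  have hfl : cls.flatten = (cls.take l).flatten ++ (cls[l] ++ (cls.drop (l + 1)).flatten) := by
    conv_lhs => rw [← List.take_append_drop l cls, List.drop_eq_getElem_cons hl]
    rw [List.flatten_append, List.flatten_cons]
  refine ⟨by rw [asBank_lt (by simp [hl])]; simp, fun t ht => ?_⟩
  rw [hst]
  unfold asBank
  rw [hfl, List.getD_append_right _ _ _ _ (Nat.le_add_right _ _), Nat.add_sub_cancel_left,
    List.getD_append _ _ _ _ ht, List.getD_eq_getElem _ _ ht]

/-- The formula read from the tables is the given one. -/
theorem tables_eval {Q : Type} (e : ℕ → Q) (cls : List (List ℕ)) (x : Q → Bool) :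
    ((List.range cls.length).all fun l =>
      clauseVal e (asBank cls.flatten) (asBank (starts cls) l)
        (asBank (cls.map List.length) l) x) = evalCodes e cls x := by
  have h1 : evalCodes e cls x = (List.range cls.length).all fun l =>
      !(cls.getD l []).all fun c => negLit e c x := by
    unfold evalCodes
    rw [Bool.eq_iff_iff, List.all_eq_true, List.all_eq_true]
    constructor
    · intro h l hl
      rw [List.mem_range] at hl
      exact h _ (by rw [List.getD_eq_getElem _ _ hl]; exact List.getElem_mem hl)
    · intro h cl hcl
      obtain ⟨l, hl, rfl⟩ := List.getElem_of_mem hcl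
      have := h l (List.mem_range.2 hl)
      rwa [List.getD_eq_getElem _ _ hl] at this
  rw [h1]
  refine range_all_congr fun l hl => ?_
  unfold clauseVal
  obtain ⟨hln, h2⟩ := starts_spec hl
  rw [hln, List.getD_eq_getElem _ _ hl]
  congr 1
  rw [range_all_congr (P' := fun t => negLit e (cls[l].getD t 0) x) fun t ht => by
    rw [h2 t ht, List.getD_eq_getElem _ _ ht]]
  rw [Bool.eq_iff_iff, List.all_eq_true, List.all_eq_true]
  constructor
  · intro h c hc
    obtain ⟨t, ht, rfl⟩ := List.getElem_of_mem hc
    have := h t (List.mem_range.2 ht)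
    rwa [List.getD_eq_getElem _ _ ht] at this
  · intro h t ht
    rw [List.mem_range] at ht
    exact h _ (by rw [List.getD_eq_getElem _ _ ht]; exact List.getElem_mem ht)

/-- A set of exactly `a` bit strings, if `a < 2 ^ k`: those whose leading one is at a place where
the binary expansion of `a` has a one. There are `2 ^ i` strings with leading one at place `i`. -/
def Leads (k a : ℕ) (u : Fin k → Bool) : Prop :=
  (∃ i, u i = true) ∧ ∀ i : Fin k, a / 2 ^ (i : ℕ) % 2 = 0 → u i = true →
    ∃ j, i < j ∧ u j = true

/-- Splitting off the last bit of a string. -/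
theorem sum_snoc {M : Type} [AddCommMonoid M] (k : ℕ) (F : (Fin (k + 1) → Bool) → M) :
    ∑ u, F u =
      ∑ u : Fin k → Bool, F (Fin.snoc u true) + ∑ u : Fin k → Bool, F (Fin.snoc u false) := by
  rw [← (Fin.snocEquiv fun _ : Fin (k + 1) => Bool).sum_comp, Fintype.sum_prod_type,
    Fintype.sum_bool]
  rfl

theorem leads_snoc_true (k a : ℕ) (u : Fin k → Bool) :
    Leads (k + 1) a (Fin.snoc (α := fun _ => Bool) u true) ↔ a / 2 ^ k % 2 ≠ 0 := by
  constructor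
  · intro h h0
    obtain ⟨j, hj, -⟩ := h.2 (Fin.last k) (by simpa using h0) (by simp)
    exact absurd hj (not_lt.2 (Fin.le_last j))
  · intro h
    refine ⟨⟨Fin.last k, by simp⟩, fun i hi _ => ⟨Fin.last k, ?_, by simp⟩⟩
    refine lt_of_le_of_ne (Fin.le_last i) fun he => h ?_
    subst he
    simpa using hi

theorem leads_snoc_false (k a : ℕ) (u : Fin k → Bool) :
    Leads (k + 1) a (Fin.snoc (α := fun _ => Bool) u false) ↔ Leads k a u := by
  constructor
  · rintro ⟨⟨i, hi⟩, h⟩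
    refine ⟨?_, fun i h0 hi => ?_⟩
    · induction i using Fin.lastCases with
      | last => simp at hi
      | cast i => exact ⟨i, by simpa using hi⟩
    · obtain ⟨j, hj, hj'⟩ := h i.castSucc (by simpa using h0) (by simpa using hi)
      induction j using Fin.lastCases with
      | last => simp at hj'
      | cast j => exact ⟨j, by simpa using hj, by simpa using hj'⟩
  · rintro ⟨⟨i, hi⟩, h⟩
    refine ⟨⟨i.castSucc, by simpa using hi⟩, fun i h0 hi => ?_⟩
    induction i using Fin.lastCases with
    | last => simp at hi
    | cast i =>
      obtain ⟨j, hj, hj'⟩ := h i (by simpa using h0) (by simpa using hi)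
      exact ⟨j.castSucc, by simpa using hj, by simpa using hj'⟩

open Classical in
/-- There are `a` such strings, by induction on the number of binary digits. -/
theorem sum_leads (k a : ℕ) :
    (∑ u : Fin k → Bool, if Leads k a u then (1 : ℕ) else 0) = a % 2 ^ k := by
  induction k with
  | zero => simp [Leads, Nat.mod_one]
  | succ k ih =>
    rw [sum_snoc]
    simp only [leads_snoc_true, leads_snoc_false, ih]
    rw [Nat.mod_pow_succ]
    rcases Nat.mod_two_eq_zero_or_one (a / 2 ^ k) with h | h <;> simp [h, add_comm]

/-- The formula whose signed number of solutions is the number of solutions of `φ` minus `a`. Its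
variables are the wires from `3 + p` on. The first of them is the sign: where it is `0`, the last
variable is `0` and the others satisfy `φ`; where it is `1`, the variables other than the sign form
one of the strings counted by `Leads`. -/
def shiftedFormula {n : ℕ} (p a : ℕ) (φ : CNF n) : List (List ℕ) :=
  (φ.map fun cl => (2 * (3 + p) + 1) :: cl.map fun l => 2 * (l.1 : ℕ) + l.2.toNat + 2 * (4 + p)) ++
  ([[2 * (3 + p) + 1, 2 * (4 + p + n)]] ++
  ([(2 * (3 + p)) :: (List.range (n + 1)).map fun i => 2 * (4 + p + i) + 1] ++
  (List.range (n + 1)).flatMap fun i => if a / 2 ^ i % 2 = 0 then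
    [(2 * (3 + p)) :: (2 * (4 + p + i)) ::
      (List.range (n - i)).map fun t => 2 * (4 + p + (i + 1) + t) + 1] else []))

theorem negLit_even {Q : Type} (e : ℕ → Q) (w : ℕ) (x : Q → Bool) :
    negLit e (2 * w) x = x (e w) := by
  simp [negLit]

theorem negLit_odd {Q : Type} (e : ℕ → Q) (w : ℕ) (x : Q → Bool) :
    negLit e (2 * w + 1) x = !x (e w) := by
  have : (2 * w + 1) / 2 = w := by omega
  simp [negLit, this]

theorem assign_sign (n p : ℕ) (zu : Bool × (Fin (n + 1) → Bool)) :
    assign n p zu (wire n p (3 + p)) = zu.1 := by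
  have : (wire n p (3 + p) : ℕ) = 3 + p := wire_val (by unfold wires; omega)
  simp [assign, this]

theorem assign_var (n p : ℕ) (zu : Bool × (Fin (n + 1) → Bool)) {i : ℕ} (hi : i < n + 1) :
    assign n p zu (wire n p (4 + p + i)) = zu.2 ⟨i, hi⟩ := by
  have h : (wire n p (4 + p + i) : ℕ) = 4 + p + i := wire_val (by unfold wires; omega)
  have c1 : ¬ (4 + p + i = 0) := by omega
  have c2 : ¬ (4 + p + i < 3 + p) := by omega
  have c3 : ¬ (4 + p + i = 3 + p) := by omega
  have c4 : 4 + p + i - (4 + p) = i := by omega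
  simp only [assign, h, c1, c2, c3, c4, if_false]
  have : Fin.ofNat (n + 1) i = ⟨i, hi⟩ := Fin.ext (Nat.mod_eq_of_lt hi)
  rw [this]

/-- The meaning of `shiftedFormula`: clauses that contain the sign, in one polarity or the other,
are vacuous for one of its values. -/
theorem eval_shiftedFormula {n : ℕ} (p a : ℕ) (φ : CNF n) (zu : Bool × (Fin (n + 1) → Bool)) :
    evalCodes (wire n p) (shiftedFormula p a φ) (assign n p zu) = true ↔
      if zu.1 = true then Leads (n + 1) a zu.2
      else φ.eval (fun i => zu.2 i.castSucc) = true ∧ zu.2 (Fin.last n) = false := by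
  obtain ⟨z, u⟩ := zu
  have hz : assign n p (z, u) (wire n p (3 + p)) = z := assign_sign n p (z, u)
  have hu : ∀ i (hi : i < n + 1), assign n p (z, u) (wire n p (4 + p + i)) = u ⟨i, hi⟩ :=
    fun i hi => assign_var n p (z, u) hi
  have hlit : ∀ l : Fin n × Bool, negLit (wire n p) (2 * (l.1 : ℕ) + l.2.toNat + 2 * (4 + p))
      (assign n p (z, u)) = !(u l.1.castSucc == l.2) := by
    rintro ⟨v, b⟩
    have hv : (v : ℕ) < n + 1 := by omega
    cases b
    · have : 2 * (v : ℕ) + false.toNat + 2 * (4 + p) = 2 * (4 + p + v) := by simp; ring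
      dsimp only
      rw [this, negLit_even, hu _ hv]
      have : (⟨v, hv⟩ : Fin (n + 1)) = v.castSucc := rfl
      rw [this]
      cases u v.castSucc <;> rfl
    · have : 2 * (v : ℕ) + true.toNat + 2 * (4 + p) = 2 * (4 + p + v) + 1 := by simp; ring
      dsimp only
      rw [this, negLit_odd, hu _ hv]
      have : (⟨v, hv⟩ : Fin (n + 1)) = v.castSucc := rfl
      rw [this]
      cases u v.castSucc <;> rfl
  unfold evalCodes shiftedFormula
  rw [List.all_append, List.all_append, List.all_append]
  simp only [Bool.and_eq_true, List.all_eq_true, List.mem_map, List.mem_flatMap,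
    forall_exists_index, and_imp, forall_apply_eq_imp_iff₂,
    List.all_cons, List.all_nil, Bool.and_true, negLit_even, negLit_odd, hz, List.mem_range]
  cases z
  · -- the sign zero: the clauses of `φ`, and the one for the last variable
    simp only [Bool.not_false, Bool.true_and, Bool.false_eq_true, if_false, Bool.false_and,
      Bool.not_eq_true']
    constructor
    · rintro ⟨h1, h2, -⟩
      refine ⟨?_, by rw [hu n (by omega)] at h2; exact h2⟩
      unfold CNF.eval
      rw [List.all_eq_true]
      intro cl hcl
      have h3 := h1 cl hcl
      rw [List.any_eq_true]
      by_contra hne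
      push Not at hne
      rw [← Bool.not_eq_true, List.all_eq_true] at h3
      refine h3 fun c hc => ?_
      obtain ⟨l, hl, rfl⟩ := List.mem_map.1 hc
      rw [hlit]
      simpa using hne l hl
    · rintro ⟨h1, h2⟩
      refine ⟨fun cl hcl => ?_, by rw [hu n (by omega)]; exact h2, trivial, ?_⟩
      · unfold CNF.eval at h1
        rw [List.all_eq_true] at h1
        have h3 := h1 cl hcl
        rw [List.any_eq_true] at h3
        obtain ⟨l, hl, hl'⟩ := h3
        rw [← Bool.not_eq_true, List.all_eq_true]
        intro hall
        have := hall _ (List.mem_map.2 ⟨l, hl, rfl⟩)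
        rw [hlit] at this
        simp_all
      · intro cl i hi hcl
        split_ifs at hcl
        · rw [List.mem_singleton] at hcl
          subst hcl
          simp [negLit_even, hz]
        · simp at hcl
  · -- the sign one: the clause demanding some one, and those demanding a further one to the right
    simp only [Bool.not_true, Bool.false_and, if_true, Bool.true_and, Bool.not_false]
    constructor
    · rintro ⟨-, -, h1, h2⟩
      refine ⟨?_, fun i hi hui => ?_⟩
      · by_contra hne
        push Not at hne
        rw [Bool.not_eq_true', ← Bool.not_eq_true, List.all_eq_true] at h1
        refine h1 fun c hc => ?_
        obtain ⟨i, hi, rfl⟩ := List.mem_map.1 hc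
        rw [List.mem_range] at hi
        rw [negLit_odd, hu i hi]
        simpa using hne ⟨i, hi⟩
      · have h3 := h2 _ i i.isLt (by rw [if_pos hi]; exact List.mem_singleton.2 rfl)
        by_contra hne
        push Not at hne
        rw [Bool.not_eq_true', ← Bool.not_eq_true, List.all_eq_true] at h3
        refine h3 fun c hc => ?_
        rw [List.mem_cons, List.mem_cons] at hc
        rcases hc with rfl | rfl | hc
        · rw [negLit_even, hz]
        · rw [negLit_even, hu i i.isLt]; exact hui
        · obtain ⟨t, ht, rfl⟩ := List.mem_map.1 hc
          rw [List.mem_range] at ht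
          have hlt : (i : ℕ) + 1 + t < n + 1 := by omega
          rw [Nat.add_assoc (4 + p), negLit_odd, hu _ hlt]
          have := hne ⟨i + 1 + t, hlt⟩ (by rw [Fin.lt_def]; dsimp only; omega)
          simpa using this
    · rintro ⟨⟨i, hi⟩, h⟩
      refine ⟨fun _ _ => trivial, trivial, ?_, ?_⟩
      · rw [Bool.not_eq_true', ← Bool.not_eq_true, List.all_eq_true]
        intro hall
        have := hall _ (List.mem_map.2 ⟨i, List.mem_range.2 i.isLt, rfl⟩)
        rw [negLit_odd, hu _ i.isLt] at this
        simp [hi] at this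
      · intro cl i hi' hcl
        split_ifs at hcl with h0
        · rw [List.mem_singleton] at hcl
          subst hcl
          rw [Bool.not_eq_true', ← Bool.not_eq_true, List.all_eq_true]
          intro hall
          have hui := hall (2 * (4 + p + i)) (by simp)
          rw [negLit_even, hu _ hi'] at hui
          obtain ⟨j, hj, hj'⟩ := h ⟨i, hi'⟩ h0 hui
          have hlt := j.isLt
          rw [Fin.lt_def] at hj
          dsimp only at hj
          have := hall (2 * (4 + p + (i + 1) + (j - (i + 1))) + 1) (by
            refine List.mem_cons_of_mem _ (List.mem_cons_of_mem _ (List.mem_map.2 ⟨_, ?_, rfl⟩))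
            rw [List.mem_range]
            omega)
          rw [Nat.add_assoc (4 + p), negLit_odd, hu _ (by omega)] at this
          have e : (⟨i + 1 + (j - (i + 1)), by omega⟩ : Fin (n + 1)) = j :=
            Fin.ext (by dsimp only; omega)
          rw [e, hj'] at this
          simp at this
        · simp at hcl

/-- The difference that interference is to compute. -/
theorem signed_count {n : ℕ} (p a : ℕ) (φ : CNF n) :
    (∑ zu : Bool × (Fin (n + 1) → Bool),
      if evalCodes (wire n p) (shiftedFormula p a φ) (assign n p zu) = true then
        (if zu.1 = true then (-1 : ℂ) else 1) else 0) = (φ.count : ℂ) - (a % 2 ^ (n + 1) : ℕ) := by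
  classical
  simp only [eval_shiftedFormula]
  rw [Fintype.sum_prod_type, Fintype.sum_bool]
  simp only [if_true, Bool.false_eq_true, if_false]
  rw [sum_snoc (F := fun u : Fin (n + 1) → Bool =>
    if φ.eval (fun i => u i.castSucc) = true ∧ u (Fin.last n) = false then (1 : ℂ) else 0)]
  simp only [Fin.snoc_last, Fin.snoc_castSucc, Bool.true_eq_false, and_false, if_false, and_true,
    Finset.sum_const_zero, zero_add]
  have h1 : (∑ u : Fin n → Bool, if φ.eval (fun i => u i) = true then (1 : ℂ) else 0) =
      φ.count := by
    rw [CNF.count, Finset.sum_boole]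
  have h2 : (∑ u : Fin (n + 1) → Bool, if Leads (n + 1) a u then (-1 : ℂ) else 0) =
      -((a % 2 ^ (n + 1) : ℕ) : ℂ) := by
    rw [← sum_leads, Nat.cast_sum, ← Finset.sum_neg_distrib]
    refine Finset.sum_congr rfl fun u _ => ?_
    split_ifs <;> simp
  rw [h1, h2]
  ring

/-- The gates that evaluate the shifted formula. -/
def formulaOps (cls : List (List ℕ)) : List (Gate ℕ) :=
  andOps (clauseOps (asBank cls.flatten) (asBank (starts cls)) (asBank (cls.map List.length)))
    0 1 0 cls.length

/-- The circuit whose amplitude is the difference of the number of solutions of `φ` and `a`. -/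
def shiftCircuit {n : ℕ} (p a : ℕ) (φ : CNF n) : Circuit (wires n p) :=
  mapGates (wire n p) (countCircuit n p (formulaOps (shiftedFormula p a φ)))

theorem shiftedFormula_mem {n : ℕ} {p a : ℕ} {φ : CNF n} {cl : List ℕ}
    (h : cl ∈ shiftedFormula p a φ) :
    1 ≤ cl.length ∧ ∀ c ∈ cl, 3 + p ≤ c / 2 ∧ c / 2 < wires n p := by
  unfold wires
  simp only [shiftedFormula, List.mem_append, List.mem_map, List.mem_singleton,
    List.mem_flatMap, List.mem_range] at h
  rcases h with ⟨cl', _, rfl⟩ | rfl | rfl | ⟨i, hi, h⟩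
  · refine ⟨by simp, fun c hc => ?_⟩
    rcases List.mem_cons.1 hc with rfl | hc
    · omega
    · obtain ⟨l, _, rfl⟩ := List.mem_map.1 hc
      have h1 := l.1.isLt
      have h2 : l.2.toNat ≤ 1 := by cases l.2 <;> simp
      omega
  · refine ⟨by simp, fun c hc => ?_⟩
    simp only [List.mem_cons, List.not_mem_nil, or_false] at hc
    omega
  · refine ⟨by simp, fun c hc => ?_⟩
    simp only [List.mem_cons, List.mem_map, List.mem_range] at hc
    rcases hc with rfl | ⟨i, hi, rfl⟩ <;> omega
  · split_ifs at h
    · rw [List.mem_singleton] at h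
      subst h
      refine ⟨by simp, fun c hc => ?_⟩
      simp only [List.mem_cons, List.mem_map, List.mem_range] at hc
      rcases hc with rfl | rfl | ⟨t, ht, rfl⟩ <;> omega
    · simp at h

/-- The absolute value of an integer is encoded into an amplitude on `n + 5 + p` qubits. -/
theorem shiftCircuit_absAmplitude {n : ℕ} (p a : ℕ) (φ : CNF n) :
    (shiftCircuit p a φ).absAmplitude (fun _ => false) =
      |(φ.count : ℝ) - (a % 2 ^ (n + 1) : ℕ)| / 2 ^ (n + 2) := by
  have hadds := cnfOps_adds (wire n p)
    (fun i j hi hj h => wire_inj (by unfold wires; omega) (by unfold wires; omega) h)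
    (asBank (shiftedFormula p a φ).flatten) (asBank (starts (shiftedFormula p a φ)))
    (asBank ((shiftedFormula p a φ).map List.length)) (M := (shiftedFormula p a φ).length)
    (by simp [shiftedFormula]; omega)
    (fun l hl => by
      rw [(starts_spec hl).1]
      exact (shiftedFormula_mem (List.getElem_mem hl)).1)
    (fun l hl t ht k hk => by
      rw [(starts_spec hl).1] at ht
      rw [(starts_spec hl).2 t ht]
      have := (shiftedFormula_mem (List.getElem_mem hl)).2 _ (List.getElem_mem ht)
      exact wire_ne this.2 (by unfold wires; omega) (by omega))
  simp only [tables_eval] at hadds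
  unfold Circuit.absAmplitude shiftCircuit formulaOps
  rw [countCircuit_amplitude n p _ _ hadds, signed_count, norm_mul, norm_pow, norm_inv,
    Complex.norm_ofNat, inv_pow, inv_mul_eq_div]
  congr 1
  have : (φ.count : ℂ) - ((a % 2 ^ (n + 1) : ℕ) : ℂ) =
      (((φ.count : ℝ) - ((a % 2 ^ (n + 1) : ℕ) : ℝ) : ℝ) : ℂ) := by push_cast; rfl
  rw [this, Complex.norm_real, Real.norm_eq_abs]

/-! ### Code for the tables of the shifted formula

The tables are held in the banks `1` (codes of the literals), `2` (starting positions of the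
clauses) and `3` (lengths of the clauses); registers `11` and `12` point behind the last literal and
the last clause. Register `10` holds the constant one and register `26` the constant zero. -/

theorem execs_append (l l' : List Instr) (m : Mem) : execs (l ++ l') m = execs l' (execs l m) := by
  induction l generalizing m with
  | nil => rfl
  | cons i l ih => exact ih _

theorem blkSteps_append (l l' : List Instr) : blkSteps (l ++ l') = blkSteps l + blkSteps l' := by
  induction l with
  | nil => simp [blkSteps]
  | cons i l ih => simp [blkSteps, ih, Nat.add_assoc]

/-- A loop with a known number of rounds. -/
theorem Det.loop_count {r : ℕ} {P : Prog} {R : Mem → Prop} (I : ℕ → Mem → Prop) (c : ℕ)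
    (h0 : ∀ m, I 0 m → m r 0 = 0 ∧ R m)
    (hs : ∀ k m, I (k + 1) m → m r 0 ≠ 0 ∧ Det P m c (I k)) {k : ℕ} {m : Mem} (h : I k m) :
    Det (.loop r P) m (k * (c + 1) + 1) R := by
  induction k generalizing m with
  | zero => simpa using Det.loop_false (h0 m h).1 (h0 m h).2
  | succ k ih =>
    obtain ⟨h1, h2⟩ := hs k m h
    refine (Det.loop_true h1 (h2.imp fun m' hm' => ih hm')).mono (le_of_eq ?_) fun _ => id
    ring

theorem update_asBank (l : List ℕ) (v : ℕ) :
    Function.update (asBank l) l.length v = asBank (l ++ [v]) := by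
  funext j
  unfold asBank
  by_cases h : j = l.length
  · subst h; simp
  · rw [Function.update_of_ne h]
    rcases lt_or_gt_of_ne h with h | h
    · rw [List.getD_append _ _ _ _ h]
    · rw [List.getD_eq_default _ _ (by omega), List.getD_eq_default _ _ (by simp; omega)]

/-- Open a clause. -/
def openBlk : List Instr := [.store 2 12 11]

/-- Append the literal in register `r`. -/
def litBlk (r : ℕ) : List Instr := [.store 1 11 r, .add 11 11 10]

/-- Close the open clause. -/
def closeBlk : List Instr := [.load 18 2 12, .sub 18 11 18, .store 3 12 18, .add 12 12 10]

theorem execs_openBlk_of_ne {m : Mem} {b : ℕ} (h : b ≠ 2) : execs openBlk m b = m b := by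
  simp [openBlk, execs, Instr.memExec, upd_of_ne, h]

theorem execs_litBlk_of_ne {m : Mem} {r b : ℕ} (h : b ≠ 1) (h' : b ≠ 11) :
    execs (litBlk r) m b = m b := by
  simp [litBlk, execs, Instr.memExec, upd_of_ne, h, h']

theorem execs_closeBlk_of_ne {m : Mem} {b : ℕ} (h : b ≠ 18) (h' : b ≠ 3) (h'' : b ≠ 12) :
    execs closeBlk m b = m b := by
  simp [closeBlk, execs, Instr.memExec, upd_of_ne, h, h', h'']

/-- The memory holds the tables of the clauses `cls`. -/
def Tables (m : Mem) (cls : List (List ℕ)) : Prop :=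
  m 1 = asBank cls.flatten ∧ m 2 = asBank (starts cls) ∧ m 3 = asBank (cls.map List.length) ∧
    m 11 0 = cls.flatten.length ∧ m 12 0 = cls.length

/-- The memory holds the tables of the clauses `cls` and of a further clause that is still open and
has the literals `cur` so far. -/
def OpenTables (m : Mem) (cls : List (List ℕ)) (cur : List ℕ) : Prop :=
  m 1 = asBank (cls.flatten ++ cur) ∧ m 2 = asBank (starts cls ++ [cls.flatten.length]) ∧
    m 3 = asBank (cls.map List.length) ∧ m 11 0 = (cls.flatten ++ cur).length ∧
    m 12 0 = cls.length

theorem Tables.congr {m m' : Mem} {cls : List (List ℕ)} (h : Tables m cls)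
    (e : ∀ b, b = 1 ∨ b = 2 ∨ b = 3 ∨ b = 11 ∨ b = 12 → m' b = m b) : Tables m' cls := by
  unfold Tables at *
  rwa [e 1 (by simp), e 2 (by simp), e 3 (by simp), e 11 (by simp), e 12 (by simp)]

theorem OpenTables.congr {m m' : Mem} {cls : List (List ℕ)} {cur : List ℕ}
    (h : OpenTables m cls cur)
    (e : ∀ b, b = 1 ∨ b = 2 ∨ b = 3 ∨ b = 11 ∨ b = 12 → m' b = m b) : OpenTables m' cls cur := by
  unfold OpenTables at *
  rwa [e 1 (by simp), e 2 (by simp), e 3 (by simp), e 11 (by simp), e 12 (by simp)]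

theorem starts_length (cls : List (List ℕ)) : (starts cls).length = cls.length := by
  simp [starts]

theorem starts_append (cls : List (List ℕ)) (cl : List ℕ) :
    starts (cls ++ [cl]) = starts cls ++ [cls.flatten.length] := by
  unfold starts
  rw [List.length_append, List.length_singleton, List.range_succ, List.map_append]
  congr 1
  · refine List.map_congr_left fun i hi => ?_
    rw [List.mem_range] at hi
    rw [List.take_append_of_le_length hi.le]
  · simp

theorem Tables.open {m : Mem} {cls : List (List ℕ)} (h : Tables m cls) :
    OpenTables (execs openBlk m) cls [] := by
  obtain ⟨h1, h2, h3, h4, h5⟩ := h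
  have h2' : execs openBlk m 2 = asBank (starts cls ++ [cls.flatten.length]) := by
    change upd m 2 (m 12 0) (m 11 0) 2 = _
    rw [upd_self, h2, h5, h4, ← starts_length, update_asBank]
  refine ⟨?_, h2', ?_, ?_, ?_⟩
  · rw [execs_openBlk_of_ne (by norm_num), h1, List.append_nil]
  · rw [execs_openBlk_of_ne (by norm_num), h3]
  · rw [execs_openBlk_of_ne (by norm_num), h4, List.append_nil]
  · rw [execs_openBlk_of_ne (by norm_num), h5]

theorem OpenTables.lit {m : Mem} {cls : List (List ℕ)} {cur : List ℕ} (h : OpenTables m cls cur)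
    (h10 : m 10 0 = 1) (r : ℕ) :
    OpenTables (execs (litBlk r) m) cls (cur ++ [m r 0]) := by
  obtain ⟨h1, h2, h3, h4, h5⟩ := h
  refine ⟨?_, ?_, ?_, ?_, ?_⟩
  · simp [litBlk, execs, Instr.memExec, upd_of_ne, h1, h4, -List.length_append, update_asBank]
  · simp [litBlk, execs, Instr.memExec, upd_of_ne, h2]
  · simp [litBlk, execs, Instr.memExec, upd_of_ne, h3]
  · simp [litBlk, execs, Instr.memExec, upd_of_ne, h4, h10]; omega
  · simp [litBlk, execs, Instr.memExec, upd_of_ne, h5]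

theorem OpenTables.close {m : Mem} {cls : List (List ℕ)} {cur : List ℕ} (h : OpenTables m cls cur)
    (h10 : m 10 0 = 1) : Tables (execs closeBlk m) (cls ++ [cur]) := by
  obtain ⟨h1, h2, h3, h4, h5⟩ := h
  have hst : m 2 cls.length = cls.flatten.length := by
    rw [h2, asBank_lt (by simp [starts_length])]
    simp [starts_length]
  refine ⟨?_, ?_, ?_, ?_, ?_⟩
  · simp [closeBlk, execs, Instr.memExec, upd_of_ne, h1]
  · simp [closeBlk, execs, Instr.memExec, upd_of_ne, h2, starts_append]
  · have := update_asBank (cls.map List.length) cur.length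
    rw [List.length_map] at this
    have h6 : (cls.flatten ++ cur).length - cls.flatten.length = cur.length := by simp
    rw [List.map_append, List.map_singleton, ← this, ← h3]
    simp [closeBlk, execs, Instr.memExec, upd_of_ne, h4, h5, hst, h6, -List.length_append,
      -List.length_flatten]
  · simp [closeBlk, execs, Instr.memExec, upd_of_ne, h4]
  · simp [closeBlk, execs, Instr.memExec, upd_of_ne, h5, h10]

/-- Append the positive literals of a range of wires: as many as register `17` says, from the
literal in register `41` on. -/
def rangeLoop : Prog :=
  .loop 17 (blk (litBlk 41 ++ [.add 41 41 10, .add 41 41 10, .sub 17 17 10]))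

theorem rangeLoop_det {m : Mem} {cls : List (List ℕ)} {cur : List ℕ} {w k : ℕ}
    (h : OpenTables m cls cur) (h10 : m 10 0 = 1) (h41 : m 41 0 = 2 * w + 1) (h17 : m 17 0 = k) :
    Det rangeLoop m (k * 6 + 1) fun m' =>
      OpenTables m' cls (cur ++ (List.range k).map fun t => 2 * (w + t) + 1) ∧
        ∀ b, b ≠ 1 → b ≠ 11 → b ≠ 17 → b ≠ 41 → m' b = m b := by
  refine Det.loop_count (fun j m' => ∃ i, i + j = k ∧
    OpenTables m' cls (cur ++ (List.range i).map fun t => 2 * (w + t) + 1) ∧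
    m' 41 0 = 2 * (w + i) + 1 ∧ m' 17 0 = j ∧
    ∀ b, b ≠ 1 → b ≠ 11 → b ≠ 17 → b ≠ 41 → m' b = m b) 5 ?_ ?_
    ⟨0, by omega, by simpa using h, by simpa using h41, h17, fun _ _ _ _ _ => rfl⟩
  · rintro m' ⟨i, hi, h1, -, h3, h4⟩
    rw [Nat.add_zero] at hi
    subst hi
    exact ⟨h3, h1, h4⟩
  · rintro j m' ⟨i, hi, h1, h2, h3, h4⟩
    refine ⟨by omega, Det.blk ?_⟩
    have h10' : m' 10 0 = 1 := by rw [h4 10] <;> first | exact h10 | norm_num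
    have h5 := h1.lit h10' 41
    rw [execs_append]
    refine ⟨i + 1, by omega, ?_, ?_, ?_, ?_⟩
    · rw [List.range_succ, List.map_append, ← List.append_assoc]
      rw [h2] at h5
      refine h5.congr fun b hb => ?_
      have : b ≠ 41 ∧ b ≠ 17 := by omega
      simp [execs, Instr.memExec, upd_of_ne, this]
    · simp [execs, Instr.memExec, upd_of_ne, execs_litBlk_of_ne, h2, h10']; omega
    · simp [execs, Instr.memExec, upd_of_ne, execs_litBlk_of_ne, h3, h10']
    · intro b b1 b2 b3 b4
      simp [execs, Instr.memExec, upd_of_ne, execs_litBlk_of_ne, b1, b2, b3, b4, h4]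

/-- The memory that stays fixed while the tables are written: the input in bank `0`, the empty
bank `4`, and some constants. -/
structure Consts (n p : ℕ) (W : ℕ → ℕ) (m : Mem) : Prop where
  input : m 0 = W
  out : m 4 = fun _ => 0
  one : m 10 0 = 1
  vars : m 19 0 = n
  pos : m 20 0 = 2 * (3 + p) + 1
  neg : m 21 0 = 2 * (3 + p)
  off : m 22 0 = 2 * (4 + p)
  three : m 24 0 = 3
  four : m 25 0 = 4
  zero : m 26 0 = 0

theorem Consts.congr {n p : ℕ} {W : ℕ → ℕ} {m m' : Mem} (h : Consts n p W m)
    (e : ∀ b, b = 0 ∨ b = 4 ∨ b = 10 ∨ (19 ≤ b ∧ b ≤ 26) → m' b = m b) : Consts n p W m' := by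
  obtain ⟨h1, h2, h3, h4, h5, h6, h7, h8, h9, h10⟩ := h
  refine ⟨?_, ?_, ?_, ?_, ?_, ?_, ?_, ?_, ?_, ?_⟩ <;> rw [e _ (by norm_num)] <;> assumption

theorem asBank_append_cons (l₁ l₂ : List ℕ) (x : ℕ) :
    asBank (l₁ ++ x :: l₂) l₁.length = x := by
  simp [asBank]

/-- The code of a literal of the input. -/
def litCode {n : ℕ} (l : Fin n × Bool) : ℕ := 2 * (l.1 : ℕ) + l.2.toNat

/-- The clauses of a formula, as they appear in the input. -/
def body {n : ℕ} (φ : CNF n) : List ℕ := φ.flatMap fun cl => cl.length :: cl.map litCode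

theorem encode_eq {n : ℕ} (φ : CNF n) : φ.encode = n :: φ.length :: body φ := rfl

/-- A clause of the input, with the wires of the circuit and with the sign as a further literal. -/
def liftClause {n : ℕ} (p : ℕ) (cl : List (Fin n × Bool)) : List ℕ :=
  (2 * (3 + p) + 1) :: cl.map fun l => litCode l + 2 * (4 + p)

/-- Copy the literals of a clause. -/
def copyLits : Prog :=
  .loop 17 (blk ([.load 18 0 15, .add 18 18 22] ++ litBlk 18 ++ [.add 15 15 10, .sub 17 17 10]))

/-- The literals in `d` have been copied, those in `r` remain; `l₁` and `l₂` are the parts of the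
input before and after the clause. -/
theorem copyLits_det {n p : ℕ} {l₁ l₂ : List ℕ} {cls : List (List ℕ)}
    (r : List (Fin n × Bool)) : ∀ (d : List (Fin n × Bool)) (m : Mem),
    Consts n p (asBank (l₁ ++ (d ++ r).map litCode ++ l₂)) m → OpenTables m cls (liftClause p d) →
    m 15 0 = l₁.length + d.length → m 17 0 = r.length →
    Det copyLits m (r.length * 7 + 1) fun m' =>
      Consts n p (asBank (l₁ ++ (d ++ r).map litCode ++ l₂)) m' ∧
      OpenTables m' cls (liftClause p (d ++ r)) ∧ m' 15 0 = l₁.length + d.length + r.length ∧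
      ∀ b, b ≠ 1 → b ≠ 11 → b ≠ 15 → b ≠ 17 → b ≠ 18 → m' b = m b := by
  induction r with
  | nil =>
    intro d m h1 h2 h3 h4
    have : Det copyLits m 1 (fun m' => Consts n p (asBank (l₁ ++
      (d ++ []).map litCode ++ l₂)) m' ∧ OpenTables m' cls (liftClause p (d ++ [])) ∧
      m' 15 0 = l₁.length + d.length + 0 ∧
      ∀ b, b ≠ 1 → b ≠ 11 → b ≠ 15 → b ≠ 17 → b ≠ 18 → m' b = m b) :=
      Det.loop_false h4 ⟨h1, by simpa using h2, h3, fun _ _ _ _ _ _ => rfl⟩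
    simpa using this
  | cons x r ih =>
    intro d m h1 h2 h3 h4
    refine (Det.loop_true (k := 6) (by rw [h4]; simp) ?_).mono
      (k := 1 + (6 + (r.length * 7 + 1))) (by simp; omega) fun _ => id
    refine Det.blk ?_
    have hx : m 0 (m 15 0) = litCode x := by
      rw [h1.input, h3]
      have := asBank_append_cons (l₁ ++ d.map litCode) (r.map litCode ++ l₂) (litCode x)
      simpa using this
    rw [execs_append, execs_append]
    set m₁ := execs [.load 18 0 15, .add 18 18 22] m with hm₁
    have e1 : ∀ b, b ≠ 18 → m₁ b = m b := fun b hb => by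
      simp [hm₁, execs, Instr.memExec, upd_of_ne, hb]
    have v1 : m₁ 18 0 = litCode x + 2 * (4 + p) := by
      simp [hm₁, execs, Instr.memExec, upd_of_ne, hx, h1.off]
    have t1 : OpenTables m₁ cls (liftClause p d) := h2.congr fun b hb => e1 b (by omega)
    have t2 := t1.lit (by rw [e1 _ (by norm_num), h1.one]) 18
    rw [v1] at t2
    set m₂ := execs (litBlk 18) m₁ with hm₂
    have e2 : ∀ b, b ≠ 1 → b ≠ 11 → b ≠ 18 → m₂ b = m b := fun b b1 b2 b3 => by
      rw [hm₂, execs_litBlk_of_ne b1 b2, e1 b b3]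
    set m₃ := execs [.add 15 15 10, .sub 17 17 10] m₂ with hm₃
    have e3 : ∀ b, b ≠ 15 → b ≠ 17 → m₃ b = m₂ b := fun b b1 b2 => by
      simp [hm₃, execs, Instr.memExec, upd_of_ne, b1, b2]
    have e4 : ∀ b, b ≠ 1 → b ≠ 11 → b ≠ 15 → b ≠ 17 → b ≠ 18 → m₃ b = m b :=
      fun b b1 b2 b3 b4 b5 => by rw [e3 b b3 b4, e2 b b1 b2 b5]
    have c3 := h1.congr (m' := m₃) fun b hb => e4 b (by omega) (by omega) (by omega) (by omega)
      (by omega)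
    have t3 : OpenTables m₃ cls (liftClause p (d ++ [x])) := by
      have := t2.congr (m' := m₃) fun b hb => e3 b (by omega) (by omega)
      simpa [liftClause] using this
    have p3 : m₃ 15 0 = l₁.length + (d ++ [x]).length := by
      simp [hm₃, execs, Instr.memExec, upd_of_ne, e2, h3, h1.one]
      omega
    have q3 : m₃ 17 0 = r.length := by
      simp [hm₃, execs, Instr.memExec, upd_of_ne, e2, h4, h1.one]
    have eq : d ++ x :: r = (d ++ [x]) ++ r := by simp
    rw [eq] at c3 ⊢
    refine (ih (d ++ [x]) m₃ c3 t3 p3 q3).imp fun m' ⟨a1, a2, a3, a4⟩ =>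
      ⟨a1, a2, by rw [a3]; simp; omega, fun b b1 b2 b3 b4 b5 => ?_⟩
    rw [a4 b b1 b2 b3 b4 b5, e4 b b1 b2 b3 b4 b5]

/-- Copy the clauses of the input. -/
def copyClauses : Prog :=
  .loop 16 (.seq (blk (openBlk ++ litBlk 20 ++ [.load 17 0 15, .add 15 15 10]))
    (.seq copyLits (blk (closeBlk ++ [.sub 16 16 10]))))

/-- The clauses in `d` have been copied, those in `r` remain. -/
theorem copyClauses_det {n p : ℕ} {l₁ l₂ : List ℕ}
    (r : CNF n) : ∀ (d : CNF n) (m : Mem),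
    Consts n p (asBank (l₁ ++ body (d ++ r) ++ l₂)) m → Tables m (d.map (liftClause p)) →
    m 15 0 = (l₁ ++ body d).length → m 16 0 = r.length →
    Det copyClauses m ((r.map fun cl => 12 + cl.length * 7).sum + 1) fun m' =>
      Consts n p (asBank (l₁ ++ body (d ++ r) ++ l₂)) m' ∧
      Tables m' ((d ++ r).map (liftClause p)) ∧ m' 15 0 = (l₁ ++ body (d ++ r)).length := by
  induction r with
  | nil =>
    intro d m h1 h2 h3 h4
    have : Det copyClauses m 1 (fun m' => Consts n p (asBank (l₁ ++
      body (d ++ []) ++ l₂)) m' ∧ Tables m' ((d ++ []).map (liftClause p)) ∧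
      m' 15 0 = (l₁ ++ body (d ++ [])).length) := Det.loop_false h4
      ⟨h1, by simpa using h2, by simpa using h3⟩
    simpa using this
  | cons cl r ih =>
    intro d m h1 h2 h3 h4
    refine (Det.loop_true (k := 5 + ((cl.length * 7 + 1) + 5)) (by rw [h4]; simp) ?_).mono
      (k := 1 + ((5 + ((cl.length * 7 + 1) + 5)) +
        ((r.map fun cl => 12 + cl.length * 7).sum + 1))) (by simp; omega) fun _ => id
    refine Det.seq (Det.blk ?_)
    have hb : body (d ++ cl :: r) = body d ++ (cl.length :: (cl.map litCode ++ body r)) := by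
      simp [body]
    have hx : m 0 (m 15 0) = cl.length := by
      rw [h1.input, h3, hb]
      have := asBank_append_cons (l₁ ++ body d) (cl.map litCode ++ body r ++ l₂) cl.length
      simpa using this
    rw [execs_append, execs_append]
    set m₁ := execs openBlk m with hm₁
    have e1 : ∀ b, b ≠ 2 → m₁ b = m b := fun b hb => execs_openBlk_of_ne hb
    have t1 : OpenTables m₁ (d.map (liftClause p)) [] := h2.open
    have t2 := t1.lit (by rw [e1 _ (by norm_num), h1.one]) 20
    rw [e1 20 (by norm_num), h1.pos] at t2
    set m₂ := execs (litBlk 20) m₁ with hm₂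
    have e2 : ∀ b, b ≠ 1 → b ≠ 2 → b ≠ 11 → m₂ b = m b := fun b b1 b2 b3 => by
      rw [hm₂, execs_litBlk_of_ne b1 b3, e1 b b2]
    set m₃ := execs [.load 17 0 15, .add 15 15 10] m₂ with hm₃
    have e3 : ∀ b, b ≠ 15 → b ≠ 17 → m₃ b = m₂ b := fun b b1 b2 => by
      simp [hm₃, execs, Instr.memExec, upd_of_ne, b1, b2]
    have e4 : ∀ b, b ≠ 1 → b ≠ 2 → b ≠ 11 → b ≠ 15 → b ≠ 17 → m₃ b = m b :=
      fun b b1 b2 b3 b4 b5 => by rw [e3 b b4 b5, e2 b b1 b2 b3]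
    have c3 := h1.congr (m' := m₃) fun b hb => e4 b (by omega) (by omega) (by omega) (by omega)
      (by omega)
    have t3 : OpenTables m₃ (d.map (liftClause p)) (liftClause p ([] : List (Fin n × Bool))) :=
      t2.congr (m' := m₃) fun b hb => e3 b (by omega) (by omega)
    have p3 : m₃ 15 0 =
        (l₁ ++ body d ++ [cl.length]).length + ([] : List (Fin n × Bool)).length := by
      simp [hm₃, execs, Instr.memExec, upd_of_ne, e2, h3, h1.one]
      omega
    have q3 : m₃ 17 0 = cl.length := by
      simp [hm₃, execs, Instr.memExec, upd_of_ne, e2, hx]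
    have hW : l₁ ++ body (d ++ cl :: r) ++ l₂ = (l₁ ++ body d ++ [cl.length]) ++
        ([] ++ cl).map litCode ++ (body r ++ l₂) := by
      rw [hb]; simp
    rw [hW] at c3
    refine Det.seq ((copyLits_det cl [] m₃ c3 t3 p3 q3).imp ?_)
    rintro m₄ ⟨c4, t4, p4, e5⟩
    rw [← hW] at c4
    refine Det.blk ?_
    rw [execs_append]
    have t5 := t4.close c4.one
    set m₅ := execs closeBlk m₄ with hm₅
    have e6 : ∀ b, b ≠ 18 → b ≠ 3 → b ≠ 12 → m₅ b = m₄ b :=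
      fun b b1 b2 b3 => execs_closeBlk_of_ne b1 b2 b3
    set m₆ := execs [.sub 16 16 10] m₅ with hm₆
    have e7 : ∀ b, b ≠ 16 → m₆ b = m₅ b := fun b b1 => by
      simp [hm₆, execs, Instr.memExec, upd_of_ne, b1]
    have c6 := c4.congr (m' := m₆) fun b hb => by
      rw [e7 b (by omega), e6 b (by omega) (by omega) (by omega)]
    have eq : d ++ cl :: r = (d ++ [cl]) ++ r := by simp
    rw [eq] at c6 ⊢
    refine ih (d ++ [cl]) m₆ c6 ?_ ?_ ?_
    · have := t5.congr (m' := m₆) fun b hb => e7 b (by omega)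
      simpa using this
    · rw [e7 15 (by norm_num), e6 15 (by norm_num) (by norm_num) (by norm_num), p4]
      simp [body]
      omega
    · simp [hm₆, execs, Instr.memExec, e6, e5, e4, h4, c4.one]

/-- The clauses for the strings counted by `Leads`. Register `40` holds the number `a`, and is
shifted to the right. -/
def bitLoop : Prog :=
  .loop 16 (.seq (blk [.half 43 40, .add 44 43 43, .sub 44 40 44, .add 40 43 26, .sub 16 16 10])
    (.seq (.cond 44 .skip
      (.seq (blk (openBlk ++ (litBlk 21 ++ (litBlk 42 ++
        [.add 41 42 10, .add 41 41 10, .add 41 41 10, .add 17 16 26]))))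
        (.seq rangeLoop (blk closeBlk))))
      (blk [.add 42 42 10, .add 42 42 10])))

/-- The clauses that `bitLoop` writes for the place `i`. -/
def bitClause (n p a i : ℕ) : List (List ℕ) :=
  if a / 2 ^ i % 2 = 0 then
    [(2 * (3 + p)) :: (2 * (4 + p + i)) ::
      (List.range (n - i)).map fun t => 2 * (4 + p + (i + 1) + t) + 1] else []

/-- With `j` rounds to go, the clauses of the places below `n + 1 - j` have been written, and
register `40` holds the remaining binary digits of `a`. -/
theorem bitLoop_det {n p a : ℕ} {W : ℕ → ℕ} {cls : List (List ℕ)} {m : Mem}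
    (hc : Consts n p W m) (ht : Tables m cls) (h40 : m 40 0 = a) (h42 : m 42 0 = 2 * (4 + p))
    (h16 : m 16 0 = n + 1) :
    Det bitLoop m ((n + 1) * ((5 + ((1 + (9 + ((n * 6 + 1) + 4))) + 2)) + 1) + 1) fun m' =>
      Consts n p W m' ∧ Tables m' (cls ++ (List.range (n + 1)).flatMap (bitClause n p a)) := by
  refine Det.loop_count (fun j m' => ∃ i, i + j = n + 1 ∧ Consts n p W m' ∧
    Tables m' (cls ++ (List.range i).flatMap (bitClause n p a)) ∧
    m' 40 0 = a / 2 ^ i ∧ m' 42 0 = 2 * (4 + p + i) ∧ m' 16 0 = j) _ ?_ ?_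
    ⟨0, by omega, hc, by simpa using ht, by simpa using h40, by simpa using h42, h16⟩
  · rintro m' ⟨i, hi, h1, h2, -, -, h5⟩
    rw [Nat.add_zero] at hi
    subst hi
    exact ⟨h5, h1, h2⟩
  · rintro j m' ⟨i, hi, h1, h2, h3, h4, h5⟩
    refine ⟨by omega, Det.seq (Det.blk ?_)⟩
    set m₁ := execs [.half 43 40, .add 44 43 43, .sub 44 40 44, .add 40 43 26, .sub 16 16 10] m'
      with hm₁
    have e1 : ∀ b, b ≠ 43 → b ≠ 44 → b ≠ 40 → b ≠ 16 → m₁ b = m' b := fun b b1 b2 b3 b4 => by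
      simp [hm₁, execs, Instr.memExec, upd_of_ne, b1, b2, b3, b4]
    have c1 := h1.congr (m' := m₁) fun b hb => e1 b (by omega) (by omega) (by omega) (by omega)
    have t1 := h2.congr (m' := m₁) fun b hb => e1 b (by omega) (by omega) (by omega) (by omega)
    have v44 : m₁ 44 0 = a / 2 ^ i % 2 := by
      simp [hm₁, execs, Instr.memExec, upd_of_ne, h3]
      omega
    have v40 : m₁ 40 0 = a / 2 ^ (i + 1) := by
      simp [hm₁, execs, Instr.memExec, upd_of_ne, h3, h1.zero]
      rw [pow_succ, Nat.div_div_eq_div_mul]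
    have v16 : m₁ 16 0 = j := by
      simp [hm₁, execs, Instr.memExec, upd_of_ne, h5, h1.one]
    have v42 : m₁ 42 0 = 2 * (4 + p + i) := by rw [e1 42] <;> first | exact h4 | norm_num
    have rest : ∀ m₂ : Mem, Consts n p W m₂ →
        Tables m₂ (cls ++ (List.range (i + 1)).flatMap (bitClause n p a)) →
        m₂ 40 0 = m₁ 40 0 → m₂ 42 0 = m₁ 42 0 → m₂ 16 0 = m₁ 16 0 →
        Det (blk [.add 42 42 10, .add 42 42 10]) m₂ 2 fun m' => ∃ i, i + j = n + 1 ∧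
          Consts n p W m' ∧ Tables m' (cls ++ (List.range i).flatMap (bitClause n p a)) ∧
          m' 40 0 = a / 2 ^ i ∧ m' 42 0 = 2 * (4 + p + i) ∧ m' 16 0 = j := by
      intro m₂ c2 t2 w40 w42 w16
      refine Det.blk ⟨i + 1, by omega, c2.congr fun b hb => ?_, t2.congr fun b hb => ?_, ?_, ?_, ?_⟩
      · have hb' : b ≠ 42 := by omega
        simp [execs, Instr.memExec, upd_of_ne, hb']
      · have hb' : b ≠ 42 := by omega
        simp [execs, Instr.memExec, upd_of_ne, hb']
      · simp [execs, Instr.memExec, upd_of_ne, w40, v40]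
      · simp [execs, Instr.memExec, upd_of_ne, w42, v42, c2.one]
        omega
      · simp [execs, Instr.memExec, upd_of_ne, w16, v16]
    have hrange : (List.range (i + 1)).flatMap (bitClause n p a) =
        (List.range i).flatMap (bitClause n p a) ++ bitClause n p a i := by
      rw [List.range_succ, List.flatMap_append]
      simp
    refine Det.seq ?_
    by_cases hbit : a / 2 ^ i % 2 = 0
    · refine Det.cond_false (by rw [v44, hbit]) ?_
      have hcl : bitClause n p a i = [(2 * (3 + p)) :: (2 * (4 + p + i)) ::
          (List.range (n - i)).map fun t => 2 * (4 + p + (i + 1) + t) + 1] := if_pos hbit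
      refine Det.seq (Det.blk ?_)
      rw [execs_append, execs_append, execs_append]
      set m₂ := execs openBlk m₁ with hm₂
      have e2 : ∀ b, b ≠ 2 → m₂ b = m₁ b := fun b hb => execs_openBlk_of_ne hb
      have t1' : OpenTables m₂ _ [] := t1.open
      have t2 := t1'.lit (by rw [e2 _ (by norm_num), c1.one]) 21
      rw [e2 21 (by norm_num), c1.neg] at t2
      set m₃ := execs (litBlk 21) m₂ with hm₃
      have e3 : ∀ b, b ≠ 1 → b ≠ 2 → b ≠ 11 → m₃ b = m₁ b := fun b b1 b2 b3 => by
        rw [hm₃, execs_litBlk_of_ne b1 b3, e2 b b2]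
      have t3 := t2.lit (by rw [e3 _ (by norm_num) (by norm_num) (by norm_num), c1.one]) 42
      rw [e3 42 (by norm_num) (by norm_num) (by norm_num), v42] at t3
      set m₄ := execs (litBlk 42) m₃ with hm₄
      have e4 : ∀ b, b ≠ 1 → b ≠ 2 → b ≠ 11 → m₄ b = m₁ b := fun b b1 b2 b3 => by
        rw [hm₄, execs_litBlk_of_ne b1 b3, e3 b b1 b2 b3]
      set m₅ := execs [.add 41 42 10, .add 41 41 10, .add 41 41 10, .add 17 16 26] m₄ with hm₅
      have e5 : ∀ b, b ≠ 41 → b ≠ 17 → m₅ b = m₄ b := fun b b1 b2 => by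
        simp [hm₅, execs, Instr.memExec, upd_of_ne, b1, b2]
      have t5 := t3.congr (m' := m₅) fun b hb => e5 b (by omega) (by omega)
      have v10 : m₅ 10 0 = 1 := by
        rw [e5 _ (by norm_num) (by norm_num), e4 _ (by norm_num) (by norm_num) (by norm_num),
          c1.one]
      have v41 : m₅ 41 0 = 2 * (4 + p + (i + 1)) + 1 := by
        simp [hm₅, execs, Instr.memExec, upd_of_ne, e4, v42, c1.one]
        omega
      have v17 : m₅ 17 0 = n - i := by
        simp [hm₅, execs, Instr.memExec, upd_of_ne, e4, v16, c1.zero]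
        omega
      refine Det.seq (((rangeLoop_det t5 v10 v41 v17).mono (by gcongr; omega) fun _ => id).imp ?_)
      rintro m₆ ⟨t6, e6⟩
      refine Det.blk ?_
      have e7 : ∀ b, b ≠ 1 → b ≠ 2 → b ≠ 3 → b ≠ 11 → b ≠ 12 → b ≠ 17 → b ≠ 18 → b ≠ 41 →
          execs closeBlk m₆ b = m₁ b := fun b b1 b2 b3 b4 b5 b6 b7 b8 => by
        rw [execs_closeBlk_of_ne b7 b3 b5, e6 b b1 b4 b6 b8, e5 b b8 b6, e4 b b1 b2 b4]
      have v10' : m₆ 10 0 = 1 := by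
        rw [e6 _ (by norm_num) (by norm_num) (by norm_num) (by norm_num), v10]
      have t7 := t6.close v10'
      refine rest _ (c1.congr fun b hb => ?_) ?_ ?_ ?_ ?_
      · exact e7 b (by omega) (by omega) (by omega) (by omega) (by omega) (by omega) (by omega)
          (by omega)
      · rw [hrange, hcl, ← List.append_assoc]
        simpa using t7
      all_goals rw [e7] <;> norm_num
    · refine (Det.cond_true (by rw [v44]; exact hbit) (Det.skip ?_)).mono
        (k := 1 + 0) (by omega) fun _ => id
      refine rest _ c1 ?_ rfl rfl rfl
      have hcl : bitClause n p a i = [] := if_neg hbit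
      rw [hrange, hcl, List.append_nil]
      exact t1

/-- Write the tables of the shifted formula. -/
def tablesProg (p : ℕ) : Prog :=
  .seq (blk [.const 10 1, .const 20 (2 * (3 + p) + 1), .const 21 (2 * (3 + p)),
      .const 22 (2 * (4 + p)), .const 24 3, .const 25 4, .add 19 0 26, .load 16 0 10,
      .const 15 2])
    (.seq copyClauses
    (.seq (blk ([.load 40 0 15] ++ (openBlk ++ (litBlk 20 ++ ([.add 18 22 19, .add 18 18 19] ++
      (litBlk 18 ++ (closeBlk ++ (openBlk ++ (litBlk 21 ++ [.add 41 22 10, .add 17 19 10])))))))))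
    (.seq rangeLoop
    (.seq (blk (closeBlk ++ [.add 16 19 10, .add 42 22 26]))
      bitLoop))))

/-- A bound on the number of unit steps of `tablesProg`. -/
def tablesSteps (p s : ℕ) : ℕ :=
  2 * (2 * (3 + p) + 1 + 2 * (3 + p) + 2 * (4 + p)) + 100 + 12 * s + 20 + (s + 1) * 6 + 10 +
    (s + 1) * (s * 6 + 30)

theorem size_le_self (n : ℕ) : n.size ≤ n := Nat.size_le.2 Nat.lt_two_pow_self

theorem sum_clauses_le {n : ℕ} (φ : CNF n) :
    (φ.map fun cl => 12 + cl.length * 7).sum ≤ 12 * (φ.length + (φ.map List.length).sum) := by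
  induction φ with
  | nil => simp
  | cons cl φ ih => simp only [List.map_cons, List.sum_cons, List.length_cons]; omega

theorem tablesProg_det {n : ℕ} (p a : ℕ) (φ : CNF n) :
    Det (tablesProg p) (frame (asBank (φ.encode ++ [a]))) (tablesSteps p φ.size) fun m =>
      Consts n p (asBank (φ.encode ++ [a])) m ∧ Tables m (shiftedFormula p a φ) := by
  set W := asBank (φ.encode ++ [a]) with hW
  have hlen : φ.encode.length = 2 + (body φ).length := by rw [encode_eq]; simp; omega
  have hWl : [n, φ.length] ++ body ([] ++ φ) ++ [a] = φ.encode ++ [a] := by simp [encode_eq]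
  have ha : W ([n, φ.length] ++ body ([] ++ φ)).length = a := by
    have := asBank_append_cons φ.encode [] a
    rw [← hW] at this
    simpa [encode_eq] using this
  -- the last block and the loop over the places of `a`
  have h3 : ∀ m, Consts n p W m → OpenTables m (φ.map (liftClause p) ++
      [[2 * (3 + p) + 1, 2 * (4 + p + n)]]) ((2 * (3 + p)) :: (List.range (n + 1)).map
        fun i => 2 * (4 + p + i) + 1) → m 40 0 = a →
      Det (.seq (blk (closeBlk ++ [.add 16 19 10, .add 42 22 26])) bitLoop) m
        (6 + ((n + 1) * ((5 + ((1 + (9 + ((n * 6 + 1) + 4))) + 2)) + 1) + 1)) fun m =>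
        Consts n p W m ∧ Tables m (shiftedFormula p a φ) := by
    intro m hc ho h40
    have t := ho.close hc.one
    refine Det.seq (Det.blk ?_)
    rw [execs_append]
    set m₁ := execs closeBlk m with hm₁
    have e1 : ∀ b, b ≠ 18 → b ≠ 3 → b ≠ 12 → m₁ b = m b :=
      fun b b1 b2 b3 => execs_closeBlk_of_ne b1 b2 b3
    set m₂ := execs [.add 16 19 10, .add 42 22 26] m₁ with hm₂
    have e2 : ∀ b, b ≠ 16 → b ≠ 42 → m₂ b = m₁ b := fun b b1 b2 => by
      simp [hm₂, execs, Instr.memExec, upd_of_ne, b1, b2]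
    have c2 := hc.congr (m' := m₂) fun b hb => by
      rw [e2 b (by omega) (by omega), e1 b (by omega) (by omega) (by omega)]
    have t2 := t.congr (m' := m₂) fun b hb => e2 b (by omega) (by omega)
    refine (bitLoop_det (a := a) c2 t2 ?_ ?_ ?_).imp fun m' ⟨r1, r2⟩ => ⟨r1, ?_⟩
    · rw [e2, e1] <;> first | exact h40 | norm_num
    · simp [hm₂, execs, Instr.memExec, upd_of_ne, e1, hc.off, hc.zero]
    · simp [hm₂, execs, Instr.memExec, upd_of_ne, e1, hc.vars, hc.one]
    · rw [List.append_assoc, List.append_assoc] at r2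
      exact r2
  have h2 : ∀ m, Consts n p W m → Tables m (φ.map (liftClause p)) →
      m 15 0 = ([n, φ.length] ++ body ([] ++ φ)).length →
      Det (.seq (blk ([.load 40 0 15] ++ (openBlk ++ (litBlk 20 ++ ([.add 18 22 19, .add 18 18 19] ++
      (litBlk 18 ++ (closeBlk ++ (openBlk ++ (litBlk 21 ++ [.add 41 22 10, .add 17 19 10])))))))))
        (.seq rangeLoop
        (.seq (blk (closeBlk ++ [.add 16 19 10, .add 42 22 26])) bitLoop))) m
        (17 + (((n + 1) * 6 + 1) +
          (6 + ((n + 1) * ((5 + ((1 + (9 + ((n * 6 + 1) + 4))) + 2)) + 1) + 1)))) fun m =>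
        Consts n p W m ∧ Tables m (shiftedFormula p a φ) := by
    intro m hc ht h15
    refine Det.seq (Det.blk ?_)
    rw [execs_append, execs_append, execs_append, execs_append, execs_append, execs_append,
      execs_append, execs_append]
    set m₁ := execs [.load 40 0 15] m with hm₁
    have e1 : ∀ b, b ≠ 40 → m₁ b = m b := fun b b1 => by
      simp [hm₁, execs, Instr.memExec, upd_of_ne, b1]
    have v40 : m₁ 40 0 = a := by
      simp only [hm₁, execs, Instr.memExec, upd_self, Function.update_self, h15, hc.input, ha]
    have t1 := ht.congr (m' := m₁) fun b hb => e1 b (by omega)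
    set m₂ := execs openBlk m₁ with hm₂
    have e2 : ∀ b, b ≠ 2 → m₂ b = m₁ b := fun b hb => execs_openBlk_of_ne hb
    have c2 := hc.congr (m' := m₂) fun b hb => by rw [e2 b (by omega), e1 b (by omega)]
    have t2 : OpenTables m₂ _ [] := t1.open
    have t3 := t2.lit c2.one 20
    rw [c2.pos] at t3
    set m₃ := execs (litBlk 20) m₂ with hm₃
    have e3 : ∀ b, b ≠ 1 → b ≠ 11 → m₃ b = m₂ b := fun b b1 b2 => execs_litBlk_of_ne b1 b2
    set m₄ := execs [.add 18 22 19, .add 18 18 19] m₃ with hm₄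
    have e4 : ∀ b, b ≠ 18 → m₄ b = m₃ b := fun b b1 => by
      simp [hm₄, execs, Instr.memExec, upd_of_ne, b1]
    have c4 := c2.congr (m' := m₄) fun b hb => by
      rw [e4 b (by omega), e3 b (by omega) (by omega)]
    have t4 := t3.congr (m' := m₄) fun b hb => e4 b (by omega)
    have v18 : m₄ 18 0 = 2 * (4 + p + n) := by
      simp [hm₄, execs, Instr.memExec, upd_of_ne, e3, c2.off, c2.vars]
      omega
    have t5 := t4.lit c4.one 18
    rw [v18] at t5
    set m₅ := execs (litBlk 18) m₄ with hm₅
    have e5 : ∀ b, b ≠ 1 → b ≠ 11 → m₅ b = m₄ b := fun b b1 b2 => execs_litBlk_of_ne b1 b2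
    have t6 := t5.close (by rw [e5 _ (by norm_num) (by norm_num), c4.one])
    set m₆ := execs closeBlk m₅ with hm₆
    have e6 : ∀ b, b ≠ 18 → b ≠ 3 → b ≠ 12 → m₆ b = m₅ b :=
      fun b b1 b2 b3 => execs_closeBlk_of_ne b1 b2 b3
    set m₇ := execs openBlk m₆ with hm₇
    have e7 : ∀ b, b ≠ 2 → m₇ b = m₆ b := fun b hb => execs_openBlk_of_ne hb
    have c7 := c4.congr (m' := m₇) fun b hb => by
      rw [e7 b (by omega), e6 b (by omega) (by omega) (by omega), e5 b (by omega) (by omega)]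
    have t7 : OpenTables m₇ _ [] := t6.open
    have t8 := t7.lit c7.one 21
    rw [c7.neg] at t8
    set m₈ := execs (litBlk 21) m₇ with hm₈
    have e8 : ∀ b, b ≠ 1 → b ≠ 11 → m₈ b = m₇ b := fun b b1 b2 => execs_litBlk_of_ne b1 b2
    set m₉ := execs [.add 41 22 10, .add 17 19 10] m₈ with hm₉
    have e9 : ∀ b, b ≠ 41 → b ≠ 17 → m₉ b = m₈ b := fun b b1 b2 => by
      simp [hm₉, execs, Instr.memExec, upd_of_ne, b1, b2]
    have c9 := c7.congr (m' := m₉) fun b hb => by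
      rw [e9 b (by omega) (by omega), e8 b (by omega) (by omega)]
    have t9 := t8.congr (m' := m₉) fun b hb => e9 b (by omega) (by omega)
    refine Det.seq ((rangeLoop_det (w := 4 + p) t9 c9.one ?_ ?_).imp ?_)
    · simp [hm₉, execs, Instr.memExec, upd_of_ne, e8, c7.off, c7.one]
    · simp [hm₉, execs, Instr.memExec, upd_of_ne, e8, c7.vars, c7.one]
    · rintro m' ⟨r1, r2⟩
      refine h3 m' (c9.congr fun b hb => r2 b (by omega) (by omega) (by omega) (by omega)) ?_ ?_
      · simpa using r1
      · rw [r2, e9, e8, e7, e6, e5, e4, e3, e2, v40] <;> norm_num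
  have h1 := copyClauses_det (p := p) (l₁ := [n, φ.length]) (l₂ := [a]) φ []
    (execs [.const 10 1, .const 20 (2 * (3 + p) + 1), .const 21 (2 * (3 + p)),
      .const 22 (2 * (4 + p)), .const 24 3, .const 25 4, .add 19 0 26, .load 16 0 10,
      .const 15 2] (frame W)) ?_ ?_ ?_ ?_
  · refine (Det.seq (Det.blk (Det.seq (h1.imp fun m' ⟨r1, r2, r3⟩ => h2 m' ?_ ?_ r3)))).mono ?_
      fun _ => id
    · rw [hWl] at r1
      exact r1
    · simpa using r2
    · have s1 := size_le_self (2 * (3 + p) + 1)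
      have s2 := size_le_self (2 * (3 + p))
      have s3 := size_le_self (2 * (4 + p))
      have s4 := sum_clauses_le φ
      have s5 : φ.length + (φ.map List.length).sum ≤ φ.size := by unfold CNF.size; omega
      have s6 : n ≤ φ.size := by unfold CNF.size; omega
      have s7 : (n + 1) * ((5 + ((1 + (9 + ((n * 6 + 1) + 4))) + 2)) + 1) ≤
          (φ.size + 1) * (φ.size * 6 + 30) := Nat.mul_le_mul (by omega) (by omega)
      have k1 : Nat.size 1 ≤ 1 := size_le_self 1
      have k2 : Nat.size 2 ≤ 2 := size_le_self 2
      have k3 : Nat.size 3 ≤ 3 := size_le_self 3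
      have k4 : Nat.size 4 ≤ 4 := size_le_self 4
      simp only [blkSteps, Instr.steps, tablesSteps]
      omega
  · rw [hWl, ← hW]
    constructor <;> simp [execs, Instr.memExec, upd_of_ne, frame, hW, encode_eq, asBank]
  · simp [Tables, execs, Instr.memExec, upd_of_ne, frame, starts]
    simp [funext_iff, asBank]
  · simp [execs, Instr.memExec, upd_of_ne, body]
  · simp [execs, Instr.memExec, upd_of_ne, frame, hW, encode_eq, asBank]

/-! ### Code that writes the circuit -/

/-- A gate on numbered wires as a list of four numbers. -/
def gateCode : Gate ℕ → List ℕ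
  | .X i => [0, i, 0, 0]
  | .H i => [1, i, 0, 0]
  | .T i => [2, i, 0, 0]
  | .CNOT c t => [3, c, t, 0]
  | .TOFFOLI a b t => [4, a, b, t]

/-- Append a gate, given by four registers, to the circuit in bank `4`. Register `13` points behind
the last gate, and register `14` counts the gates. -/
def emitBlk (a b c d : ℕ) : List Instr :=
  [.store 4 13 a, .add 13 13 10, .store 4 13 b, .add 13 13 10, .store 4 13 c, .add 13 13 10,
    .store 4 13 d, .add 13 13 10, .add 14 14 10]

/-- Bank `4` holds the numbers `pre` and then the gates `gs`. -/
def Emitted (pre : List ℕ) (m : Mem) (gs : List (Gate ℕ)) : Prop :=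
  m 4 = asBank (pre ++ gs.flatMap gateCode) ∧ m 13 0 = (pre ++ gs.flatMap gateCode).length ∧
    m 14 0 = gs.length

theorem execs_emitBlk_of_ne {m : Mem} {a b c d r : ℕ} (h : r ≠ 4) (h' : r ≠ 13) (h'' : r ≠ 14) :
    execs (emitBlk a b c d) m r = m r := by
  simp [emitBlk, execs, Instr.memExec, upd_of_ne, h, h', h'']

theorem Emitted.congr {pre : List ℕ} {m m' : Mem} {gs : List (Gate ℕ)} (h : Emitted pre m gs)
    (e : ∀ b, b = 4 ∨ b = 13 ∨ b = 14 → m' b = m b) : Emitted pre m' gs := by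
  unfold Emitted at *
  rwa [e 4 (by simp), e 13 (by simp), e 14 (by simp)]

theorem Emitted.emit {pre : List ℕ} {m : Mem} {gs : List (Gate ℕ)} (h : Emitted pre m gs)
    (h10 : m 10 0 = 1) {a b c d : ℕ} {g : Gate ℕ}
    (hg : gateCode g = [m a 0, m b 0, m c 0, m d 0])
    (hne : ∀ r, r = a ∨ r = b ∨ r = c ∨ r = d → r ≠ 4 ∧ r ≠ 13 ∧ r ≠ 14) :
    Emitted pre (execs (emitBlk a b c d) m) (gs ++ [g]) := by
  obtain ⟨h1, h2, h3⟩ := h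
  have hb := hne b (by simp)
  have hc := hne c (by simp)
  have hd := hne d (by simp)
  have happ : pre ++ (gs ++ [g]).flatMap gateCode =
      ((((pre ++ gs.flatMap gateCode) ++ [m a 0]) ++ [m b 0]) ++ [m c 0]) ++ [m d 0] := by
    simp [hg]
  set l := pre ++ gs.flatMap gateCode with hl
  refine ⟨?_, ?_, ?_⟩
  · rw [happ]
    simp only [← update_asBank]
    simp [emitBlk, execs, Instr.memExec, upd_of_ne, h1, h2, h10, hb, hc, hd]
  · rw [happ]
    simp [emitBlk, execs, Instr.memExec, upd_of_ne, h2, h10]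
  · simp [emitBlk, execs, Instr.memExec, upd_of_ne, h3, h10]

/-- A pending task of the code that writes the circuit: the gates of a conjunction of literals
(`kind = 0`) or of clauses (`kind = 1`). -/
structure Task : Type where
  kind : ℕ
  i : ℕ
  j : ℕ
  lo : ℕ
  len : ℕ

/-- The tasks on the stack, the top of the stack last. -/
def Stack (m : Mem) (S : List Task) : Prop :=
  m 30 0 = S.length ∧ ∀ t T, S[t]? = some T →
    m 5 t = T.kind ∧ m 6 t = T.i ∧ m 7 t = T.j ∧ m 8 t = T.lo ∧ m 9 t = T.len

/-- Push a task given by five registers. -/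
def pushBlk (a b c d e : ℕ) : List Instr :=
  [.store 5 30 a, .store 6 30 b, .store 7 30 c, .store 8 30 d, .store 9 30 e, .add 30 30 10]

/-- Pop a task into the registers `31` to `35`. -/
def popBlk : List Instr :=
  [.sub 30 30 10, .load 31 5 30, .load 32 6 30, .load 33 7 30, .load 34 8 30, .load 35 9 30]

theorem execs_pushBlk_of_ne {m : Mem} {a b c d e r : ℕ} (h : ¬ (5 ≤ r ∧ r ≤ 9)) (h' : r ≠ 30) :
    execs (pushBlk a b c d e) m r = m r := by
  have : r ≠ 5 ∧ r ≠ 6 ∧ r ≠ 7 ∧ r ≠ 8 ∧ r ≠ 9 := by omega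
  simp [pushBlk, execs, Instr.memExec, upd_of_ne, this, h']

theorem execs_popBlk_of_ne {m : Mem} {r : ℕ} (h : ¬ (30 ≤ r ∧ r ≤ 35)) :
    execs popBlk m r = m r := by
  have : r ≠ 30 ∧ r ≠ 31 ∧ r ≠ 32 ∧ r ≠ 33 ∧ r ≠ 34 ∧ r ≠ 35 := by omega
  simp [popBlk, execs, Instr.memExec, upd_of_ne, this]

theorem Stack.congr {m m' : Mem} {S : List Task} (h : Stack m S)
    (e : ∀ b, (5 ≤ b ∧ b ≤ 9) ∨ b = 30 → m' b = m b) : Stack m' S := by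
  unfold Stack at *
  rwa [e 5 (by simp), e 6 (by simp), e 7 (by simp), e 8 (by simp), e 9 (by simp), e 30 (by simp)]

theorem Stack.push {m : Mem} {S : List Task} (h : Stack m S) (h10 : m 10 0 = 1) {a b c d e : ℕ}
    (hne : ∀ r, r = a ∨ r = b ∨ r = c ∨ r = d ∨ r = e → 9 < r) :
    Stack (execs (pushBlk a b c d e) m) (S ++ [⟨m a 0, m b 0, m c 0, m d 0, m e 0⟩]) := by
  obtain ⟨h1, h2⟩ := h
  have hb := hne b (by simp)
  have hc := hne c (by simp)
  have hd := hne d (by simp)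
  have he := hne e (by simp)
  have hb' : b ≠ 5 := by omega
  have hc' : c ≠ 5 ∧ c ≠ 6 := by omega
  have hd' : d ≠ 5 ∧ d ≠ 6 ∧ d ≠ 7 := by omega
  have he' : e ≠ 5 ∧ e ≠ 6 ∧ e ≠ 7 ∧ e ≠ 8 := by omega
  constructor
  · simp [pushBlk, execs, Instr.memExec, upd_of_ne, h1, h10]
  · intro t T hT
    rcases lt_trichotomy t S.length with ht | ht | ht
    · rw [List.getElem?_append_left ht] at hT
      have := h2 t T hT
      simpa [pushBlk, execs, Instr.memExec, upd_of_ne, h1, ht.ne] using this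
    · subst ht
      simp only [List.getElem?_concat_length, Option.some.injEq] at hT
      subst hT
      simp [pushBlk, execs, Instr.memExec, upd_of_ne, h1, hb', hc', hd', he']
    · rw [List.getElem?_eq_none (by simp; omega)] at hT
      simp at hT

theorem Stack.pop {m : Mem} {S : List Task} {T : Task} (h : Stack m (S ++ [T]))
    (h10 : m 10 0 = 1) :
    Stack (execs popBlk m) S ∧ execs popBlk m 31 0 = T.kind ∧ execs popBlk m 32 0 = T.i ∧
      execs popBlk m 33 0 = T.j ∧ execs popBlk m 34 0 = T.lo ∧ execs popBlk m 35 0 = T.len := by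
  obtain ⟨h1, h2⟩ := h
  rw [List.length_append, List.length_singleton] at h1
  have hT := h2 S.length T (by simp)
  refine ⟨⟨?_, fun t T' hT' => ?_⟩, ?_⟩
  · simp [popBlk, execs, Instr.memExec, upd_of_ne, h1, h10]
  · have ht : t < S.length := (List.getElem?_eq_some_iff.1 hT').1
    have := h2 t T' (by rw [List.getElem?_append_left ht, hT'])
    simpa [popBlk, execs, Instr.memExec, upd_of_ne] using this
  · simpa [popBlk, execs, Instr.memExec, upd_of_ne, h1, h10] using hT

/-- The memory that stays fixed while the circuit is written: the input, the tables, and some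
constants. -/
structure Fixed (W lit cst cln : ℕ → ℕ) (n : ℕ) (m : Mem) : Prop where
  input : m 0 = W
  lit : m 1 = lit
  cst : m 2 = cst
  cln : m 3 = cln
  one : m 10 0 = 1
  vars : m 19 0 = n
  three : m 24 0 = 3
  four : m 25 0 = 4
  zero : m 26 0 = 0

theorem Fixed.congr {W lit cst cln : ℕ → ℕ} {n : ℕ} {m m' : Mem} (h : Fixed W lit cst cln n m)
    (e : ∀ b, b ≤ 3 ∨ b = 10 ∨ (19 ≤ b ∧ b ≤ 26) → m' b = m b) : Fixed W lit cst cln n m' := by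
  obtain ⟨h1, h2, h3, h4, h5, h6, h7, h8, h9⟩ := h
  refine ⟨?_, ?_, ?_, ?_, ?_, ?_, ?_, ?_, ?_⟩ <;> rw [e _ (by norm_num)] <;> assumption

/-- The gates that a task asks for. -/
def Task.gates (lit cst cln : ℕ → ℕ) (T : Task) : List (Gate ℕ) :=
  if T.kind = 0 then andOps (litOps lit) T.i T.j T.lo T.len
  else andOps (clauseOps lit cst cln) T.i T.j T.lo T.len

/-- The conjunctions are not empty, and the clauses have at most `L` literals. -/
def Task.Valid (cln : ℕ → ℕ) (L : ℕ) (T : Task) : Prop :=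
  1 ≤ T.len ∧ (T.kind ≠ 0 → ∀ t < T.len, 1 ≤ cln (T.lo + t) ∧ cln (T.lo + t) ≤ L)

/-- A bound on the number of rounds spent on a task. -/
def Task.rounds (L : ℕ) (T : Task) : ℕ :=
  (2 * T.len ^ 2 - 1) * if T.kind = 0 then 1 else 2 * L ^ 2

/-- The recursion behind the quadratic size of a conjunction; it needs that the two halves differ
by at most one. -/
theorem two_sq_halves {len : ℕ} (h : len / 2 ≠ 0) :
    1 + 2 * (2 * (len / 2) ^ 2 - 1) + 2 * (2 * (len - len / 2) ^ 2 - 1) ≤ 2 * len ^ 2 - 1 := by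
  obtain ⟨a, ha⟩ : ∃ a, a = len / 2 := ⟨_, rfl⟩
  obtain ⟨b, hb⟩ : ∃ b, b = len - len / 2 := ⟨_, rfl⟩
  rw [← hb, ← ha]
  have h1 : len = a + b := by omega
  have h2 : b = a ∨ b = a + 1 := by omega
  have h3 : 1 ≤ a := by omega
  have h4 : 1 ≤ a ^ 2 := Nat.one_le_pow _ _ h3
  subst h1
  rcases h2 with h2 | h2 <;> rw [h2] <;> ring_nf <;> omega

/-- Write the gates of the tasks on the stack. A task with several items is replaced by four tasks
for its halves, one with a single clause by the task for its literals. The task is in the registers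
`31` to `35`; register `36` gets the third work qubit, and `37` half the number of items. -/
def gatesLoop : Prog :=
  .loop 30 (.seq (blk (popBlk ++ [.half 37 35])) (.cond 37
    (blk ([.sub 36 24 32, .sub 36 36 33, .add 38 34 37, .sub 39 35 37] ++
      (pushBlk 31 36 33 38 39 ++ (pushBlk 31 32 36 34 37 ++
      (pushBlk 31 36 33 38 39 ++ pushBlk 31 32 36 34 37)))))
    (.cond 31
      (blk (emitBlk 24 32 33 26 ++ ([.load 38 2 34, .load 39 3 34] ++ pushBlk 26 32 33 38 39)))
      (.seq (blk [.load 38 1 34, .half 37 38, .add 39 37 37, .sub 39 38 39])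
        (.seq (.cond 39 (blk (emitBlk 24 32 33 26)) .skip) (blk (emitBlk 25 32 37 33)))))))

set_option maxHeartbeats 400000 in
/-- The gates written so far, followed by those that the tasks on the stack ask for, are always the
same. A round takes at most `40` unit steps and decreases the sum of `Task.rounds` over the stack.
-/
theorem gatesLoop_det {W lit cst cln : ℕ → ℕ} {n L : ℕ} {pre : List ℕ} {total : List (Gate ℕ)}
    {m : Mem} {S : List Task} {gs : List (Gate ℕ)} (hf : Fixed W lit cst cln n m)
    (hg : Emitted pre m gs) (hs : Stack m S) (hv : ∀ T ∈ S, T.Valid cln L)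
    (ht : gs ++ S.reverse.flatMap (Task.gates lit cst cln) = total) :
    Det gatesLoop m (1 + 40 * (S.map (Task.rounds L)).sum) fun m' =>
      Fixed W lit cst cln n m' ∧ Emitted pre m' total := by
  refine Det.loop (fun c m => ∃ S gs, Fixed W lit cst cln n m ∧ Emitted pre m gs ∧ Stack m S ∧
    (∀ T ∈ S, T.Valid cln L) ∧ gs ++ S.reverse.flatMap (Task.gates lit cst cln) = total ∧
    1 + 40 * (S.map (Task.rounds L)).sum ≤ c) ?_ ⟨S, gs, hf, hg, hs, hv, ht, le_rfl⟩
  clear hf hg hs hv ht S gs m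
  rintro c m ⟨S, gs, hf, hg, hs, hv, ht, hc⟩
  rcases List.eq_nil_or_concat S with rfl | ⟨S, T, rfl⟩
  · refine Or.inl ⟨hs.1, ⟨hf, ?_⟩, by omega⟩
    have : gs = total := by simpa using ht
    rwa [← this]
  rw [List.concat_eq_append] at *
  -- There is a task `T` on top of the stack. It counts for one round at least.
  refine Or.inr ⟨by rw [hs.1]; simp, 39, c - 40, ?_, ?_⟩
  · have hvT := hv T (by simp)
    have h1 : 1 ≤ T.len ^ 2 := Nat.one_le_pow _ _ hvT.1
    have : 1 ≤ T.rounds L := by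
      unfold Task.rounds
      refine Nat.mul_pos (by omega) ?_
      split_ifs with hk
      · omega
      · have := hvT.2 hk 0 hvT.1
        have : 1 ≤ L ^ 2 := Nat.one_le_pow _ _ (by omega)
        omega
    rw [List.map_append, List.sum_append] at hc
    simp only [List.map_cons, List.map_nil, List.sum_cons, List.sum_nil] at hc
    omega
  have hv' : ∀ T ∈ S, T.Valid cln L := fun T' hT' => hv T' (by simp [hT'])
  have hvT := hv T (by simp)
  rw [List.reverse_append, List.flatMap_append] at ht
  simp only [List.reverse_singleton, List.flatMap_cons, List.flatMap_nil, List.append_nil] at ht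
  rw [List.map_append, List.sum_append] at hc
  simp only [List.map_cons, List.map_nil, List.sum_cons, List.sum_nil, Nat.add_zero] at hc
  refine (Det.seq (k := 7) (k' := 30) (Det.blk ?_)).mono (by norm_num) fun _ => id
  rw [execs_append]
  obtain ⟨s1, a1, a2, a3, a4, a5⟩ := hs.pop hf.one
  set m₁ := execs popBlk m with hm₁
  have e1 : ∀ b, ¬ (30 ≤ b ∧ b ≤ 35) → m₁ b = m b := fun b hb => execs_popBlk_of_ne hb
  set m₂ := execs [.half 37 35] m₁ with hm₂
  have e2 : ∀ b, b ≠ 37 → m₂ b = m₁ b := fun b hb => by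
    simp [hm₂, execs, Instr.memExec, upd_of_ne, hb]
  have v37 : m₂ 37 0 = T.len / 2 := by simp [hm₂, execs, Instr.memExec, a5]
  have s2 := s1.congr (m' := m₂) fun b hb => e2 b (by omega)
  have f2 := hf.congr (m' := m₂) fun b hb => by rw [e2 b (by omega), e1 b (by omega)]
  have g2 := hg.congr (m' := m₂) fun b hb => by rw [e2 b (by omega), e1 b (by omega)]
  rw [← e2 _ (by norm_num)] at a1 a2 a3 a4 a5
  clear_value m₂
  clear hm₂ e2 s1 e1 hm₁ m₁ hs hf hg m
  by_cases hhalf : T.len / 2 = 0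
  · by_cases hk : T.kind = 0
    · -- a literal
      refine Det.mono (k := 1 + (1 + (4 + 19))) ?_ (by norm_num) fun _ => id
      refine Det.cond_false (by rw [v37, hhalf]) ?_
      refine Det.cond_false (by rw [a1, hk]) ?_
      refine Det.seq (k := 4) (Det.blk ?_)
      have hgates : T.gates lit cst cln = litOps lit T.i T.j T.lo := by
        rw [Task.gates, if_pos hk, andOps_of_leaf _ _ _ _ hhalf]
      set m₃ := execs [.load 38 1 34, .half 37 38, .add 39 37 37, .sub 39 38 39] m₂ with hm₃
      have e3 : ∀ b, b ≠ 37 → b ≠ 38 → b ≠ 39 → m₃ b = m₂ b := fun b b1 b2 b3 => by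
        simp [hm₃, execs, Instr.memExec, upd_of_ne, b1, b2, b3]
      have w37 : m₃ 37 0 = lit T.lo / 2 := by
        simp [hm₃, execs, Instr.memExec, upd_of_ne, a4, f2.lit]
      have w39 : m₃ 39 0 = lit T.lo % 2 := by
        simp [hm₃, execs, Instr.memExec, upd_of_ne, a4, f2.lit]
        omega
      have w32 : m₃ 32 0 = T.i := by rw [e3, a2] <;> norm_num
      have w33 : m₃ 33 0 = T.j := by rw [e3, a3] <;> norm_num
      have s3 := s2.congr (m' := m₃) fun b hb => e3 b (by omega) (by omega) (by omega)
      have f3 := f2.congr (m' := m₃) fun b hb => e3 b (by omega) (by omega) (by omega)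
      have g3 := g2.congr (m' := m₃) fun b hb => e3 b (by omega) (by omega) (by omega)
      -- the last of the gates, after the one that depends on the sign of the literal
      have fin : ∀ m₄, Stack m₄ S → Fixed W lit cst cln n m₄ →
          Emitted pre m₄ (gs ++ if lit T.lo % 2 = 1 then [.CNOT T.i T.j] else []) →
          m₄ 32 0 = T.i → m₄ 33 0 = T.j → m₄ 37 0 = lit T.lo / 2 →
          Det (blk (emitBlk 25 32 37 33)) m₄ 9 fun m => ∃ S gs, Fixed W lit cst cln n m ∧
            Emitted pre m gs ∧ Stack m S ∧ (∀ T ∈ S, T.Valid cln L) ∧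
            gs ++ S.reverse.flatMap (Task.gates lit cst cln) = total ∧
            1 + 40 * (S.map (Task.rounds L)).sum ≤ c - 40 := by
        intro m₄ s4 f4 g4 x32 x33 x37
        refine Det.blk ⟨S, _, f4.congr fun b hb => ?_, g4.emit f4.one
          (g := .TOFFOLI T.i (lit T.lo / 2) T.j) ?_ ?_, s4.congr fun b hb => ?_, hv', ?_, ?_⟩
        · exact execs_emitBlk_of_ne (by omega) (by omega) (by omega)
        · rw [x32, x33, x37, f4.four]; rfl
        · intro r hr; omega
        · exact execs_emitBlk_of_ne (by omega) (by omega) (by omega)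
        · rw [← ht, hgates, litOps]
          simp
        · have h1 : 1 ≤ T.len ^ 2 := Nat.one_le_pow _ _ hvT.1
          have : T.rounds L = 2 * T.len ^ 2 - 1 := by rw [Task.rounds, if_pos hk, mul_one]
          omega
      clear_value m₃
      by_cases hb : lit T.lo % 2 = 1
      · refine Det.seq (k := 10) (k' := 9) (Det.cond_true (k := 9) (by rw [w39, hb]; norm_num)
          (Det.blk ?_))
        have e4 : ∀ b, b ≠ 4 → b ≠ 13 → b ≠ 14 → execs (emitBlk 24 32 33 26) m₃ b = m₃ b :=
          fun b b1 b2 b3 => execs_emitBlk_of_ne b1 b2 b3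
        refine fin _ (s3.congr fun b hb => e4 b (by omega) (by omega) (by omega))
          (f3.congr fun b hb => e4 b (by omega) (by omega) (by omega)) ?_ ?_ ?_ ?_
        · rw [if_pos hb]
          refine g3.emit f3.one ?_ ?_
          · rw [w32, w33, f3.three, f3.zero]; rfl
          · intro r hr; omega
        · rw [e4, w32] <;> norm_num
        · rw [e4, w33] <;> norm_num
        · rw [e4, w37] <;> norm_num
      · refine (Det.seq (k := 1) (k' := 9) (Det.cond_false (k := 0) (by rw [w39]; omega)
          (Det.skip ?_))).mono (by norm_num) fun _ => id
        refine fin _ s3 f3 ?_ w32 w33 w37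
        rwa [if_neg hb, List.append_nil]
    · -- a clause
      refine Det.mono (k := 1 + (1 + 17)) ?_ (by norm_num) fun _ => id
      refine Det.cond_false (by rw [v37, hhalf]) ?_
      refine Det.cond_true (by rw [a1]; exact hk) ?_
      refine Det.blk ?_
      have hgates : T.gates lit cst cln = clauseOps lit cst cln T.i T.j T.lo := by
        rw [Task.gates, if_neg hk, andOps_of_leaf _ _ _ _ hhalf]
      rw [execs_append, execs_append]
      have g3 := g2.emit f2.one (a := 24) (b := 32) (c := 33) (d := 26) (g := .CNOT T.i T.j)
        (by rw [a2, a3, f2.three, f2.zero]; rfl) (by intro r hr; omega)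
      set m₃ := execs (emitBlk 24 32 33 26) m₂ with hm₃
      have e3 : ∀ b, b ≠ 4 → b ≠ 13 → b ≠ 14 → m₃ b = m₂ b := fun b b1 b2 b3 =>
        execs_emitBlk_of_ne b1 b2 b3
      set m₄ := execs [.load 38 2 34, .load 39 3 34] m₃ with hm₄
      have e4 : ∀ b, b ≠ 38 → b ≠ 39 → m₄ b = m₃ b := fun b b1 b2 => by
        simp [hm₄, execs, Instr.memExec, upd_of_ne, b1, b2]
      have w38 : m₄ 38 0 = cst T.lo := by
        simp [hm₄, execs, Instr.memExec, upd_of_ne, e3, a4, f2.cst]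
      have w39 : m₄ 39 0 = cln T.lo := by
        simp [hm₄, execs, Instr.memExec, upd_of_ne, e3, a4, f2.cln]
      have s4 := s2.congr (m' := m₄) fun b hb => by
        rw [e4 b (by omega) (by omega), e3 b (by omega) (by omega) (by omega)]
      have f4 := f2.congr (m' := m₄) fun b hb => by
        rw [e4 b (by omega) (by omega), e3 b (by omega) (by omega) (by omega)]
      have g4 := g3.congr (m' := m₄) fun b hb => e4 b (by omega) (by omega)
      have s5 := s4.push f4.one (a := 26) (b := 32) (c := 33) (d := 38) (e := 39)
        (by intro r hr; omega)
      rw [w38, w39, f4.zero, e4 32 (by norm_num) (by norm_num), e4 33 (by norm_num) (by norm_num),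
        e3 32 (by norm_num) (by norm_num) (by norm_num),
        e3 33 (by norm_num) (by norm_num) (by norm_num), a2, a3] at s5
      have hcl := hvT.2 hk 0 hvT.1
      rw [Nat.add_zero] at hcl
      refine ⟨_, _, f4.congr fun b hb => ?_, g4.congr fun b hb => ?_, s5, ?_, ?_, ?_⟩
      · exact execs_pushBlk_of_ne (by omega) (by omega)
      · exact execs_pushBlk_of_ne (by omega) (by omega)
      · intro T' hT'
        rw [List.mem_append, List.mem_singleton] at hT'
        rcases hT' with hT' | rfl
        · exact hv' _ hT'
        · exact ⟨hcl.1, fun h => absurd rfl h⟩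
      · rw [← ht, hgates, clauseOps]
        simp [Task.gates]
      · have h1 : cln T.lo ^ 2 ≤ L ^ 2 := Nat.pow_le_pow_left hcl.2 2
        have h2 : 1 ≤ cln T.lo ^ 2 := Nat.one_le_pow _ _ hcl.1
        have h3 : 1 * (2 * L ^ 2) ≤ T.rounds L := by
          rw [Task.rounds, if_neg hk]
          refine Nat.mul_le_mul_right _ ?_
          have h1 : 1 ≤ T.len ^ 2 := Nat.one_le_pow _ _ hvT.1
          omega
        simp only [List.map_append, List.sum_append, List.map_cons, List.map_nil, List.sum_cons,
          List.sum_nil, Task.rounds, if_true]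
        omega
  · -- a conjunction of several items
    refine Det.mono (k := 1 + 28) ?_ (by norm_num) fun _ => id
    refine Det.cond_true (by rw [v37]; exact hhalf) ?_
    refine Det.blk ?_
    rw [execs_append, execs_append, execs_append, execs_append]
    set m₃ := execs [.sub 36 24 32, .sub 36 36 33, .add 38 34 37, .sub 39 35 37] m₂ with hm₃
    have e3 : ∀ b, b ≠ 36 → b ≠ 38 → b ≠ 39 → m₃ b = m₂ b := fun b b1 b2 b3 => by
      simp [hm₃, execs, Instr.memExec, upd_of_ne, b1, b2, b3]
    have w36 : m₃ 36 0 = 3 - T.i - T.j := by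
      simp [hm₃, execs, Instr.memExec, upd_of_ne, f2.three, a2, a3]
    have w38 : m₃ 38 0 = T.lo + T.len / 2 := by
      simp [hm₃, execs, Instr.memExec, upd_of_ne, a4, v37]
    have w39 : m₃ 39 0 = T.len - T.len / 2 := by
      simp [hm₃, execs, Instr.memExec, upd_of_ne, a5, v37]
    rw [← e3 _ (by norm_num) (by norm_num) (by norm_num)] at a1 a2 a3 a4 v37
    have s3 := s2.congr (m' := m₃) fun b hb => e3 b (by omega) (by omega) (by omega)
    have f3 := f2.congr (m' := m₃) fun b hb => e3 b (by omega) (by omega) (by omega)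
    have g3 := g2.congr (m' := m₃) fun b hb => e3 b (by omega) (by omega) (by omega)
    clear_value m₃
    clear hm₃ e3 g2 f2 s2 a5 m₂
    set k := 3 - T.i - T.j with hkdef
    -- the two halves, which are pushed in reverse order
    set A : Task := ⟨T.kind, T.i, k, T.lo, T.len / 2⟩ with hA
    set B : Task := ⟨T.kind, k, T.j, T.lo + T.len / 2, T.len - T.len / 2⟩ with hB
    have pushB : ∀ m S, Stack m S → (∀ b, ¬ (5 ≤ b ∧ b ≤ 9) → b ≠ 30 → m b = m₃ b) →
        Stack (execs (pushBlk 31 36 33 38 39) m) (S ++ [B]) ∧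
        ∀ b, ¬ (5 ≤ b ∧ b ≤ 9) → b ≠ 30 → execs (pushBlk 31 36 33 38 39) m b = m₃ b := by
      intro m S hS hm
      have h10 : m 10 0 = 1 := by rw [hm _ (by norm_num) (by norm_num), f3.one]
      have := hS.push h10 (a := 31) (b := 36) (c := 33) (d := 38) (e := 39)
        (by intro r hr; omega)
      rw [hm 31 (by norm_num) (by norm_num), hm 36 (by norm_num) (by norm_num),
        hm 33 (by norm_num) (by norm_num), hm 38 (by norm_num) (by norm_num),
        hm 39 (by norm_num) (by norm_num), a1, w36, a3, w38, w39] at this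
      exact ⟨this, fun b b1 b2 => by rw [execs_pushBlk_of_ne b1 b2, hm b b1 b2]⟩
    have pushA : ∀ m S, Stack m S → (∀ b, ¬ (5 ≤ b ∧ b ≤ 9) → b ≠ 30 → m b = m₃ b) →
        Stack (execs (pushBlk 31 32 36 34 37) m) (S ++ [A]) ∧
        ∀ b, ¬ (5 ≤ b ∧ b ≤ 9) → b ≠ 30 → execs (pushBlk 31 32 36 34 37) m b = m₃ b := by
      intro m S hS hm
      have h10 : m 10 0 = 1 := by rw [hm _ (by norm_num) (by norm_num), f3.one]
      have := hS.push h10 (a := 31) (b := 32) (c := 36) (d := 34) (e := 37)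
        (by intro r hr; omega)
      rw [hm 31 (by norm_num) (by norm_num), hm 36 (by norm_num) (by norm_num),
        hm 32 (by norm_num) (by norm_num), hm 34 (by norm_num) (by norm_num),
        hm 37 (by norm_num) (by norm_num), a1, w36, a2, a4, v37] at this
      exact ⟨this, fun b b1 b2 => by rw [execs_pushBlk_of_ne b1 b2, hm b b1 b2]⟩
    obtain ⟨p1, q1⟩ := pushB m₃ S s3 fun _ _ _ => rfl
    obtain ⟨p2, q2⟩ := pushA _ _ p1 q1
    obtain ⟨p3, q3⟩ := pushB _ _ p2 q2
    obtain ⟨p4, q4⟩ := pushA _ _ p3 q3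
    have hVA : A.Valid cln L := ⟨by simp only [hA]; omega, fun hk t ht => hvT.2 hk t (by
      simp only [hA] at ht; omega)⟩
    have hVB : B.Valid cln L := ⟨by simp only [hB]; omega, fun hk t ht => by
      simp only [hB] at ht ⊢
      rw [Nat.add_assoc]
      exact hvT.2 hk _ (by omega)⟩
    have hgates : T.gates lit cst cln = A.gates lit cst cln ++ (B.gates lit cst cln ++
        (A.gates lit cst cln ++ B.gates lit cst cln)) := by
      unfold Task.gates
      by_cases hk : T.kind = 0
      · rw [if_pos hk, if_pos hk, if_pos hk, andOps_of_half _ _ _ _ hhalf]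
      · rw [if_neg hk, if_neg hk, if_neg hk, andOps_of_half _ _ _ _ hhalf]
    refine ⟨_, gs, f3.congr fun b hb => q4 b (by omega) (by omega),
      g3.congr fun b hb => q4 b (by omega) (by omega), p4, ?_, ?_, ?_⟩
    · intro T' hT'
      simp only [List.mem_append, List.mem_singleton] at hT'
      rcases hT' with (((hT' | rfl) | rfl) | rfl) | rfl
      exacts [hv' _ hT', hVB, hVA, hVB, hVA]
    · rw [← ht, hgates]
      simp
    · have hr : 1 + 2 * A.rounds L + 2 * B.rounds L ≤ T.rounds L := by
        have h1 := two_sq_halves hhalf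
        unfold Task.rounds
        simp only [hA, hB]
        by_cases hk : T.kind = 0
        · simp only [hk, if_true, mul_one]
          exact h1
        · have hL : 1 ≤ L := by have := hvT.2 hk 0 hvT.1; omega
          have hL2 : 1 ≤ L ^ 2 := Nat.one_le_pow _ _ hL
          simp only [if_neg hk]
          have h2 := Nat.mul_le_mul_right (2 * L ^ 2) h1
          rw [Nat.add_mul, Nat.add_mul, Nat.mul_assoc, Nat.mul_assoc] at h2
          omega
      simp only [List.map_append, List.sum_append, List.map_cons, List.map_nil, List.sum_cons,
        List.sum_nil]
      omega

theorem andOps_forall {γ : Type} (leaf : ℕ → ℕ → ℕ → List γ) (P : γ → Prop) (len : ℕ) :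
    ∀ lo i j, WorkPair i j → 1 ≤ len →
      (∀ i j l, WorkPair i j → lo ≤ l → l < lo + len → ∀ g ∈ leaf i j l, P g) →
      ∀ g ∈ andOps leaf i j lo len, P g := by
  induction len using Nat.strong_induction_on with
  | _ len ih =>
    intro lo i j hij h1 hl
    by_cases h : len / 2 = 0
    · rw [andOps_of_leaf _ _ _ _ h]
      exact hl i j lo hij le_rfl (by omega)
    · rw [andOps_of_half _ _ _ _ h]
      have hA := ih (len / 2) (by omega) lo i _ hij.left (by omega)
        fun i j l h a b => hl i j l h a (by omega)
      have hB := ih (len - len / 2) (by omega) (lo + len / 2) _ j hij.right (by omega)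
        fun i j l h a b => hl i j l h (by omega) (by omega)
      intro g hg
      simp only [List.mem_append] at hg
      rcases hg with hg | hg | hg | hg
      exacts [hA g hg, hB g hg, hA g hg, hB g hg]

/-- The number of gates is quadratic in the number of items, since a conjunction of `len` items
takes four conjunctions of half as many. -/
theorem andOps_length_le {γ : Type} (leaf : ℕ → ℕ → ℕ → List γ) (B : ℕ) (len : ℕ) :
    ∀ lo i j, 1 ≤ len → (∀ i j l, lo ≤ l → l < lo + len → (leaf i j l).length ≤ B) →
      (andOps leaf i j lo len).length ≤ (2 * len ^ 2 - 1) * B := by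
  induction len using Nat.strong_induction_on with
  | _ len ih =>
    intro lo i j h1 hl
    by_cases h : len / 2 = 0
    · rw [andOps_of_leaf _ _ _ _ h]
      have : len = 1 := by omega
      subst this
      simpa using hl i j lo le_rfl (by omega)
    · rw [andOps_of_half _ _ _ _ h]
      have hA := ih (len / 2) (by omega) lo i (3 - i - j) (by omega)
        fun i j l a b => hl i j l a (by omega)
      have hB := ih (len - len / 2) (by omega) (lo + len / 2) (3 - i - j) j (by omega)
        fun i j l a b => hl i j l (by omega) (by omega)
      have h2 := Nat.mul_le_mul_right B (two_sq_halves h)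
      rw [Nat.add_mul, Nat.add_mul, Nat.mul_assoc, Nat.mul_assoc] at h2
      simp only [List.length_append]
      omega

theorem litOps_length_le (lit : ℕ → ℕ) (i j l : ℕ) : (litOps lit i j l).length ≤ 2 := by
  unfold litOps; split_ifs <;> simp

theorem starts_lt {cls : List (List ℕ)} {l : ℕ} (hl : l < cls.length) :
    asBank (cls.map List.length) l = cls[l].length := (starts_spec hl).1

theorem sum_length_of_mem {α : Type} {cl : List α} {φ : List (List α)} (h : cl ∈ φ) :
    cl.length ≤ (φ.map List.length).sum :=
  List.le_sum_of_mem (List.mem_map_of_mem h)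

theorem shiftedFormula_length_clause {n : ℕ} {p a : ℕ} {φ : CNF n} {cl : List ℕ}
    (h : cl ∈ shiftedFormula p a φ) : cl.length ≤ φ.size + 3 := by
  unfold CNF.size
  simp only [shiftedFormula, List.mem_append, List.mem_map, List.mem_singleton,
    List.mem_flatMap, List.mem_range] at h
  rcases h with ⟨cl', h, rfl⟩ | rfl | rfl | ⟨i, hi, h⟩
  · have := sum_length_of_mem h
    simp only [List.length_cons, List.length_map]
    omega
  · simp
  · simp; omega
  · split_ifs at h
    · rw [List.mem_singleton] at h
      subst h
      simp only [List.length_cons, List.length_map, List.length_range]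
      omega
    · simp at h

theorem length_flatMap_le {α β : Type} (l : List α) (f : α → List β) (B : ℕ)
    (h : ∀ x ∈ l, (f x).length ≤ B) : (l.flatMap f).length ≤ l.length * B := by
  induction l with
  | nil => simp
  | cons x l ih =>
    have h1 := h x (by simp)
    have h2 := ih fun y hy => h y (by simp [hy])
    rw [List.flatMap_cons, List.length_append, List.length_cons, Nat.add_mul]
    omega

theorem shiftedFormula_length {n : ℕ} (p a : ℕ) (φ : CNF n) :
    2 ≤ (shiftedFormula p a φ).length ∧ (shiftedFormula p a φ).length ≤ φ.size + 3 := by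
  have h1 := length_flatMap_le (List.range (n + 1)) (fun i => if a / 2 ^ i % 2 = 0 then
    [(2 * (3 + p)) :: (2 * (4 + p + i)) ::
      (List.range (n - i)).map fun t => 2 * (4 + p + (i + 1) + t) + 1] else []) 1
    (fun i _ => by split_ifs <;> simp)
  rw [List.length_range] at h1
  unfold shiftedFormula CNF.size
  rw [List.length_append, List.length_append, List.length_append, List.length_map,
    List.length_singleton, List.length_singleton]
  omega

theorem formulaOps_forall {n : ℕ} (p a : ℕ) (φ : CNF n) :
    ∀ g ∈ formulaOps (shiftedFormula p a φ), ∀ w ∈ g.wires, w < wires n p := by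
  have hlen := shiftedFormula_length p a φ
  refine andOps_forall _ _ _ _ _ _ ⟨by norm_num, by norm_num, by norm_num⟩ (by omega) ?_
  intro i j l hij _ hl g hg
  rw [Nat.zero_add] at hl
  have hmem := shiftedFormula_mem (List.getElem_mem hl)
  have hij' : i < wires n p ∧ j < wires n p := by
    obtain ⟨h1, h2, -⟩ := hij
    unfold wires; omega
  rcases List.mem_cons.1 hg with rfl | hg
  · intro w hw
    simp only [Gate.wires, List.mem_cons, List.not_mem_nil, or_false] at hw
    rcases hw with rfl | rfl
    exacts [hij'.1, hij'.2]
  · rw [starts_lt hl] at hg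
    refine andOps_forall (litOps _) (fun g => ∀ w ∈ g.wires, w < wires n p) _ _ _ _ hij hmem.1 ?_
      g hg
    intro i j t hij h1 h2 g hg
    have hij' : i < wires n p ∧ j < wires n p := by
      obtain ⟨h1, h2, -⟩ := hij
      unfold wires; omega
    have hw : asBank (shiftedFormula p a φ).flatten t / 2 < wires n p := by
      have h3 := (starts_spec hl).2 (t - asBank (starts (shiftedFormula p a φ)) l) (by omega)
      rw [Nat.add_sub_cancel' h1] at h3
      rw [h3]
      exact (hmem.2 _ (List.getElem_mem _)).2
    unfold litOps at hg
    rcases List.mem_append.1 hg with hg | hg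
    · split_ifs at hg
      · rw [List.mem_singleton] at hg
        subst hg
        intro w hw
        simp only [Gate.wires, List.mem_cons, List.not_mem_nil, or_false] at hw
        rcases hw with rfl | rfl
        exacts [hij'.1, hij'.2]
      · simp at hg
    · rw [List.mem_singleton] at hg
      subst hg
      intro w hw'
      simp only [Gate.wires, List.mem_cons, List.not_mem_nil, or_false] at hw'
      rcases hw' with rfl | rfl | rfl
      exacts [hij'.1, hw, hij'.2]

theorem formulaOps_length_le {n : ℕ} (p a : ℕ) (φ : CNF n) :
    (formulaOps (shiftedFormula p a φ)).length ≤ 8 * (φ.size + 3) ^ 4 := by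
  have hlen := shiftedFormula_length p a φ
  set L := φ.size + 3 with hL
  have hL1 : 1 ≤ L ^ 2 := Nat.one_le_pow _ _ (by omega)
  have h : (formulaOps (shiftedFormula p a φ)).length ≤ _ :=
    andOps_length_le (clauseOps (asBank (shiftedFormula p a φ).flatten)
      (asBank (starts (shiftedFormula p a φ)))
      (asBank ((shiftedFormula p a φ).map List.length))) (4 * L ^ 2)
      (shiftedFormula p a φ).length 0 0 1 (by omega) ?_
  · refine h.trans ?_
    have h1 : (shiftedFormula p a φ).length ^ 2 ≤ L ^ 2 := Nat.pow_le_pow_left hlen.2 2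
    calc _ ≤ (2 * L ^ 2) * (4 * L ^ 2) := Nat.mul_le_mul_right _ (by omega)
      _ = _ := by ring
  · intro i j l _ hl
    rw [Nat.zero_add] at hl
    unfold clauseOps
    rw [List.length_cons, starts_lt hl]
    have h1 := andOps_length_le (litOps (asBank (shiftedFormula p a φ).flatten)) 2
      ((shiftedFormula p a φ)[l]).length (asBank (starts (shiftedFormula p a φ)) l) i j
      (shiftedFormula_mem (List.getElem_mem hl)).1 fun i j l _ _ => litOps_length_le _ i j l
    have h2 := Nat.pow_le_pow_left (shiftedFormula_length_clause (List.getElem_mem hl)) 2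
    rw [← hL] at h2
    omega

theorem countCircuit_forall {n p : ℕ} {ops : List (Gate ℕ)}
    (h : ∀ g ∈ ops, ∀ w ∈ g.wires, w < wires n p) :
    ∀ g ∈ countCircuit n p ops, ∀ w ∈ g.wires, w < wires n p := by
  intro g hg w hw
  unfold countCircuit at hg
  simp only [List.mem_append, List.mem_cons, List.not_mem_nil, or_false, List.mem_map,
    List.mem_range] at hg
  rcases hg with (((((rfl | rfl | rfl) | ⟨t, ht, rfl⟩) | hg) | ⟨t, ht, rfl⟩) | rfl)
  case inl.inl.inr => exact h g hg w hw
  all_goals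
    simp only [Gate.wires, List.mem_singleton] at hw
    unfold wires
    omega

/-- For wires in range, the reduction modulo the number of wires does nothing. -/
theorem encode_map_wire {n p : ℕ} {g : Gate ℕ} (h : ∀ w ∈ g.wires, w < wires n p) :
    (g.map (wire n p)).encode = gateCode g := by
  cases g <;> simp only [Gate.wires, List.mem_cons, List.not_mem_nil, or_false, forall_eq_or_imp,
    forall_eq] at h <;> simp [Gate.map, Gate.encode, gateCode, wire_val, h]

theorem shiftCircuit_encode {n : ℕ} (p a : ℕ) (φ : CNF n) :
    Circuit.encode (shiftCircuit p a φ) (fun _ => false) =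
      [wires n p, (countCircuit n p (formulaOps (shiftedFormula p a φ))).length] ++
        List.replicate (wires n p) 0 ++
        (countCircuit n p (formulaOps (shiftedFormula p a φ))).flatMap gateCode := by
  unfold Circuit.encode shiftCircuit mapGates
  rw [List.length_map, List.flatMap_map]
  congr 1
  · congr 1
    rw [← List.ofFn_const]
    rfl
  · refine List.flatMap_congr fun g hg => ?_
    exact encode_map_wire (countCircuit_forall (formulaOps_forall p a φ) g hg)

theorem shiftCircuit_size_le {n : ℕ} (p a : ℕ) (φ : CNF n) :
    (shiftCircuit p a φ).size ≤ 3 * φ.size + p + 13 + 8 * (φ.size + 3) ^ 4 := by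
  have h1 := formulaOps_length_le p a φ
  have h2 : n ≤ φ.size := by unfold CNF.size; omega
  unfold Circuit.size shiftCircuit mapGates countCircuit wires
  simp only [List.length_map, List.length_append, List.length_cons, List.length_nil,
    List.length_range]
  omega

/-- Write Hadamard gates: as many as register `17` says, from the wire in register `45` on. -/
def hadamardLoop : Prog :=
  .loop 17 (blk (emitBlk 10 45 26 26 ++ [.add 45 45 10, .sub 17 17 10]))

theorem hadamardLoop_det {pre : List ℕ} {m : Mem} {gs : List (Gate ℕ)} {w k : ℕ}
    (h : Emitted pre m gs) (h10 : m 10 0 = 1) (h26 : m 26 0 = 0) (h45 : m 45 0 = w)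
    (h17 : m 17 0 = k) :
    Det hadamardLoop m (k * 12 + 1) fun m' =>
      Emitted pre m' (gs ++ (List.range k).map fun t => .H (w + t)) ∧
        ∀ b, b ≠ 4 → b ≠ 13 → b ≠ 14 → b ≠ 45 → b ≠ 17 → m' b = m b := by
  refine Det.loop_count (fun j m' => ∃ i, i + j = k ∧
    Emitted pre m' (gs ++ (List.range i).map fun t => .H (w + t)) ∧
    m' 45 0 = w + i ∧ m' 17 0 = j ∧
    ∀ b, b ≠ 4 → b ≠ 13 → b ≠ 14 → b ≠ 45 → b ≠ 17 → m' b = m b) 11 ?_ ?_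
    ⟨0, by omega, by simpa using h, by simpa using h45, h17, fun _ _ _ _ _ _ => rfl⟩
  · rintro m' ⟨i, hi, h1, -, h3, h4⟩
    rw [Nat.add_zero] at hi
    subst hi
    exact ⟨h3, h1, h4⟩
  · rintro j m' ⟨i, hi, h1, h2, h3, h4⟩
    refine ⟨by omega, Det.blk ?_⟩
    have h10' : m' 10 0 = 1 := by rw [h4 10] <;> first | exact h10 | norm_num
    have h26' : m' 26 0 = 0 := by rw [h4 26] <;> first | exact h26 | norm_num
    rw [execs_append]
    have h5 := h1.emit h10' (a := 10) (b := 45) (c := 26) (d := 26) (g := .H (w + i))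
      (by rw [h10', h2, h26']; rfl) (by intro r hr; omega)
    set m₁ := execs (emitBlk 10 45 26 26) m' with hm₁
    have e1 : ∀ b, b ≠ 4 → b ≠ 13 → b ≠ 14 → m₁ b = m' b := fun b b1 b2 b3 =>
      execs_emitBlk_of_ne b1 b2 b3
    refine ⟨i + 1, by omega, ?_, ?_, ?_, ?_⟩
    · rw [List.range_succ, List.map_append, ← List.append_assoc]
      refine h5.congr fun b hb => ?_
      have : b ≠ 45 ∧ b ≠ 17 := by omega
      simp [execs, Instr.memExec, upd_of_ne, this]
    · simp [execs, Instr.memExec, upd_of_ne, e1, h2, h10']; omega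
    · simp [execs, Instr.memExec, upd_of_ne, e1, h3, h10']
    · intro b b1 b2 b3 b4 b5
      simp [execs, Instr.memExec, upd_of_ne, e1, b1, b2, b3, b4, b5, h4]

/-- Write the circuit, from the tables of the formula. -/
def circuitProg (p : ℕ) : Prog :=
  .seq (blk ([.const 13 (7 + p), .add 13 13 19, .const 14 0, .const 30 0, .const 45 (3 + p),
      .const 46 2, .add 17 19 46] ++ (emitBlk 26 45 26 26 ++ (emitBlk 26 26 26 26 ++
      emitBlk 26 10 26 26))))
    (.seq hadamardLoop
    (.seq (blk (pushBlk 10 26 10 26 12))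
    (.seq gatesLoop
    (.seq (blk [.const 45 (3 + p), .const 46 2, .add 17 19 46])
    (.seq hadamardLoop
      (blk (emitBlk 26 26 26 26 ++
        [.const 45 (5 + p), .add 45 45 19, .store 4 26 45, .store 4 10 14])))))))

/-- A bound on the number of unit steps of `circuitProg`. -/
def circuitSteps (p s : ℕ) : ℕ := 200 + 4 * p + 24 * (s + 2) + 160 * (s + 3) ^ 4

/-- The two cells in front of the gates, for the numbers of wires and of gates, are filled in the
end; the bits of the input state are zero, as is the memory at the start. -/
theorem circuitProg_det {n : ℕ} (p a : ℕ) (φ : CNF n) {W : ℕ → ℕ} {m : Mem} (hc : Consts n p W m)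
    (ht : Tables m (shiftedFormula p a φ)) :
    Det (circuitProg p) m (circuitSteps p φ.size) fun m =>
      m 0 = W ∧ m 4 = asBank (Circuit.encode (shiftCircuit p a φ) fun _ => false) := by
  set cls := shiftedFormula p a φ with hcls
  set ops := formulaOps cls with hops
  have hlen := shiftedFormula_length p a φ
  rw [← hcls] at hlen
  have hn : n ≤ φ.size := by unfold CNF.size; omega
  set pre : List ℕ := List.replicate (wires n p + 2) 0 with hpre
  set Hs : List (Gate ℕ) := (List.range (n + 2)).map fun t => .H (3 + p + t) with hHs
  set F := Fixed W (asBank cls.flatten) (asBank (starts cls)) (asBank (cls.map List.length)) n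
    with hF
  have hgates : (countCircuit n p ops).length = ([Gate.X (3 + p), Gate.X 0, Gate.X 1] ++ Hs ++ ops ++
      Hs ++ [Gate.X 0]).length := rfl
  -- the last gate, and the head of the encoding
  have h6 : ∀ m, F m → Emitted pre m ([.X (3 + p), .X 0, .X 1] ++ Hs ++ ops ++ Hs) →
      Det (blk (emitBlk 26 26 26 26 ++ [.const 45 (5 + p), .add 45 45 19, .store 4 26 45,
        .store 4 10 14])) m (18 + p) fun m =>
      m 0 = W ∧ m 4 = asBank (Circuit.encode (shiftCircuit p a φ) fun _ => false) := by
    intro m hf hg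
    refine (Det.blk ?_).mono ?_ fun _ => id
    · rw [execs_append]
      have g1 := hg.emit hf.one (a := 26) (b := 26) (c := 26) (d := 26) (g := .X 0)
        (by rw [hf.zero]; rfl) (by intro r hr; omega)
      set m₁ := execs (emitBlk 26 26 26 26) m with hm₁
      have e1 : ∀ b, b ≠ 4 → b ≠ 13 → b ≠ 14 → m₁ b = m b := fun b b1 b2 b3 =>
        execs_emitBlk_of_ne b1 b2 b3
      have f1 : F m₁ := hf.congr fun b hb => e1 b (by omega) (by omega) (by omega)
      refine ⟨?_, ?_⟩
      · simp [execs, Instr.memExec, upd_of_ne, f1.input]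
      · obtain ⟨k1, -, k3⟩ := g1
        rw [shiftCircuit_encode, hgates.trans k3.symm, List.append_assoc, List.cons_append,
          List.cons_append, List.nil_append]
        have k1' : m₁ 4 = asBank (0 :: 0 :: (List.replicate (wires n p) 0 ++
            (countCircuit n p ops).flatMap gateCode)) := by rw [k1]; rfl
        have hw : 5 + p + n = wires n p := by unfold wires; omega
        have hout : execs [.const 45 (5 + p), .add 45 45 19, .store 4 26 45, .store 4 10 14] m₁ 4 =
            Function.update (Function.update (m₁ 4) 0 (5 + p + n)) 1 (m₁ 14 0) := by
          simp [execs, Instr.memExec, upd_of_ne, f1.zero, f1.one, f1.vars]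
        rw [hout, hw, k1']
        funext t
        rcases t with _ | _ | t
        · simp [asBank]
        · simp [asBank]
        · simp [asBank, hops, hcls]
    · have := size_le_self (5 + p)
      simp only [blkSteps_append, blkSteps, Instr.steps, emitBlk]
      omega
  -- the second layer of Hadamard gates
  have h5 : ∀ m, F m → Emitted pre m ([.X (3 + p), .X 0, .X 1] ++ Hs ++ ops) →
      Det (.seq (blk [.const 45 (3 + p), .const 46 2, .add 17 19 46]) (.seq hadamardLoop
        (blk (emitBlk 26 26 26 26 ++ [.const 45 (5 + p), .add 45 45 19, .store 4 26 45,
        .store 4 10 14])))) m (8 + p + (((n + 2) * 12 + 1) + (18 + p))) fun m =>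
      m 0 = W ∧ m 4 = asBank (Circuit.encode (shiftCircuit p a φ) fun _ => false) := by
    intro m hf hg
    refine Det.seq (Det.mono (k := blkSteps [.const 45 (3 + p), .const 46 2, .add 17 19 46])
      (Det.blk ?_) ?_ fun _ => id)
    · set m₁ := execs [.const 45 (3 + p), .const 46 2, .add 17 19 46] m with hm₁
      have e1 : ∀ b, b ≠ 45 → b ≠ 46 → b ≠ 17 → m₁ b = m b := fun b b1 b2 b3 => by
        simp [hm₁, execs, Instr.memExec, upd_of_ne, b1, b2, b3]
      have f1 : F m₁ := hf.congr fun b hb => e1 b (by omega) (by omega) (by omega)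
      refine Det.seq ((hadamardLoop_det (w := 3 + p) (k := n + 2) (hg.congr fun b hb => e1 b
        (by omega) (by omega) (by omega)) f1.one f1.zero ?_ ?_).imp fun m₂ ⟨g2, e2⟩ =>
        h6 m₂ (f1.congr fun b hb => e2 b (by omega) (by omega) (by omega) (by omega) (by omega)) g2)
      · simp [hm₁, execs, Instr.memExec, upd_of_ne]
      · simp [hm₁, execs, Instr.memExec, upd_of_ne, hf.vars]
    · have := size_le_self (3 + p)
      have k2 : Nat.size 2 ≤ 2 := size_le_self 2
      simp only [blkSteps, Instr.steps]
      omega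
  -- the gates that evaluate the formula
  have h4 : ∀ m, F m → m 12 0 = cls.length → Emitted pre m ([.X (3 + p), .X 0, .X 1] ++ Hs) →
      m 30 0 = 0 →
      Det (.seq (blk (pushBlk 10 26 10 26 12)) (.seq gatesLoop
        (.seq (blk [.const 45 (3 + p), .const 46 2, .add 17 19 46]) (.seq hadamardLoop
        (blk (emitBlk 26 26 26 26 ++ [.const 45 (5 + p), .add 45 45 19, .store 4 26 45,
        .store 4 10 14])))))) m
        (6 + ((1 + 160 * (φ.size + 3) ^ 4) + (8 + p + (((n + 2) * 12 + 1) + (18 + p))))) fun m =>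
      m 0 = W ∧ m 4 = asBank (Circuit.encode (shiftCircuit p a φ) fun _ => false) := by
    intro m hf h12 hg h30
    refine Det.seq (Det.blk ?_)
    have s0 : Stack m [] := ⟨h30, fun t T hT => by simp at hT⟩
    have s1 := s0.push hf.one (a := 10) (b := 26) (c := 10) (d := 26) (e := 12)
      (by intro r hr; omega)
    rw [hf.one, hf.zero, h12] at s1
    set m₁ := execs (pushBlk 10 26 10 26 12) m with hm₁
    have e1 : ∀ b, ¬ (5 ≤ b ∧ b ≤ 9) → b ≠ 30 → m₁ b = m b := fun b b1 b2 =>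
      execs_pushBlk_of_ne b1 b2
    refine Det.seq ((Det.mono (gatesLoop_det (L := φ.size + 3) (pre := pre)
      (total := [.X (3 + p), .X 0, .X 1] ++ Hs ++ ops)
      (hf.congr fun b hb => e1 b (by omega) (by omega))
      (hg.congr fun b hb => e1 b (by omega) (by omega)) s1 ?_ ?_) ?_ fun _ => id).imp
      fun m₂ hm₂ => h5 m₂ hm₂.1 hm₂.2)
    · intro T hT
      simp only [List.nil_append, List.mem_singleton] at hT
      subst hT
      refine ⟨by dsimp only; omega, fun _ t ht => ?_⟩
      dsimp only at ht ⊢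
      rw [Nat.zero_add, starts_lt ht]
      exact ⟨(shiftedFormula_mem (List.getElem_mem ht)).1,
        shiftedFormula_length_clause (List.getElem_mem ht)⟩
    · simp [Task.gates, hops, formulaOps]
    · simp only [List.nil_append, List.map_cons, List.map_nil, List.sum_cons, List.sum_nil,
        Nat.add_zero, Task.rounds, one_ne_zero, if_false]
      have h1 : cls.length ^ 2 ≤ (φ.size + 3) ^ 2 := Nat.pow_le_pow_left hlen.2 2
      have h2 : (2 * cls.length ^ 2 - 1) * (2 * (φ.size + 3) ^ 2) ≤
          (2 * (φ.size + 3) ^ 2) * (2 * (φ.size + 3) ^ 2) := Nat.mul_le_mul_right _ (by omega)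
      have h3 : (2 * (φ.size + 3) ^ 2) * (2 * (φ.size + 3) ^ 2) = 4 * (φ.size + 3) ^ 4 := by ring
      omega
  unfold circuitProg
  refine Det.mono (k := (75 + 2 * p) + (((n + 2) * 12 + 1) +
    (6 + ((1 + 160 * (φ.size + 3) ^ 4) + (8 + p + (((n + 2) * 12 + 1) + (18 + p))))))) ?_ ?_
    fun _ => id
  · refine Det.seq (Det.mono (k := blkSteps ([.const 13 (7 + p), .add 13 13 19, .const 14 0,
      .const 30 0, .const 45 (3 + p), .const 46 2, .add 17 19 46] ++ (emitBlk 26 45 26 26 ++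
      (emitBlk 26 26 26 26 ++ emitBlk 26 10 26 26)))) (Det.blk ?_) ?_ fun _ => id)
    · rw [execs_append, execs_append, execs_append]
      have f0 : F m := ⟨hc.input, ht.1, ht.2.1, ht.2.2.1, hc.one, hc.vars, hc.three, hc.four,
        hc.zero⟩
      set m₁ := execs [.const 13 (7 + p), .add 13 13 19, .const 14 0,
        .const 30 0, .const 45 (3 + p), .const 46 2, .add 17 19 46] m with hm₁
      have e1 : ∀ b, b ≠ 13 → b ≠ 14 → b ≠ 30 → b ≠ 45 → b ≠ 46 → b ≠ 17 → m₁ b = m b :=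
        fun b b1 b2 b3 b4 b5 b6 => by
          simp [hm₁, execs, Instr.memExec, upd_of_ne, b1, b2, b3, b4, b5, b6]
      have f1 : F m₁ := f0.congr fun b hb => e1 b (by omega) (by omega) (by omega) (by omega)
        (by omega) (by omega)
      have g1 : Emitted pre m₁ [] := by
        refine ⟨?_, ?_, ?_⟩
        · rw [e1, hc.out] <;> norm_num
          funext t
          simp [asBank, hpre]
        · simp [hm₁, execs, Instr.memExec, upd_of_ne, hc.vars, hpre, wires]
          omega
        · simp [hm₁, execs, Instr.memExec, upd_of_ne]
      have v45 : m₁ 45 0 = 3 + p := by simp [hm₁, execs, Instr.memExec, upd_of_ne]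
      have v17 : m₁ 17 0 = n + 2 := by simp [hm₁, execs, Instr.memExec, upd_of_ne, hc.vars]
      have v30 : m₁ 30 0 = 0 := by simp [hm₁, execs, Instr.memExec, upd_of_ne]
      have v12 : m₁ 12 0 = cls.length := by rw [e1, ht.2.2.2.2] <;> norm_num
      clear_value m₁
      have fr : ∀ {m : Mem} {a b c d : ℕ}, F m → F (execs (emitBlk a b c d) m) :=
        fun h => h.congr fun b hb => execs_emitBlk_of_ne (by omega) (by omega) (by omega)
      have g2 := g1.emit f1.one (a := 26) (b := 45) (c := 26) (d := 26) (g := .X (3 + p))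
        (by rw [f1.zero, v45]; rfl) (by intro r hr; omega)
      have f2 := fr (a := 26) (b := 45) (c := 26) (d := 26) f1
      have g3 := g2.emit f2.one (a := 26) (b := 26) (c := 26) (d := 26) (g := .X 0)
        (by rw [f2.zero]; rfl) (by intro r hr; omega)
      have f3 := fr (a := 26) (b := 26) (c := 26) (d := 26) f2
      have g4 := g3.emit f3.one (a := 26) (b := 10) (c := 26) (d := 26) (g := .X 1)
        (by rw [f3.zero, f3.one]; rfl) (by intro r hr; omega)
      have f4 := fr (a := 26) (b := 10) (c := 26) (d := 26) f3
      have e4 : ∀ b, b ≠ 4 → b ≠ 13 → b ≠ 14 → execs (emitBlk 26 10 26 26)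
          (execs (emitBlk 26 26 26 26) (execs (emitBlk 26 45 26 26) m₁)) b = m₁ b :=
        fun b b1 b2 b3 => by
          rw [execs_emitBlk_of_ne b1 b2 b3, execs_emitBlk_of_ne b1 b2 b3,
            execs_emitBlk_of_ne b1 b2 b3]
      set m₂ := execs (emitBlk 26 10 26 26)
          (execs (emitBlk 26 26 26 26) (execs (emitBlk 26 45 26 26) m₁)) with hm₂
      refine Det.seq ((hadamardLoop_det (w := 3 + p) (k := n + 2) g4 f4.one f4.zero
        ?_ ?_).imp fun m₃ ⟨g5, e5⟩ => h4 m₃ (f4.congr fun b hb => e5 b (by omega) (by omega)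
          (by omega) (by omega) (by omega)) ?_ g5 ?_)
      · rw [e4, v45] <;> norm_num
      · rw [e4, v17] <;> norm_num
      · rw [e5, e4, v12] <;> norm_num
      · rw [e5, e4, v30] <;> norm_num
    · have := size_le_self (3 + p)
      have := size_le_self (7 + p)
      have k2 : Nat.size 2 ≤ 2 := size_le_self 2
      have k0 : Nat.size 0 ≤ 0 := size_le_self 0
      simp only [blkSteps_append, blkSteps, Instr.steps, emitBlk]
      omega
  · unfold circuitSteps
    omega

/-- Write the circuit for the input formula. -/
def buildProg (p : ℕ) : Prog := .seq (tablesProg p) (circuitProg p)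

theorem buildProg_det {n : ℕ} (p a : ℕ) (φ : CNF n) :
    Det (buildProg p) (frame (asBank (φ.encode ++ [a])))
      (tablesSteps p φ.size + circuitSteps p φ.size) fun m =>
      m 0 = asBank (φ.encode ++ [a]) ∧
        m 4 = asBank (Circuit.encode (shiftCircuit p a φ) fun _ => false) :=
  Det.seq ((tablesProg_det p a φ).imp fun _ h => circuitProg_det p a φ h.1 h.2)

/-! ### Rounding the output of the simulation -/

theorem Det.block_le {l : List Instr} {m : Mem} {k : ℕ} {R : Mem → Prop} (h : R (execs l m))
    (hk : blkSteps l ≤ k) (hl : l.all Instr.isClassical = true := by rfl) :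
    Det (QSim.blk l) m k R :=
  (Det.blk h hl).mono hk fun _ => id

/-- Round `2 ^ (n + 2)` times the quotient of the first two cells of bank `4` to the nearest
integer, where `n` is the number in register `0`, and put the result into register `0`. Only the
last `n + 3` binary digits of the result are computed, which makes the number of steps independent
of the quotient. The register `51` holds the denominator, `50` the remainder, `53` the divisor times
the power of two in register `54`, and `55` the quotient. A denominator zero leads to the result
zero, like the quotient of real numbers. -/
def roundProg : Prog :=
  .seq (blk [.const 26 0, .const 10 1, .const 52 3, .add 17 0 52, .add 50 4 26, .load 51 4 10,
      .add 53 51 51, .add 54 10 26, .const 55 0])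
    (.seq (.cond 51
      (.seq (.loop 17 (blk [.add 50 50 50, .add 53 53 53, .add 54 54 54, .sub 17 17 10]))
      (.seq (blk [.add 50 50 51, .const 52 3, .add 17 0 52])
        (.loop 17 (.seq (blk [.half 53 53, .half 54 54, .sub 17 17 10, .sub 56 53 50])
          (.cond 56 .skip (blk [.sub 50 50 53, .add 55 55 54]))))))
      .skip)
    (blk [.add 0 55 26]))

/-- A bound on the number of unit steps of `roundProg`. -/
def roundSteps (n : ℕ) : ℕ := 40 + (n + 3) * 13

theorem doublingLoop_det {m : Mem} {k x d : ℕ} (h10 : m 10 0 = 1) (h17 : m 17 0 = k)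
    (h50 : m 50 0 = x) (h53 : m 53 0 = d) (h54 : m 54 0 = 1) :
    Det (.loop 17 (blk [.add 50 50 50, .add 53 53 53, .add 54 54 54, .sub 17 17 10])) m
      (k * (4 + 1) + 1) fun m' => m' 50 0 = 2 ^ k * x ∧ m' 53 0 = 2 ^ k * d ∧ m' 54 0 = 2 ^ k ∧
        ∀ b, b ≠ 17 → b ≠ 50 → b ≠ 53 → b ≠ 54 → m' b = m b := by
  refine Det.loop_count (fun j m' => ∃ i, i + j = k ∧ m' 17 0 = j ∧ m' 50 0 = 2 ^ i * x ∧
    m' 53 0 = 2 ^ i * d ∧ m' 54 0 = 2 ^ i ∧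
    ∀ b, b ≠ 17 → b ≠ 50 → b ≠ 53 → b ≠ 54 → m' b = m b) 4 ?_ ?_
    ⟨0, by omega, h17, by simpa using h50, by simpa using h53, by simpa using h54,
      fun _ _ _ _ _ => rfl⟩
  · rintro m' ⟨i, hi, h1, h2⟩
    rw [Nat.add_zero] at hi
    subst hi
    exact ⟨h1, h2⟩
  · rintro j m' ⟨i, hi, h1, h2, h3, h4, h5⟩
    have h10' : m' 10 0 = 1 := by rw [h5 10] <;> first | exact h10 | norm_num
    refine ⟨by omega, Det.blk ⟨i + 1, by omega, ?_, ?_, ?_, ?_, ?_⟩⟩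
    · simp [execs, Instr.memExec, upd_of_ne, h1, h10']
    · simp [execs, Instr.memExec, upd_of_ne, h2]; ring
    · simp [execs, Instr.memExec, upd_of_ne, h3]; ring
    · simp [execs, Instr.memExec, upd_of_ne, h4]; ring
    · intro b b1 b2 b3 b4
      simp [execs, Instr.memExec, upd_of_ne, b1, b2, b3, b4, h5]

/-- Long division of `x` by `d`. It is correct if the quotient has at most `k` binary digits; it
takes the same time and yields a number with `k` binary digits in any case. -/
theorem divisionLoop_det {m : Mem} {k x d : ℕ} (h10 : m 10 0 = 1) (h17 : m 17 0 = k)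
    (h50 : m 50 0 = x) (h53 : m 53 0 = 2 ^ k * d) (h54 : m 54 0 = 2 ^ k) (h55 : m 55 0 = 0) :
    Det (.loop 17 (.seq (blk [.half 53 53, .half 54 54, .sub 17 17 10, .sub 56 53 50])
          (.cond 56 .skip (blk [.sub 50 50 53, .add 55 55 54])))) m
      (k * (7 + 1) + 1) fun m' => m' 55 0 < 2 ^ k ∧ (x < 2 ^ k * d → m' 55 0 = x / d) ∧
        ∀ b, b ≠ 17 → b ≠ 50 → b ≠ 53 → b ≠ 54 → b ≠ 55 → b ≠ 56 → m' b = m b := by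
  refine Det.loop_count (fun j m' => m' 17 0 = j ∧ m' 53 0 = 2 ^ j * d ∧ m' 54 0 = 2 ^ j ∧
    m' 55 0 + 2 ^ j ≤ 2 ^ k ∧ (x < 2 ^ k * d → m' 50 0 + m' 55 0 * d = x ∧ m' 50 0 < 2 ^ j * d) ∧
    ∀ b, b ≠ 17 → b ≠ 50 → b ≠ 53 → b ≠ 54 → b ≠ 55 → b ≠ 56 → m' b = m b) 7 ?_ ?_
    ⟨h17, h53, h54, by omega, fun h => by rw [h55, h50]; omega, fun _ _ _ _ _ _ _ => rfl⟩
  · rintro m' ⟨h1, h2, h3, h4, h5, h6⟩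
    refine ⟨h1, by omega, fun h => ?_, h6⟩
    obtain ⟨h7, h8⟩ := h5 h
    rw [pow_zero, one_mul] at h8
    rw [← h7, Nat.add_mul_div_right _ _ (by omega), Nat.div_eq_of_lt h8, Nat.zero_add]
  · rintro j m' ⟨h1, h2, h3, h4, h5, h6⟩
    have h10' : m' 10 0 = 1 := by rw [h6 10] <;> first | exact h10 | norm_num
    refine ⟨by omega, ?_⟩
    refine Det.seq (k := 4) (k' := 3) (Det.blk ?_)
    set m₁ := execs [.half 53 53, .half 54 54, .sub 17 17 10, .sub 56 53 50] m' with hm₁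
    have e1 : ∀ b, b ≠ 53 → b ≠ 54 → b ≠ 17 → b ≠ 56 → m₁ b = m' b := fun b b1 b2 b3 b4 => by
      simp [hm₁, execs, Instr.memExec, upd_of_ne, b1, b2, b3, b4]
    have v53 : m₁ 53 0 = 2 ^ j * d := by
      simp [hm₁, execs, Instr.memExec, upd_of_ne, h2]
      rw [pow_succ, Nat.mul_right_comm, Nat.mul_div_cancel _ (by norm_num)]
    have v54 : m₁ 54 0 = 2 ^ j := by
      simp [hm₁, execs, Instr.memExec, upd_of_ne, h3]
      omega
    have v17 : m₁ 17 0 = j := by simp [hm₁, execs, Instr.memExec, upd_of_ne, h1, h10']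
    have v50 : m₁ 50 0 = m' 50 0 := by rw [e1] <;> norm_num
    have v55 : m₁ 55 0 = m' 55 0 := by rw [e1] <;> norm_num
    have v56 : m₁ 56 0 = 2 ^ j * d - m₁ 50 0 := by
      rw [← v53]
      simp [hm₁, execs, Instr.memExec, upd_of_ne]
    have e2 : ∀ b, b ≠ 17 → b ≠ 50 → b ≠ 53 → b ≠ 54 → b ≠ 55 → b ≠ 56 → m₁ b = m b :=
      fun b b1 b2 b3 b4 b5 b6 => by rw [e1 b b3 b4 b1 b6, h6 b b1 b2 b3 b4 b5 b6]
    clear_value m₁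
    rw [← v50, ← v55] at h5
    rw [← v55] at h4
    have hp : 2 ^ (j + 1) = 2 ^ j + 2 ^ j := by ring
    have hp' : 2 ^ (j + 1) * d = 2 ^ j * d + 2 ^ j * d := by ring
    by_cases h : m₁ 56 0 = 0
    · refine Det.cond_false h (Det.blk ⟨?_, ?_, ?_, ?_, fun hx => ?_, ?_⟩)
      · simp [execs, Instr.memExec, upd_of_ne, v17]
      · simp [execs, Instr.memExec, upd_of_ne, v53]
      · simp [execs, Instr.memExec, upd_of_ne, v54]
      · simp [execs, Instr.memExec, upd_of_ne, v54]
        omega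
      · obtain ⟨h7, h8⟩ := h5 hx
        simp [execs, Instr.memExec, upd_of_ne, v54, v53]
        rw [Nat.add_mul]
        omega
      · intro b b1 b2 b3 b4 b5 b6
        simp [execs, Instr.memExec, upd_of_ne, b2, b5, e2, b1, b3, b4, b6]
    · refine Det.mono (k := 1 + 0) (Det.cond_true h (Det.skip ⟨v17, v53, v54, by omega,
        fun hx => ⟨(h5 hx).1, by omega⟩, e2⟩)) (by norm_num) fun _ => id

/-- The rounded value of `2 ^ (n + 2) * (v 0 / v 1)` is the integral part of
`(2 ^ (n + 3) * v 0 + v 1) / (2 * v 1)`. -/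
theorem roundProg_det {m : Mem} {W v : ℕ → ℕ} {n : ℕ} (h0 : m 0 = W) (hn : W 0 = n)
    (h4 : m 4 = v) :
    Det roundProg m (roundSteps n) fun m' => ∃ e < 2 ^ (n + 3), m' 0 = Function.update W 0 e ∧
      (v 1 = 0 → e = 0) ∧ (2 ^ (n + 3) * v 0 + v 1 < 2 ^ (n + 3) * (2 * v 1) →
        e = (2 ^ (n + 3) * v 0 + v 1) / (2 * v 1)) := by
  refine Det.mono (k := 20 + ((1 + (((n + 3) * (4 + 1) + 1) + (8 + ((n + 3) * (7 + 1) + 1)))) + 1))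
    ?_ (by unfold roundSteps; omega) fun _ => id
  have k0 : Nat.size 0 ≤ 0 := size_le_self 0
  have k1 : Nat.size 1 ≤ 1 := size_le_self 1
  have k3 : Nat.size 3 ≤ 3 := size_le_self 3
  refine Det.seq (Det.block_le ?_ (by simp only [blkSteps, Instr.steps]; omega))
  set m₁ := execs [.const 26 0, .const 10 1, .const 52 3, .add 17 0 52, .add 50 4 26, .load 51 4 10,
      .add 53 51 51, .add 54 10 26, .const 55 0] m with hm₁
  have e0 : m₁ 0 = W := by simp [hm₁, execs, Instr.memExec, upd_of_ne, h0]
  have v26 : m₁ 26 0 = 0 := by simp [hm₁, execs, Instr.memExec, upd_of_ne]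
  have v10 : m₁ 10 0 = 1 := by simp [hm₁, execs, Instr.memExec, upd_of_ne]
  have v17 : m₁ 17 0 = n + 3 := by simp [hm₁, execs, Instr.memExec, upd_of_ne, h0, hn]
  have v50 : m₁ 50 0 = v 0 := by simp [hm₁, execs, Instr.memExec, upd_of_ne, h4]
  have v51 : m₁ 51 0 = v 1 := by simp [hm₁, execs, Instr.memExec, upd_of_ne, h4]
  have v53 : m₁ 53 0 = 2 * v 1 := by simp [hm₁, execs, Instr.memExec, upd_of_ne, h4]; omega
  have v54 : m₁ 54 0 = 1 := by simp [hm₁, execs, Instr.memExec, upd_of_ne]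
  have v55 : m₁ 55 0 = 0 := by simp [hm₁, execs, Instr.memExec, upd_of_ne]
  clear_value m₁
  have fin : ∀ m₂ : Mem, m₂ 0 = W → m₂ 26 0 = 0 → m₂ 55 0 < 2 ^ (n + 3) → (v 1 = 0 → m₂ 55 0 = 0) →
      (2 ^ (n + 3) * v 0 + v 1 < 2 ^ (n + 3) * (2 * v 1) →
        m₂ 55 0 = (2 ^ (n + 3) * v 0 + v 1) / (2 * v 1)) →
      Det (blk [.add 0 55 26]) m₂ 1 fun m' => ∃ e < 2 ^ (n + 3), m' 0 = Function.update W 0 e ∧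
      (v 1 = 0 → e = 0) ∧ (2 ^ (n + 3) * v 0 + v 1 < 2 ^ (n + 3) * (2 * v 1) →
        e = (2 ^ (n + 3) * v 0 + v 1) / (2 * v 1)) := by
    intro m₂ w0 w26 w55 w1 w2
    refine Det.blk ⟨m₂ 55 0, w55, ?_, w1, w2⟩
    simp [execs, Instr.memExec, w0, w26]
  by_cases hv : v 1 = 0
  · refine Det.mono (k := (1 + 0) + 1) ?_ (by omega) fun _ => id
    refine Det.seq (Det.cond_false (by rw [v51, hv]) (Det.skip ?_))
    exact fin m₁ e0 v26 (by rw [v55]; positivity) (fun _ => v55)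
      (fun h => by rw [hv] at h; omega)
  · refine Det.seq (Det.cond_true (by rw [v51]; exact hv) ?_)
    refine Det.seq ((doublingLoop_det v10 v17 v50 v53 v54).imp ?_)
    rintro m₂ ⟨w50, w53, w54, e2⟩
    refine Det.seq (Det.block_le ?_ (by simp only [blkSteps, Instr.steps]; omega))
    set m₃ := execs [.add 50 50 51, .const 52 3, .add 17 0 52] m₂ with hm₃
    have e3 : ∀ b, b ≠ 17 → b ≠ 50 → b ≠ 52 → b ≠ 53 → b ≠ 54 → m₃ b = m₁ b :=
      fun b b1 b2 b3 b4 b5 => by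
        simp [hm₃, execs, Instr.memExec, upd_of_ne, b1, b2, b3, b4, b5, e2]
    refine (divisionLoop_det (k := n + 3) (x := 2 ^ (n + 3) * v 0 + v 1) (d := 2 * v 1)
      (m := m₃) ?_ ?_ ?_ ?_ ?_ ?_).imp ?_
    · rw [e3, v10] <;> norm_num
    · simp [hm₃, execs, Instr.memExec, upd_of_ne, e2, e0, hn]
    · simp [hm₃, execs, Instr.memExec, upd_of_ne, e2, w50, v51]
    · simp [hm₃, execs, Instr.memExec, upd_of_ne, w53]
    · simp [hm₃, execs, Instr.memExec, upd_of_ne, w54]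
    · rw [e3, v55] <;> norm_num
    · rintro m₄ ⟨h5, h6, h7⟩
      refine fin m₄ ?_ ?_ h5 (fun h => absurd h hv) h6
      · rw [h7, e3, e0] <;> norm_num
      · rw [h7, e3, v26] <;> norm_num

/-- The integers within the multiplicative error `γ` of `v`, up to rounding. -/
def closeTo (γ : ℝ) (v : ℕ) : Set ℕ := {e | |(e : ℝ) - v| < γ * v + 1 / 2}

/-- Good values form an interval, which is what makes a binary search for one of them possible. -/
theorem closeTo_ordConnected (γ : ℝ) (v : ℕ) : (closeTo γ v).OrdConnected := by
  refine ⟨fun x hx y hy z hz => ?_⟩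
  simp only [closeTo, Set.mem_ofPred_eq, abs_lt] at *
  have h1 : (x : ℝ) ≤ z := Nat.cast_le.2 hz.1
  have h2 : (z : ℝ) ≤ y := Nat.cast_le.2 hz.2
  constructor <;> linarith

/-- The rounded output of the simulation is a good value. For `v ≠ 0` the denominator is not zero,
and the quotient is small enough for the long division to be correct, because `v ≤ 2 ^ (n + 1)`. -/
theorem round_mem_closeTo {γ : ℝ} {v n P Q e : ℕ} (hγ : 0 < γ) (hγ' : γ < 1 / 2)
    (hv : v ≤ 2 ^ (n + 1))
    (h : MulApprox γ ((v : ℝ) / 2 ^ (n + 2)) ((P : ℝ) / Q)) (h0 : Q = 0 → e = 0)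
    (h1 : 2 ^ (n + 3) * P + Q < 2 ^ (n + 3) * (2 * Q) →
      e = (2 ^ (n + 3) * P + Q) / (2 * Q)) : e ∈ closeTo γ v := by
  have hN : (0 : ℝ) < 2 ^ (n + 2) := by positivity
  have hN3 : (2 : ℝ) ^ (n + 3) = 2 * 2 ^ (n + 2) := by ring
  rcases Nat.eq_zero_or_pos v with rfl | hv0
  · have he : e = 0 := by
      by_cases hQ : Q = 0
      · exact h0 hQ
      · simp only [MulApprox, Nat.cast_zero, zero_div, if_true, div_eq_zero_iff,
          Nat.cast_eq_zero, hQ, or_false] at h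
        subst h
        have hQ' : 0 < Q := Nat.pos_of_ne_zero hQ
        rw [Nat.mul_zero, Nat.zero_add] at h1
        rw [h1 (by nlinarith [Nat.one_le_two_pow (n := n + 3)])]
        exact Nat.div_eq_of_lt (by omega)
    subst he
    simp [closeTo]
  · have hv' : (0 : ℝ) < v := Nat.cast_pos.2 hv0
    have hx : (0 : ℝ) < (v : ℝ) / 2 ^ (n + 2) := by positivity
    rw [MulApprox, if_neg hx.ne'] at h
    obtain ⟨ha, hb⟩ := h
    have hQ : Q ≠ 0 := by
      rintro rfl
      simp only [Nat.cast_zero, div_zero] at ha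
      have : 0 < (1 - γ) * ((v : ℝ) / 2 ^ (n + 2)) := mul_pos (by linarith) hx
      linarith
    have hQ' : (0 : ℝ) < Q := Nat.cast_pos.2 (Nat.pos_of_ne_zero hQ)
    -- the number that is rounded
    set y : ℝ := 2 ^ (n + 2) * ((P : ℝ) / Q) with hy
    have hy1 : (1 - γ) * v < y := by
      have := mul_lt_mul_of_pos_left ha hN
      have e : (2 : ℝ) ^ (n + 2) * ((1 - γ) * (v / 2 ^ (n + 2))) = (1 - γ) * v := by field_simp
      linarith
    have hy2 : y < (1 + γ) * v := by
      have := mul_lt_mul_of_pos_left hb hN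
      have e : (2 : ℝ) ^ (n + 2) * ((1 + γ) * (v / 2 ^ (n + 2))) = (1 + γ) * v := by field_simp
      linarith
    have hyQ : y * Q = 2 ^ (n + 2) * P := by rw [hy]; field_simp
    -- The quotient fits: `y < (3 / 2) * 2 ^ (n + 1)`.
    have hlt : 2 ^ (n + 3) * P + Q < 2 ^ (n + 3) * (2 * Q) := by
      have hvR : (v : ℝ) ≤ 2 ^ (n + 1) := by exact_mod_cast hv
      have h2 : (2 : ℝ) ^ (n + 2) = 2 * 2 ^ (n + 1) := by ring
      have h3 : (1 : ℝ) ≤ 2 ^ (n + 1) := one_le_pow₀ (by norm_num)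
      have h4 : y < 3 / 2 * 2 ^ (n + 1) := by nlinarith
      have h5 : y * Q < 3 / 2 * 2 ^ (n + 1) * Q := mul_lt_mul_of_pos_right h4 hQ'
      have h6 : (Q : ℝ) ≤ 2 ^ (n + 1) * Q := by nlinarith
      have : ((2 ^ (n + 3) * P + Q : ℕ) : ℝ) < ((2 ^ (n + 3) * (2 * Q) : ℕ) : ℝ) := by
        push_cast
        rw [hN3, h2]
        rw [hyQ, h2] at h5
        nlinarith
      exact_mod_cast this
    have he := h1 hlt
    have d1 : e * (2 * Q) ≤ 2 ^ (n + 3) * P + Q := by rw [he]; exact Nat.div_mul_le_self _ _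
    have d2 : 2 ^ (n + 3) * P + Q < (e + 1) * (2 * Q) := by
      rw [he, ← Nat.div_lt_iff_lt_mul (by omega)]
      exact Nat.lt_succ_self _
    have d1' : (e : ℝ) * (2 * Q) ≤ 2 * (y * Q) + Q := by
      rw [hyQ, ← mul_assoc 2 (2 ^ (n + 2) : ℝ), ← hN3]; exact_mod_cast d1
    have d2' : 2 * (y * Q) + Q < ((e : ℝ) + 1) * (2 * Q) := by
      rw [hyQ, ← mul_assoc 2 (2 ^ (n + 2) : ℝ), ← hN3]; exact_mod_cast d2
    have f1 : (e : ℝ) ≤ y + 1 / 2 := by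
      refine le_of_mul_le_mul_right ?_ (by linarith : (0 : ℝ) < 2 * Q)
      linarith
    have f2 : y + 1 / 2 < (e : ℝ) + 1 := by
      refine lt_of_mul_lt_mul_right ?_ (by linarith : (0 : ℝ) ≤ 2 * Q)
      linarith
    simp only [closeTo, Set.mem_ofPred_eq, abs_lt]
    constructor <;> linarith

theorem CNF.count_le {n : ℕ} (φ : CNF n) : φ.count ≤ 2 ^ n :=
  (Finset.card_filter_le _ _).trans (by simp)

/-- Build the circuit for the formula and the number `a` in the input, run the simulation, and round
its output to an integer. -/
def sampleProg (p : ℕ) (A : Prog) : Prog := .seq (buildProg p) (.seq (.call 4 A) roundProg)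

/-- The expected running time of `sampleProg`, in terms of the size of the formula, of the length of
the numbers in the input, and of the running time `x` of the simulation. -/
def sampleTime (p s z : ℕ) (x : ℝ≥0∞) : ℝ≥0∞ :=
  stepCost (tablesSteps p s + circuitSteps p s) z +
    ((1 + stepCost (roundSteps s) (z + (tablesSteps p s + circuitSteps p s)) : ℕ) +
      (2 * roundSteps s + 1 : ℕ) * x)

/-- A single sample: from an algorithm for strong simulation to an estimate of the distance of `a`
to the number of satisfying assignments, with the same probability of success. -/
theorem sampleProg_spec {n p a z : ℕ} {φ : CNF n} {A : Prog} {γ t : ℝ} (hγ : 0 < γ)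
    (hγ' : γ < 1 / 2)
    (hA : A.Succeeds (Circuit.encode (shiftCircuit p a φ) fun _ => false)
      (fun τ => MulApprox γ ((shiftCircuit p a φ).absAmplitude fun _ => false)
        ((τ.mem 0 0 : ℝ) / (τ.mem 0 1 : ℝ))) t)
    (hz : SizeLE (frame (asBank (φ.encode ++ [a]))) z) :
    Spec (sampleProg p A) (frame (asBank (φ.encode ++ [a])))
      (fun m => ∃ e < 2 ^ (n + 3), m 0 = Function.update (asBank (φ.encode ++ [a])) 0 e)
      (fun m => m 0 0 ∈ closeTo γ (Int.natAbs ((φ.count : ℤ) - (a % 2 ^ (n + 1) : ℕ)))) (1 / 3)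
      (sampleTime p φ.size z (ENNReal.ofReal t)) := by
  have hn : n ≤ φ.size := by unfold CNF.size; omega
  have hcount := φ.count_le
  set v := Int.natAbs ((φ.count : ℤ) - (a % 2 ^ (n + 1) : ℕ)) with hv
  have hv2 : v ≤ 2 ^ (n + 1) := by
    have : 2 ^ (n + 1) = 2 ^ n + 2 ^ n := by ring
    have := Nat.mod_lt a (Nat.two_pow_pos (n + 1))
    omega
  have hW : asBank (φ.encode ++ [a]) 0 = n := by simp [encode_eq, asBank]
  have hamp : (shiftCircuit p a φ).absAmplitude (fun _ => false) = (v : ℝ) / 2 ^ (n + 2) := by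
    rw [shiftCircuit_absAmplitude, hv, Nat.cast_natAbs]
    push_cast
    rfl
  rw [hamp] at hA
  refine Spec.det_seq (buildProg_det p a φ) hz fun m ⟨h0, h4⟩ hm => ?_
  refine Spec.call_det (w := Circuit.encode (shiftCircuit p a φ) fun _ => false)
    (good := fun b => MulApprox γ ((v : ℝ) / 2 ^ (n + 2)) ((b 0 : ℝ) / (b 1 : ℝ))) hA h4 hm
    (fun b => (roundProg_det (W := asBank (φ.encode ++ [a])) (v := b) (by simpa using h0) hW
      (by simp)).mono (by unfold roundSteps; omega) fun _ => id) ?_ ?_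
  · rintro b m' ⟨e, he, h, -⟩
    exact ⟨e, he, h⟩
  · rintro b m' hb ⟨e, he, h, h1, h2⟩
    rw [h, Function.update_self]
    exact round_mem_closeTo hγ hγ' hv2 hb h1 h2

/-! ### Loops of randomized code -/

/-- Forgetting what holds with high probability only. -/
theorem Spec.weaken {P : Prog} {m : Mem} {I Q : Mem → Prop} {ε T : ℝ≥0∞} (h : Spec P m I Q ε T) :
    Spec P m I (fun _ => True) 0 T where
  halts := h.halts
  sure := h.sure
  fail q s := by
    refine (h.sure q s _ (fun _ => 0) fun τ _ => (bad_of trivial).le).trans ?_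
    rw [Prog.expect_const_of_halts (h.halts q s)]
  time := h.time

/-- A loop with at most `k` rounds, each of which keeps the property `G` except with probability
`ε`. -/
theorem Spec.loop_count {r z : ℕ} {P : Prog} {ε T : ℝ≥0∞} (J : ℕ → Mem → Prop) (G : Mem → Prop)
    (h0 : ∀ m, J 0 m → m r 0 = 0) (hz : ∀ k m, J k m → SizeLE m z)
    (hexit : ∀ k m, J k m → m r 0 = 0 → J 0 m)
    (hs : ∀ k m, J (k + 1) m → m r 0 ≠ 0 → Spec P m (J k) (fun m' => G m → G m') ε T) :
    ∀ k m, J k m → Spec (.loop r P) m (J 0) (fun m' => G m → G m') (k * ε)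
      (k * ((1 + z : ℕ) + T) + (1 + z : ℕ)) := by
  have halt : ∀ k m, J k m → m r 0 = 0 → Spec (.loop r P) m (J 0) (fun m' => G m → G m') (k * ε)
      (k * ((1 + z : ℕ) + T) + (1 + z : ℕ)) := fun k m hJ hr =>
    ((Spec.loop_false (I := fun m' => m' = m) (Q := fun _ => True) hr (hz k m hJ) rfl
      trivial).mono (fun m' hm' => by rw [hm']; exact hexit k m hJ hr)
      (fun m' hm' _ => by rw [hm']; exact id) zero_le le_add_self)
  intro k
  induction k with
  | zero => exact fun m hJ => halt 0 m hJ (h0 m hJ)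
  | succ k ih =>
    intro m hJ
    by_cases hr : m r 0 = 0
    · exact halt _ m hJ hr
    · refine (Spec.loop_true hr (hz _ m hJ) ((hs k m hJ hr).seq
        (Q' := fun m' => G m → G m') fun m' hm' => (ih m' hm').mono (fun _ => id)
        (fun m'' _ h1 h2 h3 => h1 (h2 h3)) le_rfl le_rfl)).mono (fun _ => id) (fun _ _ => id) ?_ ?_
      · rw [Nat.cast_succ, add_mul, one_mul, add_comm]
      · rw [Nat.cast_succ]
        exact le_of_eq (by ring)

/-- A loop with `k` rounds, each of which at most doubles the quantity `Φ` and increases it with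
probability at most `ε` only. The expected value of `Φ` grows by a factor of at most `1 + ε` per
round; the probability of a large value at the end is bounded by Markov's inequality. -/
theorem Spec.loop_potential {r z : ℕ} {P : Prog} {ε T c : ℝ≥0∞} (J : ℕ → Mem → Prop)
    (Φ : Mem → ℝ≥0∞) {Q' : Mem → Prop} (hc : c ≠ 0) (hc' : c ≠ ⊤)
    (h0 : ∀ m, J 0 m → m r 0 = 0 ∧ (¬ Q' m → c ≤ Φ m)) (hz : ∀ k m, J k m → SizeLE m z)
    (hs : ∀ k m, J (k + 1) m → m r 0 ≠ 0 ∧ ∃ Q, Spec P m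
      (fun m' => J k m' ∧ Φ m' ≤ Φ m * 2 ∧ (Q m' → Φ m' ≤ Φ m)) Q ε T) {k : ℕ} {m : Mem}
    (hJ : J k m) :
    Spec (.loop r P) m (J 0) Q' (Φ m * (1 + ε) ^ k / c) (k * ((1 + z : ℕ) + T) + (1 + z : ℕ)) := by
  have hspec : ∀ k m, J k m → Spec (.loop r P) m (J 0) (fun _ => True) 0
      (k * ((1 + z : ℕ) + T) + (1 + z : ℕ)) := by
    intro k
    induction k with
    | zero =>
      intro m hJ
      exact (Spec.loop_false (h0 m hJ).1 (hz _ m hJ) hJ trivial).mono (fun _ => id)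
        (fun _ _ => id) zero_le (by simp)
    | succ k ih =>
      intro m hJ
      obtain ⟨hr, Q, hQ⟩ := hs k m hJ
      refine (Spec.loop_true hr (hz _ m hJ) (hQ.weaken.seq
        (Q' := fun _ => True) fun m' hm' => (ih m' hm'.1).mono (fun _ => id)
        (fun _ _ _ _ => trivial) le_rfl le_rfl)).mono (fun _ => id) (fun _ _ => id) ?_ ?_
      · simp
      · rw [Nat.cast_succ]
        exact le_of_eq (by ring)
  -- the expected value of `Φ` at the end
  have hexp : ∀ k m, J k m → ∀ q s, (Prog.loop r P).expect (fun τ => Φ τ.mem) ⟨m, q, s⟩ ≤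
      Φ m * (1 + ε) ^ k := by
    intro k
    induction k with
    | zero =>
      intro m hJ q s
      rw [Prog.expect_loop_eq_cond]
      simp [Prog.expect, Config.reg, Config.tick, (h0 m hJ).1]
    | succ k ih =>
      intro m hJ q s
      obtain ⟨hr, Q, hQ⟩ := hs k m hJ
      rw [Prog.expect_loop_eq_cond]
      simp only [Prog.expect, Config.reg, ne_eq, hr, not_false_eq_true, if_true, Config.tick]
      calc _ ≤ P.expect (fun τ => Φ m * (1 + ε) ^ k * (1 + bad Q τ.mem))
              ⟨m, q, s + (1 + (m r 0).size)⟩ := by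
            refine hQ.sure _ _ _ _ fun τ hτ => ?_
            refine (ih τ.mem hτ.1 τ.qubits τ.time).trans ?_
            rw [mul_right_comm]
            gcongr
            by_cases hb : Q τ.mem
            · rw [bad_of hb, add_zero, mul_one]; exact hτ.2.2 hb
            · rw [bad_of_not hb, one_add_one_eq_two]; exact hτ.2.1
        _ = Φ m * (1 + ε) ^ k *
              (1 + P.expect (fun τ => bad Q τ.mem) ⟨m, q, s + (1 + (m r 0).size)⟩) := by
            rw [Prog.expect_const_mul, Prog.expect_add, hQ.halts]
        _ ≤ Φ m * (1 + ε) ^ k * (1 + ε) := by gcongr; exact hQ.fail _ _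
        _ = _ := by rw [mul_assoc, ← pow_succ]
  have h := hspec k m hJ
  refine ⟨h.halts, h.sure, fun q s => ?_, h.time⟩
  rw [ENNReal.le_div_iff_mul_le (Or.inl hc) (Or.inl hc'), mul_comm]
  refine le_trans ?_ (hexp k m hJ q s)
  rw [← Prog.expect_const_mul]
  refine h.sure q s _ _ fun τ hτ => ?_
  by_cases hb : Q' τ.mem
  · rw [bad_of hb, mul_zero]; exact zero_le
  · rw [bad_of_not hb, mul_one]; exact (h0 _ hτ).2 hb

/-! ### Binary search with majority votes -/

/-- One vote: whether the output of `S` is at least the number in register `67`. Register `66`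
counts the votes in favour, register `65` the votes to come. -/
def voteProg (S : Prog) : Prog :=
  .seq (.call 0 S) (blk [.sub 68 67 0, .sub 68 10 68, .add 66 66 68, .add 0 60 26, .sub 65 65 10])

/-- One step of the binary search: the number in register `62` is a lower bound, and register `61`
holds the width of the range. -/
def searchStep (S : Prog) : Prog :=
  .seq (blk [.half 61 61, .add 67 62 61, .add 65 64 64, .const 66 0, .sub 63 63 10])
    (.seq (.loop 65 (voteProg S))
      (.seq (blk [.sub 68 64 66]) (.cond 68 .skip (blk [.add 62 67 26]))))

/-- Binary search for an output of `S`, with `n + 3` steps and `2 * (16 * n + c)` votes per step,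
where `n` is the number in register `0`. Register `63` counts the steps to come. -/
def searchProg (c : ℕ) (S : Prog) : Prog :=
  .seq (.seq (blk [.const 26 0, .const 10 1, .add 60 0 26, .const 61 1, .const 63 3,
      .add 63 63 0, .add 17 63 26, .const 62 0, .add 64 0 0, .add 64 64 64, .add 64 64 64,
      .add 64 64 64, .const 68 c, .add 64 64 68])
      (.loop 17 (blk [.add 61 61 61, .sub 17 17 10])))
    (.seq (.loop 63 (searchStep S)) (blk [.add 0 62 26]))

/-- The memory of the binary search between the votes: the input `W`, which contains `n` and is
restored after each call, some constants, and half the number `r` of votes per step. -/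
structure Search (W : ℕ → ℕ) (n r : ℕ) (m : Mem) : Prop where
  input : m 0 = W
  one : m 10 0 = 1
  zero : m 26 0 = 0
  size : m 60 0 = n
  votes : m 64 0 = r

theorem Search.congr {W : ℕ → ℕ} {n r : ℕ} {m m' : Mem} (h : Search W n r m)
    (e : ∀ b, b = 0 ∨ b = 10 ∨ b = 26 ∨ b = 60 ∨ b = 64 → m' b = m b) : Search W n r m' := by
  obtain ⟨h1, h2, h3, h4, h5⟩ := h
  refine ⟨?_, ?_, ?_, ?_, ?_⟩ <;> rw [e _ (by norm_num)] <;> assumption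

/-- The properties of a procedure whose output, a number with `n + 3` binary digits in cell `0`, is
in `G` except with probability `1/3`. -/
def Samples (S : Prog) (W : ℕ → ℕ) (n : ℕ) (G : Set ℕ) (T : ℝ≥0∞) : Prop :=
  Spec S (frame W) (fun m => ∃ e < 2 ^ (n + 3), m 0 = Function.update W 0 e) (fun m => m 0 0 ∈ G)
    (1 / 3) T

/-- A vote is the comparison of a good output with the number in register `67`, except with
probability `1 / 3`. -/
theorem voteProg_spec {S : Prog} {W : ℕ → ℕ} {n r z t k : ℕ} {G : Set ℕ} {T : ℝ≥0∞}
    (hS : Samples S W n G T) (hW : W 0 = n) {m : Mem} (hm : Search W n r m) (hz : SizeLE m z)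
    (hnz : n + 3 ≤ z) (ht : m 67 0 = t) (hk : m 65 0 = k + 1) :
    Spec (voteProg S) m (fun m' => Search W n r m' ∧ SizeLE m' (z + 5) ∧ m' 65 0 = k ∧
        (m' 66 0 = m 66 0 ∨ m' 66 0 = m 66 0 + 1) ∧
        ∀ b, b = 61 ∨ b = 62 ∨ b = 63 ∨ b = 67 → m' b = m b)
      (fun m' => ∃ e ∈ G, m' 66 0 = m 66 0 + if t ≤ e then 1 else 0) (1 / 3)
      ((1 + T) + stepCost 5 z) := by
  have hcall := Spec.call (m := m) (b := 0) (by rw [hm.input]; exact hS)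
  refine (hcall.seq (P' := blk [.sub 68 67 0, .sub 68 10 68, .add 66 66 68, .add 0 60 26,
    .sub 65 65 10]) (I' := fun m' => Search W n r m' ∧ SizeLE m' (z + 5) ∧ m' 65 0 = k ∧
        (m' 66 0 = m 66 0 ∨ m' 66 0 = m 66 0 + 1) ∧
        ∀ b, b = 61 ∨ b = 62 ∨ b = 63 ∨ b = 67 → m' b = m b)
    (Q' := fun m' => ∃ e ∈ G, m' 66 0 = m 66 0 + if t ≤ e then 1 else 0) (ε' := 0)
    (T' := stepCost 5 z) fun m₁ hm₁ => ?_).mono (fun _ => id) (fun _ _ => id) (by simp) le_rfl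
  obtain ⟨v, ⟨e, he, hv⟩, rfl⟩ := hm₁
  have hz1 : SizeLE (Function.update m 0 (v 0)) z := by
    rw [hv, ← hm.input]
    refine hz.update ?_
    exact (Nat.size_le.2 he).trans hnz
  have hdet : Det (blk [.sub 68 67 0, .sub 68 10 68, .add 66 66 68, .add 0 60 26, .sub 65 65 10])
      (Function.update m 0 (v 0)) 5 fun m' => Search W n r m' ∧ m' 65 0 = k ∧
        m' 66 0 = m 66 0 + (if t ≤ e then 1 else 0) ∧
        ∀ b, b = 61 ∨ b = 62 ∨ b = 63 ∨ b = 67 → m' b = m b := by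
    refine Det.blk ⟨⟨?_, ?_, ?_, ?_, ?_⟩, ?_, ?_, ?_⟩
    · simp [execs, Instr.memExec, upd_of_ne, hv, hm.size, hm.zero, ← hW]
    · simp [execs, Instr.memExec, upd_of_ne, hm.one]
    · simp [execs, Instr.memExec, upd_of_ne, hm.zero]
    · simp [execs, Instr.memExec, upd_of_ne, hm.size]
    · simp [execs, Instr.memExec, upd_of_ne, hm.votes]
    · simp [execs, Instr.memExec, upd_of_ne, hm.one, hk]
    · simp [execs, Instr.memExec, upd_of_ne, hm.one, ht, hv]
      split_ifs <;> omega
    · intro b hb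
      have : b ≠ 0 ∧ b ≠ 68 ∧ b ≠ 66 ∧ b ≠ 65 := by omega
      simp [execs, Instr.memExec, upd_of_ne, this]
  refine (Spec.of_det hdet hz1).mono ?_ ?_ le_rfl le_rfl
  · rintro m' ⟨⟨h1, h2, h3, h4⟩, h5⟩
    refine ⟨h1, h5, h2, ?_, h4⟩
    rw [h3]
    split_ifs <;> simp
  · rintro m' ⟨⟨h1, h2, h3, h4⟩, h5⟩ _ ⟨v', -, hG, hv'⟩
    refine ⟨e, ?_, h3⟩
    have := congrFun (congrFun hv' 0) 0
    simp only [Function.update_self] at this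
    rw [← this, hv, Function.update_self] at hG
    exact hG

/-- The time of a vote. -/
def voteTime (z : ℕ) (T : ℝ≥0∞) : ℝ≥0∞ := (1 + T) + stepCost 5 z

/-- If all good outputs are on the same side of the number in register `67`, the majority of the
votes is correct, except with an exponentially small probability: the expectation of two to the
number of wrong votes is at most `(4/3) ^ (2 * r)`, while it has to be `2 ^ r` at least for the
majority to be wrong. -/
theorem votes_spec {S : Prog} {W : ℕ → ℕ} {n r z t Z : ℕ} {G : Set ℕ} {T : ℝ≥0∞}
    (hS : Samples S W n G T) (hW : W 0 = n) (hG : G.Nonempty) {m : Mem} (hm : Search W n r m)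
    (hz : SizeLE m z) (hnz : n + 3 ≤ z) (hZ : z + 5 * (2 * r) ≤ Z) (ht : m 67 0 = t)
    (hk : m 65 0 = 2 * r) (h66 : m 66 0 = 0) :
    Spec (.loop 65 (voteProg S)) m
      (fun m' => Search W n r m' ∧ SizeLE m' Z ∧
        ∀ b, b = 61 ∨ b = 62 ∨ b = 63 ∨ b = 67 → m' b = m b)
      (fun m' => (r ≤ m' 66 0 → ∃ g ∈ G, t ≤ g) ∧ (m' 66 0 < r → ∃ g ∈ G, g < t))
      ((8 / 9) ^ r) ((2 * r : ℕ) * ((1 + Z : ℕ) + voteTime Z T) + (1 + Z : ℕ)) := by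
  set J : ℕ → Mem → Prop := fun k m' => Search W n r m' ∧
    (∃ y, SizeLE m' y ∧ n + 3 ≤ y ∧ y + 5 * k ≤ Z) ∧ m' 65 0 = k ∧ m' 66 0 + k ≤ 2 * r ∧
    ∀ b, b = 61 ∨ b = 62 ∨ b = 63 ∨ b = 67 → m' b = m b with hJ
  have hstart : J (2 * r) m := ⟨hm, ⟨z, hz, hnz, hZ⟩, hk, by omega, fun _ _ => rfl⟩
  have hJz : ∀ k m, J k m → SizeLE m Z := by
    rintro k m ⟨-, ⟨y, hy, -, hyZ⟩, -⟩
    exact hy.mono (by omega)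
  have hI : ∀ m', J 0 m' → Search W n r m' ∧ SizeLE m' Z ∧
      ∀ b, b = 61 ∨ b = 62 ∨ b = 63 ∨ b = 67 → m' b = m b :=
    fun m' h => ⟨h.1, hJz _ _ h, h.2.2.2.2⟩
  have hstep : ∀ k m', J (k + 1) m' → m' 65 0 ≠ 0 ∧
      Spec (voteProg S) m' (fun m'' => J k m'' ∧ (m'' 66 0 = m' 66 0 ∨ m'' 66 0 = m' 66 0 + 1))
      (fun m'' => ∃ e ∈ G, m'' 66 0 = m' 66 0 + if t ≤ e then 1 else 0) (1 / 3) (voteTime Z T) := by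
    rintro k m' ⟨h1, ⟨y, hy, hny, hyZ⟩, h3, h4, h5⟩
    refine ⟨by omega, (voteProg_spec hS hW h1 hy hny (by rw [h5 67 (by simp), ht]) h3).mono ?_
      (fun _ _ => id) le_rfl ?_⟩
    · rintro m'' ⟨g1, g2, g3, g4, g5⟩
      exact ⟨⟨g1, ⟨_, g2, by omega, by omega⟩, g3, by omega,
        fun b hb => by rw [g5 b hb, h5 b hb]⟩, g4⟩
    · unfold voteTime
      gcongr
      exact stepCost_mono le_rfl (by omega)
  -- the bound of Markov's inequality
  have hε : (1 : ℝ≥0∞) * (1 + 1 / 3) ^ (2 * r) / 2 ^ r = (8 / 9) ^ r := by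
    have h1 : (1 : ℝ≥0∞) + 1 / 3 = 4 / 3 := by
      rw [← ENNReal.toReal_eq_toReal_iff' (by finiteness) (by finiteness)]
      norm_num [ENNReal.toReal_add]
    have h2 : ((4 / 3 : ℝ≥0∞)) ^ 2 / 2 = 8 / 9 := by
      rw [← ENNReal.toReal_eq_toReal_iff' (by finiteness) (by finiteness)]
      norm_num
    rw [one_mul, h1, pow_mul, ← h2, div_eq_mul_inv, div_eq_mul_inv _ (2 : ℝ≥0∞), mul_pow,
      ENNReal.inv_pow]
  by_cases hA : ∀ g ∈ G, t ≤ g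
  · -- all the good votes are in favour
    set Φ : Mem → ℝ≥0∞ := fun m' => 2 ^ (2 * r - m' 65 0 - m' 66 0) with hΦ
    have := Spec.loop_potential (c := 2 ^ r) (ε := 1 / 3) (T := voteTime Z T) (P := voteProg S)
      (r := 65) (z := Z) J Φ
      (Q' := fun m' => (r ≤ m' 66 0 → ∃ g ∈ G, t ≤ g) ∧ (m' 66 0 < r → ∃ g ∈ G, g < t))
      (by positivity) (by finiteness) ?_ hJz ?_ hstart
    · refine this.mono hI (fun _ _ => id) ?_ le_rfl
      have h1 : Φ m = 1 := by simp only [hΦ, hk, h66]; simp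
      rw [h1, hε]
    · rintro m' ⟨-, -, h3, -⟩
      refine ⟨h3, fun hn => ?_⟩
      have hlt : m' 66 0 < r := by
        by_contra hle
        obtain ⟨g, hg⟩ := hG
        exact hn ⟨fun _ => ⟨g, hg, hA g hg⟩, fun h => absurd h hle⟩
      exact pow_le_pow_right₀ (by norm_num) (by omega)
    · intro k m' hm'
      obtain ⟨h1, h2⟩ := hstep k m' hm'
      refine ⟨h1, _, h2.mono (fun m'' ⟨g1, g2⟩ => ⟨g1, ?_, ?_⟩) (fun _ _ => id) le_rfl le_rfl⟩
      · have a1 := g1.2.2.1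
        have a2 := hm'.2.2.1
        rw [← pow_succ]
        exact pow_le_pow_right₀ (by norm_num) (by omega)
      · rintro ⟨e, he, h⟩
        rw [if_pos (hA e he)] at h
        have a1 := g1.2.2.1
        have a2 := hm'.2.2.1
        exact pow_le_pow_right₀ (by norm_num) (by omega)
  · by_cases hB : ∀ g ∈ G, g < t
    · -- all the good votes are against
      set Φ : Mem → ℝ≥0∞ := fun m' => 2 ^ (m' 66 0) with hΦ
      have := Spec.loop_potential (c := 2 ^ r) (ε := 1 / 3) (T := voteTime Z T) (P := voteProg S)
        (r := 65) (z := Z) J Φ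
        (Q' := fun m' => (r ≤ m' 66 0 → ∃ g ∈ G, t ≤ g) ∧ (m' 66 0 < r → ∃ g ∈ G, g < t))
        (by positivity) (by finiteness) ?_ hJz ?_ hstart
      · refine this.mono hI (fun _ _ => id) ?_ le_rfl
        have h1 : Φ m = 1 := by simp only [hΦ, h66]; simp
        rw [h1, hε]
      · rintro m' ⟨-, -, h3, -⟩
        refine ⟨h3, fun hn => ?_⟩
        have hlt : r ≤ m' 66 0 := by
          by_contra hle
          obtain ⟨g, hg⟩ := hG
          exact hn ⟨fun h => absurd h hle, fun _ => ⟨g, hg, hB g hg⟩⟩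
        exact pow_le_pow_right₀ (by norm_num) hlt
      · intro k m' hm'
        obtain ⟨h1, h2⟩ := hstep k m' hm'
        refine ⟨h1, _, h2.mono (fun m'' ⟨g1, g2⟩ => ⟨g1, ?_, ?_⟩) (fun _ _ => id) le_rfl le_rfl⟩
        · rw [← pow_succ]
          exact pow_le_pow_right₀ (by norm_num) (by omega)
        · rintro ⟨e, he, h⟩
          rw [if_neg (by have := hB e he; omega)] at h
          exact pow_le_pow_right₀ (by norm_num) (by omega)
    · -- both outcomes are correct
      push Not at hA hB
      have := Spec.loop_count (ε := 0) (T := voteTime Z T) (P := voteProg S)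
        (r := 65) (z := Z) J (fun _ => True) (fun m' h => h.2.2.1) hJz ?_ ?_ (2 * r) m hstart
      · exact this.mono hI (fun _ _ _ => ⟨fun _ => hB, fun _ => hA⟩) (by simp) le_rfl
      · intro k m' h hr
        have : k = 0 := by rw [← h.2.2.1, hr]
        rwa [this] at h
      · intro k m' hm' _
        exact (hstep k m' hm').2.weaken.mono (fun _ h => h.1) (fun _ _ _ _ => trivial) le_rfl le_rfl

/-- The time of a step of the binary search. -/
def stepTime (r z : ℕ) (T : ℝ≥0∞) : ℝ≥0∞ :=
  stepCost 5 z + (((2 * r : ℕ) * ((1 + z : ℕ) + voteTime z T) + (1 + z : ℕ)) + stepCost 3 z)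

/-- The range of the binary search contains good outputs or is surrounded by them. -/
def Brackets (G : Set ℕ) (m : Mem) : Prop :=
  (∃ g ∈ G, m 62 0 ≤ g) ∧ ∃ g ∈ G, g < m 62 0 + m 61 0

/-- A step halves the range. If the range was bracketed by good outputs and the majority is not
wrong, then the half that is chosen is bracketed by good outputs, too. -/
theorem searchStep_spec {S : Prog} {W : ℕ → ℕ} {n r z Z k : ℕ} {G : Set ℕ} {T : ℝ≥0∞}
    (hS : Samples S W n G T) (hW : W 0 = n) (hG : G.Nonempty) {m : Mem} (hm : Search W n r m)
    (hz : SizeLE m z) (hnz : n + 3 ≤ z) (hZ : z + (10 * r + 8) ≤ Z) (h61 : m 61 0 = 2 ^ (k + 1))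
    (h63 : m 63 0 = k + 1) (h62 : m 62 0 + 2 ^ (k + 1) ≤ 2 ^ (n + 3)) :
    Spec (searchStep S) m
      (fun m' => Search W n r m' ∧ SizeLE m' (z + (10 * r + 8)) ∧ m' 61 0 = 2 ^ k ∧ m' 63 0 = k ∧
        m' 62 0 + 2 ^ k ≤ 2 ^ (n + 3))
      (fun m' => Brackets G m → Brackets G m') ((8 / 9) ^ r) (stepTime r Z T) := by
  have hdet : Det (blk [.half 61 61, .add 67 62 61, .add 65 64 64, .const 66 0, .sub 63 63 10]) m 5
      fun m' => Search W n r m' ∧ m' 61 0 = 2 ^ k ∧ m' 63 0 = k ∧ m' 62 0 = m 62 0 ∧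
        m' 67 0 = m 62 0 + 2 ^ k ∧ m' 65 0 = 2 * r ∧ m' 66 0 = 0 := by
    have hh : 2 ^ (k + 1) / 2 = 2 ^ k := by rw [pow_succ, Nat.mul_div_cancel _ (by norm_num)]
    have k0 : Nat.size 0 ≤ 0 := size_le_self 0
    refine Det.block_le ⟨hm.congr fun b hb => ?_, ?_, ?_, ?_, ?_, ?_, ?_⟩
      (by simp only [blkSteps, Instr.steps]; omega)
    · have : b ≠ 61 ∧ b ≠ 67 ∧ b ≠ 65 ∧ b ≠ 66 ∧ b ≠ 63 := by omega
      simp [execs, Instr.memExec, upd_of_ne, this]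
    · simp [execs, Instr.memExec, upd_of_ne, h61, hh]
    · simp [execs, Instr.memExec, upd_of_ne, h63, hm.one]
    · simp [execs, Instr.memExec, upd_of_ne]
    · simp [execs, Instr.memExec, upd_of_ne, h61, hh]
    · simp [execs, Instr.memExec, upd_of_ne, hm.votes]; omega
    · simp [execs, Instr.memExec, upd_of_ne]
  have hp : 2 ^ (k + 1) = 2 ^ k + 2 ^ k := by ring
  refine (Spec.det_seq (I := fun m' => Search W n r m' ∧ SizeLE m' (z + (10 * r + 8)) ∧
      m' 61 0 = 2 ^ k ∧ m' 63 0 = k ∧ m' 62 0 + 2 ^ k ≤ 2 ^ (n + 3))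
      (Q := fun m' => Brackets G m → Brackets G m') (ε := (8 / 9) ^ r)
      (T := ((2 * r : ℕ) * ((1 + Z : ℕ) + voteTime Z T) + (1 + Z : ℕ)) + stepCost 3 Z)
      hdet hz ?_).mono (fun _ => id) (fun _ _ => id) le_rfl ?_
  swap
  · unfold stepTime
    gcongr
    exact stepCost_mono le_rfl (by omega)
  rintro m₁ ⟨s1, g61, g63, g62, g67, g65, g66⟩ hz1
  refine ((votes_spec (Z := z + 5 + 5 * (2 * r)) hS hW hG s1 hz1 (by omega) le_rfl g67 g65
    g66).seq (I' := fun m' => Search W n r m' ∧ SizeLE m' (z + (10 * r + 8)) ∧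
      m' 61 0 = 2 ^ k ∧ m' 63 0 = k ∧ m' 62 0 + 2 ^ k ≤ 2 ^ (n + 3))
    (Q' := fun m' => Brackets G m → Brackets G m') (ε' := 0) (T' := stepCost 3 Z) ?_).mono
    (fun _ => id) (fun _ _ => id) (by simp) ?_
  swap
  · gcongr
    · omega
    · unfold voteTime
      gcongr
      exact stepCost_mono le_rfl (by omega)
    · omega
  rintro m₂ ⟨s2, hz2, e2⟩
  have f61 : m₂ 61 0 = 2 ^ k := by rw [e2 61 (by simp), g61]
  have f62 : m₂ 62 0 = m 62 0 := by rw [e2 62 (by simp), g62]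
  have f63 : m₂ 63 0 = k := by rw [e2 63 (by simp), g63]
  have f67 : m₂ 67 0 = m 62 0 + 2 ^ k := by rw [e2 67 (by simp), g67]
  have hdet2 : Det (.seq (blk [.sub 68 64 66]) (.cond 68 .skip (blk [.add 62 67 26]))) m₂ 3
      fun m' => Search W n r m' ∧ m' 61 0 = 2 ^ k ∧ m' 63 0 = k ∧
        m' 62 0 = if r ≤ m₂ 66 0 then m 62 0 + 2 ^ k else m 62 0 := by
    refine Det.seq (k := 1) (k' := 2) (Det.blk ?_)
    set m₃ := execs [.sub 68 64 66] m₂ with hm₃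
    have e3 : ∀ b, b ≠ 68 → m₃ b = m₂ b := fun b hb => by
      simp [hm₃, execs, Instr.memExec, upd_of_ne, hb]
    have v68 : m₃ 68 0 = r - m₂ 66 0 := by simp [hm₃, execs, Instr.memExec, s2.votes]
    have s3 : Search W n r m₃ := s2.congr fun b hb => e3 b (by omega)
    rw [← e3 _ (by norm_num)] at f61 f62 f63 f67
    clear_value m₃
    by_cases hr : r ≤ m₂ 66 0
    · refine Det.cond_false (by omega) (Det.blk ⟨s3.congr fun b hb => ?_, ?_, ?_, ?_⟩)
      · have : b ≠ 62 := by omega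
        simp [execs, Instr.memExec, upd_of_ne, this]
      · simp [execs, Instr.memExec, upd_of_ne, f61]
      · simp [execs, Instr.memExec, upd_of_ne, f63]
      · simp [execs, Instr.memExec, f67, s3.zero, hr]
    · exact Det.mono (k := 1 + 0) (Det.cond_true (by omega) (Det.skip ⟨s3, f61, f63,
        by rw [if_neg hr, f62]⟩)) (by norm_num) fun _ => id
  refine (Spec.of_det hdet2 hz2).mono ?_ ?_ le_rfl ?_
  · rintro m' ⟨⟨h1, h2, h3, h4⟩, h5⟩
    refine ⟨h1, h5.mono (by omega), h2, h3, ?_⟩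
    rw [h4]
    split_ifs <;> omega
  · rintro m' ⟨⟨h1, h2, h3, h4⟩, h5⟩ - ⟨q1, q2⟩ ⟨b1, b2⟩
    unfold Brackets
    rw [h61] at b2
    rw [h2, h4]
    by_cases hr : r ≤ m₂ 66 0
    · rw [if_pos hr, Nat.add_assoc, ← hp]
      exact ⟨q1 hr, b2⟩
    · rw [if_neg hr]
      exact ⟨b1, q2 (by omega)⟩
  · exact_mod_cast stepCost_mono le_rfl (by omega)

/-- The unit steps before the binary search. -/
def searchInit (n c : ℕ) : ℕ := 20 + c + ((n + 3) * 3 + 1)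

/-- A bound on the length of the numbers during the binary search. -/
def searchWidth (n c z : ℕ) : ℕ :=
  z + searchInit n c + (10 * (16 * n + c) + 8) * (n + 3)

/-- The time of the binary search. -/
def searchTime (n c z : ℕ) (T : ℝ≥0∞) : ℝ≥0∞ :=
  stepCost (searchInit n c) z + (((n + 3 : ℕ) * ((1 + searchWidth n c z : ℕ) +
    stepTime (16 * n + c) (searchWidth n c z) T) + (1 + searchWidth n c z : ℕ)) +
    stepCost 1 (searchWidth n c z))

/-- When the range has shrunk to a single number, there are good outputs on both sides of it, and
since the good outputs form an interval, that number is good itself. -/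
theorem searchProg_spec {S : Prog} {W : ℕ → ℕ} {n c z : ℕ} {G : Set ℕ} {T : ℝ≥0∞}
    (hS : Samples S W n G T) (hW : W 0 = n) (hG : G.OrdConnected) (hG' : ∃ g ∈ G, g < 2 ^ (n + 3))
    (hz : SizeLE (frame W) z) :
    Spec (searchProg c S) (frame W) (fun m => ∃ e < 2 ^ (n + 3), m 0 = Function.update W 0 e)
      (fun m => m 0 0 ∈ G) ((n + 3 : ℕ) * (8 / 9) ^ (16 * n + c)) (searchTime n c z T) := by
  set r := 16 * n + c with hr
  have hGne : G.Nonempty := ⟨_, hG'.choose_spec.1⟩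
  have k0 : Nat.size 0 ≤ 0 := size_le_self 0
  have k1 : Nat.size 1 ≤ 1 := size_le_self 1
  have k3 : Nat.size 3 ≤ 3 := size_le_self 3
  have kc : Nat.size c ≤ c := size_le_self c
  have hinit : Det (.seq (blk [.const 26 0, .const 10 1, .add 60 0 26, .const 61 1, .const 63 3,
      .add 63 63 0, .add 17 63 26, .const 62 0, .add 64 0 0, .add 64 64 64, .add 64 64 64,
      .add 64 64 64, .const 68 c, .add 64 64 68])
      (.loop 17 (blk [.add 61 61 61, .sub 17 17 10]))) (frame W) (20 + c + ((n + 3) * 3 + 1))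
      fun m => Search W n r m ∧ m 61 0 = 2 ^ (n + 3) ∧ m 63 0 = n + 3 ∧ m 62 0 = 0 := by
    refine Det.seq (Det.block_le ?_ (by simp only [blkSteps, Instr.steps]; omega))
    set m₁ := execs [.const 26 0, .const 10 1, .add 60 0 26, .const 61 1, .const 63 3,
      .add 63 63 0, .add 17 63 26, .const 62 0, .add 64 0 0, .add 64 64 64, .add 64 64 64,
      .add 64 64 64, .const 68 c, .add 64 64 68] (frame W) with hm₁
    have s1 : Search W n r m₁ := by
      constructor <;> simp [hm₁, execs, Instr.memExec, upd_of_ne, frame, hW, hr]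
      omega
    have v61 : m₁ 61 0 = 1 := by simp [hm₁, execs, Instr.memExec, upd_of_ne]
    have v63 : m₁ 63 0 = n + 3 := by
      simp [hm₁, execs, Instr.memExec, upd_of_ne, frame, hW]
      omega
    have v17 : m₁ 17 0 = n + 3 := by
      simp [hm₁, execs, Instr.memExec, upd_of_ne, frame, hW]
      omega
    have v62 : m₁ 62 0 = 0 := by simp [hm₁, execs, Instr.memExec, upd_of_ne]
    clear_value m₁
    refine Det.loop_count (fun j m' => ∃ i, i + j = n + 3 ∧ m' 17 0 = j ∧ m' 61 0 = 2 ^ i ∧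
      ∀ b, b ≠ 17 → b ≠ 61 → m' b = m₁ b) 2 ?_ ?_ ⟨0, by omega, v17, v61, fun _ _ _ => rfl⟩
    · rintro m' ⟨i, hi, h1, h2, h3⟩
      rw [Nat.add_zero] at hi
      subst hi
      refine ⟨h1, s1.congr fun b hb => h3 b (by omega) (by omega), h2, ?_, ?_⟩
      · rw [h3, v63] <;> norm_num
      · rw [h3, v62] <;> norm_num
    · rintro j m' ⟨i, hi, h1, h2, h3⟩
      have v10 : m' 10 0 = 1 := by rw [h3 10 (by norm_num) (by norm_num), s1.one]
      refine ⟨by omega, Det.blk ⟨i + 1, by omega, ?_, ?_, ?_⟩⟩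
      · simp [execs, Instr.memExec, upd_of_ne, h1, v10]
      · simp [execs, Instr.memExec, upd_of_ne, h2]; ring
      · intro b b1 b2
        simp [execs, Instr.memExec, upd_of_ne, h3, b1, b2]
  set Z := searchWidth n c z with hZ
  refine Spec.det_seq hinit hz fun m ⟨s1, h61, h63, h62⟩ hz1 => ?_
  set J : ℕ → Mem → Prop := fun k m' => Search W n r m' ∧
    (∃ y, SizeLE m' y ∧ n + 3 ≤ y ∧ y + (10 * r + 8) * k ≤ Z) ∧ m' 61 0 = 2 ^ k ∧ m' 63 0 = k ∧
    m' 62 0 + 2 ^ k ≤ 2 ^ (n + 3) with hJ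
  have hstart : J (n + 3) m :=
    ⟨s1, ⟨_, hz1, by unfold searchInit; omega, le_rfl⟩, h61, h63, by rw [h62]; omega⟩
  have hJz : ∀ k m, J k m → SizeLE m Z := by
    rintro k m ⟨-, ⟨y, hy, -, hyZ⟩, -⟩
    exact hy.mono (by omega)
  have hloop := Spec.loop_count (ε := (8 / 9) ^ r) (T := stepTime r Z T) (P := searchStep S)
    (r := 63) (z := Z) J (Brackets G) (fun m' h => h.2.2.2.1) hJz ?_ ?_ (n + 3) m hstart
  · refine (hloop.seq (I' := fun m => ∃ e < 2 ^ (n + 3), m 0 = Function.update W 0 e)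
      (Q' := fun m => m 0 0 ∈ G) (ε' := 0) (T' := stepCost 1 Z) ?_).mono (fun _ => id)
      (fun _ _ => id) (by simp) le_rfl
    intro m' hm'
    have hz' := hJz _ _ hm'
    obtain ⟨s', -, h61', -, h62'⟩ := hm'
    have hdet : Det (blk [.add 0 62 26]) m' 1 fun m'' =>
        m'' 0 = Function.update W 0 (m' 62 0) :=
      Det.blk (by simp [execs, Instr.memExec, s'.zero, s'.input])
    rw [pow_zero] at h61' h62'
    refine (Spec.of_det hdet hz').mono (fun m'' h => ⟨m' 62 0, by omega, h.1⟩) ?_ le_rfl le_rfl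
    rintro m'' ⟨h, -⟩ - hbr
    obtain ⟨⟨g, hg, hg1⟩, g', hg', hg2⟩ := hbr ⟨by
      obtain ⟨g, hg⟩ := hGne
      exact ⟨g, hg, by omega⟩, by rw [h61, h62, Nat.zero_add]; exact hG'⟩
    rw [h, Function.update_self]
    exact hG.out hg' hg ⟨by omega, hg1⟩
  · rintro k m' h hr0
    have : k = 0 := by rw [← h.2.2.2.1, hr0]
    rwa [this] at h
  · rintro k m' ⟨h1, ⟨y, hy, hny, hyZ⟩, h3, h4, h5⟩ -
    refine (searchStep_spec (Z := Z) hS hW hGne h1 hy hny (by rw [Nat.mul_succ] at hyZ; omega)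
      h3 h4 h5).mono ?_ (fun _ _ => id) le_rfl le_rfl
    rintro m'' ⟨g1, g2, g3, g4, g5⟩
    exact ⟨g1, ⟨_, g2, by omega, by rw [Nat.mul_succ] at hyZ; omega⟩, g3, g4, g5⟩

/-! ### Counting by successive approximation -/

/-- The step from the number `a` to the next one, after the distance of `a` to the number of
satisfying assignments has been estimated as `e`: a step of length one, or about half the distance.
-/
def advance (b : Bool) (e : ℕ) : ℕ := if b then (e + 1) / 2 else 1

/-- Add `advance b e` to register `71`, where `e` is in register `74`. -/
def advanceBlk : Bool → List Instr
  | true => [.add 77 74 10, .half 77 77, .add 71 71 77]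
  | false => [.add 71 71 10]

/-- The number of steps: `3 * n + β` or `β`. -/
def fuel (b : Bool) (n β : ℕ) : ℕ := if b then 3 * n + β else β

/-- The register that holds `n` or zero. -/
def fuelReg (b : Bool) : ℕ := if b then 73 else 26

/-- Find the length of the input, and put it into register `70`. -/
def scanLoop : Prog :=
  .loop 76 (blk [.load 77 0 70, .add 70 70 77, .add 70 70 10, .sub 76 76 10])

/-- One step of the approximation: append the number in register `71` to the input, estimate its
distance to the number of satisfying assignments in register `74`, and either finish or proceed to
the next number. Register `72` counts the steps to come, and register `75` tells whether to go on.
-/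
def approachStep (b : Bool) (B : Prog) : Prog :=
  .seq (blk [.store 0 70 71, .sub 72 72 10]) (.seq (.call 0 B)
    (.seq (blk [.add 74 0 26, .add 0 73 26])
      (.cond 74 (.cond 72 (blk (advanceBlk b)) (blk [.const 75 0])) (blk [.const 75 0]))))

/-- Approach the number of satisfying assignments from below, with the help of a procedure `B` that
estimates the distance to it, until the estimate is zero or the admitted number of steps has been
made. The output is the number reached plus the last estimate. -/
def countProg (b : Bool) (β : ℕ) (B : Prog) : Prog :=
  .seq (.seq (blk [.const 10 1, .const 26 0, .add 73 0 26, .load 76 0 10, .const 70 2, .const 71 0,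
      .const 75 1, .const 72 β, .add 72 72 (fuelReg b), .add 72 72 (fuelReg b),
      .add 72 72 (fuelReg b)]) scanLoop)
    (.seq (.loop 75 (approachStep b B)) (blk [.add 0 71 74]))

/-- The clauses in `d` have been passed, those in `r` remain. -/
theorem scanLoop_det {n : ℕ} {l₁ : List ℕ} (r : CNF n) : ∀ (d : CNF n) (m : Mem),
    m 0 = asBank (l₁ ++ body (d ++ r)) → m 10 0 = 1 → m 70 0 = (l₁ ++ body d).length →
    m 76 0 = r.length →
    Det scanLoop m (r.length * 5 + 1) fun m' => m' 70 0 = (l₁ ++ body (d ++ r)).length ∧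
      ∀ b, b ≠ 70 → b ≠ 76 → b ≠ 77 → m' b = m b := by
  induction r with
  | nil =>
    intro d m h0 h10 h70 h76
    have : Det scanLoop m 1 (fun m' => m' 70 0 = (l₁ ++ body (d ++ [])).length ∧
      ∀ b, b ≠ 70 → b ≠ 76 → b ≠ 77 → m' b = m b) :=
      Det.loop_false h76 ⟨by simpa using h70, fun _ _ _ _ => rfl⟩
    simpa using this
  | cons cl r ih =>
    intro d m h0 h10 h70 h76
    refine (Det.loop_true (k := 4) (by rw [h76]; simp) ?_).mono
      (k := 1 + (4 + (r.length * 5 + 1))) (by simp; omega) fun _ => id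
    have hb : body (d ++ cl :: r) = body d ++ (cl.length :: (cl.map litCode ++ body r)) := by
      simp [body]
    have hx : m 0 (m 70 0) = cl.length := by
      rw [h0, h70, hb]
      have := asBank_append_cons (l₁ ++ body d) (cl.map litCode ++ body r) cl.length
      simpa using this
    refine Det.blk ?_
    set m₁ := execs [.load 77 0 70, .add 70 70 77, .add 70 70 10, .sub 76 76 10] m with hm₁
    have e1 : ∀ b, b ≠ 70 → b ≠ 76 → b ≠ 77 → m₁ b = m b := fun b b1 b2 b3 => by
      simp [hm₁, execs, Instr.memExec, upd_of_ne, b1, b2, b3]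
    have eq : d ++ cl :: r = (d ++ [cl]) ++ r := by simp
    rw [eq] at h0 ⊢
    refine (ih (d ++ [cl]) m₁ ?_ ?_ ?_ ?_).imp fun m' ⟨r1, r2⟩ => ⟨r1, fun b b1 b2 b3 => ?_⟩
    · rw [e1, h0] <;> norm_num
    · rw [e1, h10] <;> norm_num
    · have : m₁ 70 0 = m 70 0 + m 0 (m 70 0) + 1 := by
        simp [hm₁, execs, Instr.memExec, upd_of_ne, h10]
      rw [this, hx, h70]
      simp [body]
      omega
    · simp [hm₁, execs, Instr.memExec, upd_of_ne, h76, h10]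
    · rw [r2 b b1 b2 b3, e1 b b1 b2 b3]

/-- The memory between the steps of the approximation. The cell behind the formula in the input
holds some number `x`, which is overwritten before each call. -/
structure Approach {n : ℕ} (φ : CNF n) (m : Mem) : Prop where
  input : ∃ x, m 0 = asBank (φ.encode ++ [x])
  one : m 10 0 = 1
  zero : m 26 0 = 0
  pos : m 70 0 = φ.encode.length
  vars : m 73 0 = n

theorem Approach.congr {n : ℕ} {φ : CNF n} {m m' : Mem} (h : Approach φ m)
    (e : ∀ b, b = 0 ∨ b = 10 ∨ b = 26 ∨ b = 70 ∨ b = 73 → m' b = m b) : Approach φ m' := by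
  obtain ⟨h1, h2, h3, h4, h5⟩ := h
  refine ⟨?_, ?_, ?_, ?_, ?_⟩ <;> rw [e _ (by norm_num)] <;> assumption

theorem update_asBank_last (l : List ℕ) (x v : ℕ) :
    Function.update (asBank (l ++ [x])) l.length v = asBank (l ++ [v]) := by
  rw [← update_asBank, Function.update_idem, update_asBank]

/-- What the approximation is required to satisfy, if `G a` is the set of good estimates for the
number `a`: `Sure k a` holds surely for the number `a` reached with `k` steps to go, and so does
`Inv k a` if all the estimates are good; then the last one leads to an output satisfying `Out`. The
first is needed for bounds on the running time that do not depend on luck. -/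
structure Plan (b : Bool) (n : ℕ) (G : ℕ → Set ℕ) (Sure Inv : ℕ → ℕ → Prop) (Out : ℕ → Prop) :
    Prop where
  sure : ∀ k a e, Sure (k + 2) a → e < 2 ^ (n + 3) → Sure (k + 1) (a + advance b e)
  halt : ∀ k a e, Sure (k + 1) a → Inv (k + 1) a → e ∈ G a → e = 0 ∨ k = 0 → Out (a + e)
  go : ∀ k a e, Sure (k + 1) a → Inv (k + 1) a → e ∈ G a → e ≠ 0 → k ≠ 0 →
    Inv k (a + advance b e)

/-- The time of a step of the approximation. -/
def approachTime (z : ℕ) (T : ℝ≥0∞) : ℝ≥0∞ := stepCost 2 z + ((1 + T) + stepCost 7 z)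

/-- `B` is required to estimate distances only for numbers that can be reached. -/
theorem approachStep_spec {b : Bool} {B : Prog} {n z Z k : ℕ} {φ : CNF n} {G : ℕ → Set ℕ}
    {Sure Inv : ℕ → ℕ → Prop} {Out : ℕ → Prop} {ε T : ℝ≥0∞} (hP : Plan b n G Sure Inv Out)
    (hB : ∀ k a, Sure (k + 1) a → Spec B (frame (asBank (φ.encode ++ [a])))
      (fun m => ∃ e < 2 ^ (n + 3), m 0 = Function.update (asBank (φ.encode ++ [a])) 0 e)
      (fun m => m 0 0 ∈ G a) ε T) {m : Mem} (hm : Approach φ m) (hz : SizeLE m z)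
    (hnz : n + 3 ≤ z) (hZ : z + 9 ≤ Z) (h75 : m 75 0 = 1) (h72 : m 72 0 = k + 1)
    (hs : Sure (k + 1) (m 71 0)) :
    Spec (approachStep b B) m
      (fun m' => Approach φ m' ∧ SizeLE m' (z + 9) ∧
        (m' 75 0 = 0 ∨ m' 75 0 = 1 ∧ m' 72 0 = k ∧ 1 ≤ k ∧ Sure k (m' 71 0)))
      (fun m' => Inv (k + 1) (m 71 0) →
        (m' 75 0 = 0 → Out (m' 71 0 + m' 74 0)) ∧ (m' 75 0 = 1 → Inv k (m' 71 0)))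
      ε (approachTime Z T) := by
  obtain ⟨x, hx⟩ := hm.input
  set a := m 71 0 with ha
  have hdet : Det (blk [.store 0 70 71, .sub 72 72 10]) m 2 fun m' =>
      m' 0 = asBank (φ.encode ++ [a]) ∧ m' 72 0 = k ∧
      ∀ b, b ≠ 0 → b ≠ 72 → m' b = m b := by
    refine Det.blk ⟨?_, ?_, fun b b1 b2 => ?_⟩
    · simp [execs, Instr.memExec, upd_of_ne, hm.pos, hx, update_asBank_last, ← ha]
    · simp [execs, Instr.memExec, upd_of_ne, hm.one, h72]
    · simp [execs, Instr.memExec, upd_of_ne, b1, b2]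
  refine (Spec.det_seq (I := fun m' => Approach φ m' ∧ SizeLE m' (z + 9) ∧
        (m' 75 0 = 0 ∨ m' 75 0 = 1 ∧ m' 72 0 = k ∧ 1 ≤ k ∧ Sure k (m' 71 0)))
      (Q := fun m' => Inv (k + 1) a →
        (m' 75 0 = 0 → Out (m' 71 0 + m' 74 0)) ∧ (m' 75 0 = 1 → Inv k (m' 71 0)))
      (ε := ε) (T := (1 + T) + stepCost 7 Z) hdet hz ?_).mono (fun _ => id) (fun _ _ => id) le_rfl
      (by unfold approachTime; gcongr; exact stepCost_mono le_rfl (by omega))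
  rintro m₁ ⟨g0, g72, g⟩ hz1
  have hcall := Spec.call (m := m₁) (b := 0) (by rw [g0]; exact hB k a hs)
  refine (hcall.seq (I' := fun m' => Approach φ m' ∧ SizeLE m' (z + 9) ∧
        (m' 75 0 = 0 ∨ m' 75 0 = 1 ∧ m' 72 0 = k ∧ 1 ≤ k ∧ Sure k (m' 71 0)))
      (Q' := fun m' => Inv (k + 1) a →
        (m' 75 0 = 0 → Out (m' 71 0 + m' 74 0)) ∧ (m' 75 0 = 1 → Inv k (m' 71 0)))
      (ε' := 0) (T' := stepCost 7 Z) ?_).mono (fun _ => id) (fun _ _ => id) (by simp) le_rfl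
  rintro m₂ ⟨v, ⟨e, he, hv⟩, rfl⟩
  have hz2 : SizeLE (Function.update m₁ 0 (v 0)) (z + 2) := by
    rw [hv, ← g0]
    exact hz1.update ((Nat.size_le.2 he).trans (by omega))
  have hn : asBank (φ.encode ++ [a]) 0 = n := by simp [encode_eq, asBank]
  have hdet2 : Det (.seq (blk [.add 74 0 26, .add 0 73 26])
      (.cond 74 (.cond 72 (blk (advanceBlk b)) (blk [.const 75 0])) (blk [.const 75 0])))
      (Function.update m₁ 0 (v 0)) 7 fun m' => Approach φ m' ∧ m' 74 0 = e ∧ m' 72 0 = k ∧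
        ((e = 0 ∨ k = 0) ∧ m' 75 0 = 0 ∧ m' 71 0 = a ∨
          e ≠ 0 ∧ k ≠ 0 ∧ m' 75 0 = 1 ∧ m' 71 0 = a + advance b e) := by
    refine Det.seq (k := 2) (k' := 5) (Det.blk ?_)
    set m₃ := execs [.add 74 0 26, .add 0 73 26] (Function.update m₁ 0 (v 0)) with hm₃
    have e3 : ∀ b, b ≠ 0 → b ≠ 74 → b ≠ 72 → m₃ b = m b := fun b b1 b2 b3 => by
      simp [hm₃, execs, Instr.memExec, upd_of_ne, b1, b2, g b b1 b3]
    have v0 : m₃ 0 = asBank (φ.encode ++ [a]) := by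
      simp [hm₃, execs, Instr.memExec, upd_of_ne, hv, g, hm.vars, hm.zero]
      exact hn.symm
    have v74 : m₃ 74 0 = e := by
      simp [hm₃, execs, Instr.memExec, upd_of_ne, hv, g, hm.zero]
    have v72 : m₃ 72 0 = k := by
      simp [hm₃, execs, Instr.memExec, upd_of_ne, g72]
    have v71 : m₃ 71 0 = a := by rw [e3, ha] <;> norm_num
    have v75 : m₃ 75 0 = 1 := by rw [e3, h75] <;> norm_num
    have s3 : Approach φ m₃ := by
      refine ⟨⟨a, v0⟩, ?_, ?_, ?_, ?_⟩
      · rw [e3, hm.one] <;> norm_num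
      · rw [e3, hm.zero] <;> norm_num
      · rw [e3, hm.pos] <;> norm_num
      · rw [e3, hm.vars] <;> norm_num
    clear_value m₃
    have k0 : Nat.size 0 ≤ 0 := size_le_self 0
    have halt : e = 0 ∨ k = 0 → Det (blk [.const 75 0]) m₃ 1 fun m' => Approach φ m' ∧
        m' 74 0 = e ∧ m' 72 0 = k ∧ ((e = 0 ∨ k = 0) ∧ m' 75 0 = 0 ∧ m' 71 0 = a ∨
          e ≠ 0 ∧ k ≠ 0 ∧ m' 75 0 = 1 ∧ m' 71 0 = a + advance b e) := by
      intro hek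
      refine Det.block_le ⟨s3.congr fun b hb => ?_, ?_, ?_, Or.inl ⟨hek, ?_, ?_⟩⟩
        (by simp only [blkSteps, Instr.steps]; omega)
      · have : b ≠ 75 := by omega
        simp [execs, Instr.memExec, upd_of_ne, this]
      · simp [execs, Instr.memExec, upd_of_ne, v74]
      · simp [execs, Instr.memExec, upd_of_ne, v72]
      · simp [execs, Instr.memExec]
      · simp [execs, Instr.memExec, upd_of_ne, v71]
    by_cases he0 : e = 0
    · exact (Det.cond_false (by rw [v74, he0]) (halt (Or.inl he0))).mono (by norm_num) fun _ => id
    · refine Det.cond_true (k := 4) (by rw [v74]; exact he0) ?_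
      by_cases hk0 : k = 0
      · exact (Det.cond_false (by rw [v72, hk0]) (halt (Or.inr hk0))).mono (by norm_num)
          fun _ => id
      · refine Det.cond_true (k := 3) (by rw [v72]; exact hk0) ?_
        cases b
        · refine Det.block_le ⟨s3.congr fun b hb => ?_, ?_, ?_, Or.inr ⟨he0, hk0, ?_, ?_⟩⟩
            (by simp [advanceBlk, blkSteps, Instr.steps])
          · have : b ≠ 71 := by omega
            simp [advanceBlk, execs, Instr.memExec, upd_of_ne, this]
          · simp [advanceBlk, execs, Instr.memExec, upd_of_ne, v74]
          · simp [advanceBlk, execs, Instr.memExec, upd_of_ne, v72]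
          · simp [advanceBlk, execs, Instr.memExec, upd_of_ne, v75]
          · simp [advanceBlk, execs, Instr.memExec, v71, s3.one, advance]
        · refine Det.block_le ⟨s3.congr fun b hb => ?_, ?_, ?_, Or.inr ⟨he0, hk0, ?_, ?_⟩⟩
            (by simp [advanceBlk, blkSteps, Instr.steps])
          · have : b ≠ 71 ∧ b ≠ 77 := by omega
            simp [advanceBlk, execs, Instr.memExec, upd_of_ne, this]
          · simp [advanceBlk, execs, Instr.memExec, upd_of_ne, v74]
          · simp [advanceBlk, execs, Instr.memExec, upd_of_ne, v72]
          · simp [advanceBlk, execs, Instr.memExec, upd_of_ne, v75]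
          · simp [advanceBlk, execs, Instr.memExec, upd_of_ne, v71, v74, s3.one, advance]
  refine (Spec.of_det hdet2 hz2).mono ?_ ?_ le_rfl
    (by exact_mod_cast stepCost_mono le_rfl (by omega))
  · rintro m' ⟨⟨h1, h2, h3, h4⟩, h5⟩
    refine ⟨h1, h5.mono (by omega), ?_⟩
    rcases h4 with ⟨-, h4, -⟩ | ⟨-, hk, h4, h6⟩
    · exact Or.inl h4
    · refine Or.inr ⟨h4, h3, by omega, ?_⟩
      obtain ⟨j, rfl⟩ := Nat.exists_eq_succ_of_ne_zero hk
      rw [h6]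
      exact hP.sure j a e hs he
  · rintro m' ⟨⟨h1, h2, h3, h4⟩, h5⟩ - ⟨v', -, hG, hv'⟩ hinv
    have hee := congrFun (congrFun hv' 0) 0
    simp only [Function.update_self] at hee
    rw [← hee, hv, Function.update_self] at hG
    rcases h4 with ⟨hek, h4, h6⟩ | ⟨he0, hk, h4, h6⟩
    · rw [h4, h6, h2]
      exact ⟨fun _ => hP.halt k a e hs hinv hG hek, fun h => absurd h (by norm_num)⟩
    · rw [h4, h6]
      exact ⟨fun h => absurd h (by norm_num), fun _ => hP.go k a e hs hinv hG he0 hk⟩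

/-- The unit steps before the approximation. -/
def countInit (β s : ℕ) : ℕ := 16 + β + 5 * s

/-- A bound on the length of the numbers during the approximation. -/
def countWidth (β s z : ℕ) : ℕ := z + countInit β s + 9 * (3 * s + β)

/-- The time of the approximation. -/
def countTime (β s z : ℕ) (T : ℝ≥0∞) : ℝ≥0∞ :=
  stepCost (countInit β s) z + (((3 * s + β : ℕ) * ((1 + countWidth β s z : ℕ) +
    approachTime (countWidth β s z) T) + (1 + countWidth β s z : ℕ)) +
    stepCost 1 (countWidth β s z))

/-- Successive approximation leads to an output as desired if none of the estimates fails. -/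
theorem countProg_spec {b : Bool} {β : ℕ} {B : Prog} {n z : ℕ} {φ : CNF n} {G : ℕ → Set ℕ}
    {Sure Inv : ℕ → ℕ → Prop} {Out : ℕ → Prop} {ε T : ℝ≥0∞} (hP : Plan b n G Sure Inv Out)
    (hB : ∀ k a, Sure (k + 1) a → Spec B (frame (asBank (φ.encode ++ [a])))
      (fun m => ∃ e < 2 ^ (n + 3), m 0 = Function.update (asBank (φ.encode ++ [a])) 0 e)
      (fun m => m 0 0 ∈ G a) ε T) (hβ : 1 ≤ β) (hsure : Sure (fuel b n β) 0)
    (hinv : Inv (fuel b n β) 0) (hz : SizeLE (frame (asBank φ.encode)) z) :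
    Spec (countProg b β B) (frame (asBank φ.encode)) (fun _ => True) (fun m => Out (m 0 0))
      (fuel b n β * ε) (countTime β φ.size z T) := by
  have hn : n ≤ φ.size := by unfold CNF.size; omega
  have hM : φ.length ≤ φ.size := by unfold CNF.size; omega
  set F := fuel b n β with hF
  have hF1 : 1 ≤ F := by rw [hF]; unfold fuel; split_ifs <;> omega
  have hF2 : F ≤ 3 * φ.size + β := by rw [hF]; unfold fuel; split_ifs <;> omega
  have k0 : Nat.size 0 ≤ 0 := size_le_self 0
  have k1 : Nat.size 1 ≤ 1 := size_le_self 1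
  have k2 : Nat.size 2 ≤ 2 := size_le_self 2
  have kβ : Nat.size β ≤ β := size_le_self β
  have hinit : Det (.seq (blk [.const 10 1, .const 26 0, .add 73 0 26, .load 76 0 10, .const 70 2,
      .const 71 0, .const 75 1, .const 72 β, .add 72 72 (fuelReg b), .add 72 72 (fuelReg b),
      .add 72 72 (fuelReg b)]) scanLoop) (frame (asBank φ.encode)) (countInit β φ.size)
      fun m => Approach φ m ∧ m 75 0 = 1 ∧ m 72 0 = F ∧ m 71 0 = 0 := by
    refine Det.mono (k := (15 + β) + (φ.length * 5 + 1)) ?_ (by unfold countInit; omega)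
      fun _ => id
    refine Det.seq (Det.block_le ?_ (by simp only [blkSteps, Instr.steps]; omega))
    set m₁ := execs [.const 10 1, .const 26 0, .add 73 0 26, .load 76 0 10, .const 70 2,
      .const 71 0, .const 75 1, .const 72 β, .add 72 72 (fuelReg b), .add 72 72 (fuelReg b),
      .add 72 72 (fuelReg b)] (frame (asBank φ.encode)) with hm₁
    have v0 : m₁ 0 = asBank φ.encode := by simp [hm₁, execs, Instr.memExec, upd_of_ne, frame]
    have v10 : m₁ 10 0 = 1 := by simp [hm₁, execs, Instr.memExec, upd_of_ne]
    have v26 : m₁ 26 0 = 0 := by simp [hm₁, execs, Instr.memExec, upd_of_ne]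
    have v73 : m₁ 73 0 = n := by
      simp [hm₁, execs, Instr.memExec, upd_of_ne, frame, encode_eq, asBank]
    have v76 : m₁ 76 0 = φ.length := by
      simp [hm₁, execs, Instr.memExec, upd_of_ne, frame, encode_eq, asBank]
    have v70 : m₁ 70 0 = 2 := by simp [hm₁, execs, Instr.memExec, upd_of_ne]
    have v71 : m₁ 71 0 = 0 := by simp [hm₁, execs, Instr.memExec, upd_of_ne]
    have v75 : m₁ 75 0 = 1 := by simp [hm₁, execs, Instr.memExec, upd_of_ne]
    have v72 : m₁ 72 0 = F := by
      rw [hF]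
      cases b
      · simp [hm₁, execs, Instr.memExec, upd_of_ne, fuelReg, fuel]
      · simp [hm₁, execs, Instr.memExec, upd_of_ne, fuelReg, fuel, frame, encode_eq, asBank]
        omega
    clear_value m₁
    refine (scanLoop_det (l₁ := [n, φ.length]) φ [] m₁ v0 v10 (by simpa [body] using v70)
      v76).imp fun m₂ ⟨h1, h2⟩ => ⟨⟨⟨0, ?_⟩, ?_, ?_, ?_, ?_⟩, ?_, ?_, ?_⟩
    · rw [h2, v0] <;> norm_num
      funext j
      simp only [asBank]
      rcases lt_or_ge j φ.encode.length with hj | hj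
      · rw [List.getD_append _ _ _ _ hj]
      · rw [List.getD_append_right _ _ _ _ hj, List.getD_eq_default _ _ hj]
        rcases j - φ.encode.length with _ | j <;> simp
    · rw [h2, v10] <;> norm_num
    · rw [h2, v26] <;> norm_num
    · rw [h1]; rfl
    · rw [h2, v73] <;> norm_num
    · rw [h2, v75] <;> norm_num
    · rw [h2, v72] <;> norm_num
    · rw [h2, v71] <;> norm_num
  set Z := countWidth β φ.size z with hZ
  refine (Spec.det_seq (I := fun _ => True) (Q := fun m => Out (m 0 0)) (ε := F * ε)
    (T := (((3 * φ.size + β : ℕ) * ((1 + Z : ℕ) + approachTime Z T) + (1 + Z : ℕ)) +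
      stepCost 1 Z)) hinit hz fun m ⟨s1, h75, h72, h71⟩ hz1 => ?_)
  -- Either the approximation is finished, or it goes on and `k` steps are left.
  set J : ℕ → Mem → Prop := fun k m' => Approach φ m' ∧
    (∃ y, SizeLE m' y ∧ n + 3 ≤ y ∧ y + 9 * k ≤ Z) ∧
    (m' 75 0 = 0 ∨ m' 75 0 = 1 ∧ m' 72 0 = k ∧ 1 ≤ k ∧ Sure k (m' 71 0)) with hJ
  have hstart : J F m := ⟨s1, ⟨_, hz1, by unfold countInit; omega, by
    rw [hZ, countWidth]; omega⟩, Or.inr ⟨h75, h72, hF1, by rw [h71]; exact hsure⟩⟩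
  have hJz : ∀ k m, J k m → SizeLE m Z := by
    rintro k m ⟨-, ⟨y, hy, -, hyZ⟩, -⟩
    exact hy.mono (by omega)
  have hloop := Spec.loop_count (ε := ε) (T := approachTime Z T) (P := approachStep b B)
    (r := 75) (z := Z) J (fun m' => (m' 75 0 = 0 → Out (m' 71 0 + m' 74 0)) ∧
      (m' 75 0 = 1 → Inv (m' 72 0) (m' 71 0))) ?_ hJz ?_ ?_ F m hstart
  · refine (hloop.seq (I' := fun _ => True) (Q' := fun m => Out (m 0 0)) (ε' := 0)
      (T' := stepCost 1 Z) ?_).mono (fun _ => id) (fun _ _ => id) (by simp) (by gcongr)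
    intro m' hm'
    have hz' := hJz _ _ hm'
    have hdet : Det (blk [.add 0 71 74]) m' 1 fun m'' => m'' 0 0 = m' 71 0 + m' 74 0 :=
      Det.blk (by simp [execs, Instr.memExec])
    refine (Spec.of_det hdet hz').mono (fun _ _ => trivial) ?_ le_rfl le_rfl
    rintro m'' ⟨h, -⟩ - hG
    rw [h]
    refine (hG ⟨fun h => absurd h (by rw [h75]; norm_num), fun _ => by rwa [h72, h71]⟩).1 ?_
    rcases hm'.2.2 with h | h
    · exact h
    · omega
  · rintro m' ⟨-, -, h | h⟩
    · exact h
    · omega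
  · rintro k m' ⟨h1, ⟨y, hy, hny, hyZ⟩, -⟩ hr
    exact ⟨h1, ⟨y, hy, hny, by omega⟩, Or.inl hr⟩
  · rintro k m' ⟨h1, ⟨y, hy, hny, hyZ⟩, h3⟩ hr
    rcases h3 with h3 | ⟨g75, g72, -, gs⟩
    · exact absurd h3 hr
    refine (approachStep_spec (Z := Z) hP hB h1 hy hny (by rw [Nat.mul_succ] at hyZ; omega) g75 g72
      gs).mono ?_ ?_ le_rfl le_rfl
    · rintro m'' ⟨g1, g2, g3⟩
      exact ⟨g1, ⟨_, g2, by omega, by rw [Nat.mul_succ] at hyZ; omega⟩, g3⟩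
    · rintro m'' ⟨g1, g2, g3⟩ hI ⟨-, hG⟩
      have := hI (by rw [← g72]; exact hG g75)
      refine ⟨this.1, fun h => ?_⟩
      rcases g3 with g3 | g3
      · omega
      · rw [g3.2.1]
        exact this.2 h

/-- From the logic back to the notion of success of an algorithm. -/
theorem Spec.succeeds {P : Prog} {w : List ℕ} {I : Mem → Prop} {good : (ℕ → ℕ → ℕ) → Prop}
    {ε T : ℝ≥0∞} {t : ℝ} (h : Spec P (frame (asBank w)) I good ε T) (hε : ε ≤ 1 / 3)
    (hT : T ≤ ENNReal.ofReal t) : P.Succeeds w (fun τ => good τ.mem) t := by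
  unfold Prog.Succeeds
  rw [start_eq]
  refine ⟨h.halts _ _, ?_, ?_⟩
  · have h3 : (2 / 3 : ℝ≥0∞) + 1 / 3 = 1 := by
      rw [ENNReal.div_add_div_same]
      norm_num
      exact ENNReal.div_self (by norm_num) (by norm_num)
    have h1 : (2 / 3 : ℝ≥0∞) + 1 / 3 ≤ P.expect (Set.indicator {τ | good τ.mem} fun _ => 1)
        ⟨frame (asBank w), zeroQubits, 0⟩ + 1 / 3 := by
      rw [h3]
      refine le_trans ?_ (add_le_add_right ((h.fail zeroQubits 0).trans hε) _)
      refine (h.halts zeroQubits 0).ge.trans ?_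
      rw [← P.expect_add]
      refine P.expect_mono (fun τ => ?_) _
      by_cases hg : good τ.mem
      · have : τ ∈ {τ : Config | good τ.mem} := hg
        rw [Set.indicator_of_mem this]
        exact le_self_add
      · rw [bad_of_not hg]
        exact le_add_self
    exact (ENNReal.add_le_add_iff_right (by finiteness)).1 h1
  · refine (h.time zeroQubits 0).trans ?_
    simpa using hT

/-! ### Polynomial bounds -/

/-- The function is bounded by a polynomial. -/
def PolyBdd (f : ℕ → ℕ) : Prop := ∃ P : Polynomial ℕ, ∀ s, f s ≤ P.eval s

theorem PolyBdd.const (c : ℕ) : PolyBdd fun _ => c := ⟨.C c, fun s => by simp⟩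

theorem PolyBdd.id : PolyBdd fun s => s := ⟨.X, fun s => by simp⟩

theorem PolyBdd.add {f g : ℕ → ℕ} (hf : PolyBdd f) (hg : PolyBdd g) :
    PolyBdd fun s => f s + g s := by
  obtain ⟨P, hP⟩ := hf
  obtain ⟨Q, hQ⟩ := hg
  exact ⟨P + Q, fun s => by rw [Polynomial.eval_add]; exact add_le_add (hP s) (hQ s)⟩

theorem PolyBdd.mul {f g : ℕ → ℕ} (hf : PolyBdd f) (hg : PolyBdd g) :
    PolyBdd fun s => f s * g s := by
  obtain ⟨P, hP⟩ := hf
  obtain ⟨Q, hQ⟩ := hg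
  exact ⟨P * Q, fun s => by rw [Polynomial.eval_mul]; exact Nat.mul_le_mul (hP s) (hQ s)⟩

theorem PolyBdd.stepCost {f g : ℕ → ℕ} (hf : PolyBdd f) (hg : PolyBdd g) :
    PolyBdd fun s => stepCost (f s) (g s) :=
  hf.mul (((const 2).mul (hg.add hf)).add (const 1))

theorem natPolynomial_eval_mono (q : Polynomial ℕ) {s t : ℕ} (h : s ≤ t) : q.eval s ≤ q.eval t := by
  rw [Polynomial.eval_eq_sum_range, Polynomial.eval_eq_sum_range]
  exact Finset.sum_le_sum fun i _ => Nat.mul_le_mul_left _ (Nat.pow_le_pow_left h i)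

theorem PolyBdd.eval {f : ℕ → ℕ} (hf : PolyBdd f) (q : Polynomial ℕ) :
    PolyBdd fun s => q.eval (f s) := by
  obtain ⟨P, hP⟩ := hf
  exact ⟨q.comp P, fun s => by
    rw [Polynomial.eval_comp]; exact natPolynomial_eval_mono q (hP s)⟩

/-- Bounds on running times that are polynomial in the size of the input, apart from a linear
dependence on a further quantity `x`. -/
def PolyTime (f : ℕ → ℝ≥0∞ → ℝ≥0∞) : Prop :=
  ∃ P : ℕ → ℕ, PolyBdd P ∧ ∀ s x, f s x ≤ (P s : ℕ) * (1 + x)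

theorem PolyTime.nat {g : ℕ → ℕ} (hg : PolyBdd g) : PolyTime fun s _ => (g s : ℕ) :=
  ⟨g, hg, fun _ _ => le_mul_of_one_le_right zero_le le_self_add⟩

theorem PolyTime.one : PolyTime fun _ _ => 1 := by
  simpa using PolyTime.nat (PolyBdd.const 1)

theorem PolyTime.var : PolyTime fun _ x => x :=
  ⟨fun _ => 1, .const 1, fun _ _ => by rw [Nat.cast_one, one_mul]; exact le_add_self⟩

theorem PolyTime.add {f g : ℕ → ℝ≥0∞ → ℝ≥0∞} (hf : PolyTime f) (hg : PolyTime g) :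
    PolyTime fun s x => f s x + g s x := by
  obtain ⟨P, hP, hP'⟩ := hf
  obtain ⟨Q, hQ, hQ'⟩ := hg
  refine ⟨fun s => P s + Q s, hP.add hQ, fun s x => ?_⟩
  rw [Nat.cast_add, add_mul]
  exact add_le_add (hP' s x) (hQ' s x)

theorem PolyTime.nat_mul {g : ℕ → ℕ} {f : ℕ → ℝ≥0∞ → ℝ≥0∞} (hg : PolyBdd g) (hf : PolyTime f) :
    PolyTime fun s x => (g s : ℕ) * f s x := by
  obtain ⟨P, hP, hP'⟩ := hf
  refine ⟨fun s => g s * P s, hg.mul hP, fun s x => ?_⟩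
  rw [Nat.cast_mul, mul_assoc]
  exact mul_le_mul_right (hP' s x) _

theorem tablesSteps_polyBdd (p : ℕ) : PolyBdd (tablesSteps p) := by
  unfold tablesSteps
  repeat first | exact .const _ | exact .id | apply PolyBdd.add | apply PolyBdd.mul

theorem circuitSteps_polyBdd (p : ℕ) : PolyBdd (circuitSteps p) := by
  unfold circuitSteps
  repeat first | exact .const _ | exact .id | apply PolyBdd.add | apply PolyBdd.mul

theorem roundSteps_polyBdd : PolyBdd roundSteps := by
  unfold roundSteps
  repeat first | exact .const _ | exact .id | apply PolyBdd.add | apply PolyBdd.mul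

theorem searchInit_polyBdd (c : ℕ) : PolyBdd fun s => searchInit s c := by
  unfold searchInit
  repeat first | exact .const _ | exact .id | apply PolyBdd.add | apply PolyBdd.mul

theorem searchWidth_polyBdd (c : ℕ) {z : ℕ → ℕ} (hz : PolyBdd z) :
    PolyBdd fun s => searchWidth s c (z s) := by
  unfold searchWidth
  repeat first | exact .const _ | exact .id | exact hz | exact searchInit_polyBdd c |
    apply PolyBdd.add | apply PolyBdd.mul

theorem countInit_polyBdd (β : ℕ) : PolyBdd (countInit β) := by
  unfold countInit
  repeat first | exact .const _ | exact .id | apply PolyBdd.add | apply PolyBdd.mul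

theorem countWidth_polyBdd (β : ℕ) {z : ℕ → ℕ} (hz : PolyBdd z) :
    PolyBdd fun s => countWidth β s (z s) := by
  unfold countWidth
  repeat first | exact .const _ | exact .id | exact hz | exact countInit_polyBdd β |
    apply PolyBdd.add | apply PolyBdd.mul

theorem sampleTime_polyTime (p : ℕ) {z : ℕ → ℕ} (hz : PolyBdd z) :
    PolyTime fun s x => sampleTime p s (z s) x := by
  have h := (tablesSteps_polyBdd p).add (circuitSteps_polyBdd p)
  exact (PolyTime.nat (h.stepCost hz)).add ((PolyTime.nat ((PolyBdd.const 1).add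
    (roundSteps_polyBdd.stepCost (hz.add h)))).add (PolyTime.nat_mul (((PolyBdd.const 2).mul
      roundSteps_polyBdd).add (PolyBdd.const 1)) PolyTime.var))

theorem voteTime_polyTime {z : ℕ → ℕ} (hz : PolyBdd z) {T : ℕ → ℝ≥0∞ → ℝ≥0∞} (hT : PolyTime T) :
    PolyTime fun s x => voteTime (z s) (T s x) :=
  (PolyTime.one.add hT).add (PolyTime.nat ((PolyBdd.const 5).stepCost hz))

theorem stepTime_polyTime {r z : ℕ → ℕ} (hr : PolyBdd r) (hz : PolyBdd z) {T : ℕ → ℝ≥0∞ → ℝ≥0∞}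
    (hT : PolyTime T) : PolyTime fun s x => stepTime (r s) (z s) (T s x) := by
  have h1 : PolyTime fun s _ => ((1 + z s : ℕ) : ℝ≥0∞) := PolyTime.nat ((PolyBdd.const 1).add hz)
  exact (PolyTime.nat ((PolyBdd.const 5).stepCost hz)).add (((PolyTime.nat_mul ((PolyBdd.const 2).mul
    hr) (h1.add (voteTime_polyTime hz hT))).add h1).add
      (PolyTime.nat ((PolyBdd.const 3).stepCost hz)))

theorem searchTime_polyTime (c : ℕ) {z : ℕ → ℕ} (hz : PolyBdd z) {T : ℕ → ℝ≥0∞ → ℝ≥0∞}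
    (hT : PolyTime T) : PolyTime fun s x => searchTime s c (z s) (T s x) := by
  have hZ := searchWidth_polyBdd c hz
  have h1 : PolyTime fun s _ => ((1 + searchWidth s c (z s) : ℕ) : ℝ≥0∞) :=
    PolyTime.nat ((PolyBdd.const 1).add hZ)
  exact (PolyTime.nat ((searchInit_polyBdd c).stepCost hz)).add (((PolyTime.nat_mul
    (PolyBdd.id.add (.const 3)) (h1.add (stepTime_polyTime (((PolyBdd.const 16).mul .id).add
      (.const c)) hZ hT))).add h1).add (PolyTime.nat ((PolyBdd.const 1).stepCost hZ)))

theorem countTime_polyTime (β : ℕ) {z : ℕ → ℕ} (hz : PolyBdd z) {T : ℕ → ℝ≥0∞ → ℝ≥0∞}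
    (hT : PolyTime T) : PolyTime fun s x => countTime β s (z s) (T s x) := by
  have hZ := countWidth_polyBdd β hz
  have h1 : PolyTime fun s _ => ((1 + countWidth β s (z s) : ℕ) : ℝ≥0∞) :=
    PolyTime.nat ((PolyBdd.const 1).add hZ)
  have h2 : PolyTime fun s x => approachTime (countWidth β s (z s)) (T s x) :=
    (PolyTime.nat ((PolyBdd.const 2).stepCost hZ)).add ((PolyTime.one.add hT).add
      (PolyTime.nat ((PolyBdd.const 7).stepCost hZ)))
  exact (PolyTime.nat ((countInit_polyBdd β).stepCost hz)).add (((PolyTime.nat_mul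
    (((PolyBdd.const 3).mul .id).add (.const β)) (h1.add h2)).add h1).add
      (PolyTime.nat ((PolyBdd.const 1).stepCost hZ)))

theorem searchTime_mono {n s c z : ℕ} {T : ℝ≥0∞} (h : n ≤ s) :
    searchTime n c z T ≤ searchTime s c z T := by
  have h1 : searchInit n c ≤ searchInit s c := by unfold searchInit; omega
  have h2 : searchWidth n c z ≤ searchWidth s c z := by unfold searchWidth; gcongr
  have h3 : ∀ k, stepCost k (searchWidth n c z) ≤ stepCost k (searchWidth s c z) :=
    fun k => stepCost_mono le_rfl h2
  have h4 := stepCost_mono h1 (le_refl z)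
  have h5 := h3 1
  have h6 := h3 3
  have h7 := h3 5
  unfold searchTime stepTime voteTime
  gcongr

/-! ### The counting algorithm -/

/-- The numbers in the encoding of a formula are of the order of its size. -/
theorem encode_le {n : ℕ} (φ : CNF n) : ∀ x ∈ φ.encode, x ≤ 2 * φ.size + 2 := by
  intro x hx
  unfold CNF.size
  rw [encode_eq] at hx
  simp only [List.mem_cons, body, List.mem_flatMap, List.mem_map] at hx
  rcases hx with rfl | rfl | ⟨cl, hcl, rfl | ⟨l, -, rfl⟩⟩
  · omega
  · omega
  · have := sum_length_of_mem hcl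
    omega
  · have h1 := l.1.isLt
    have h2 : l.2.toNat ≤ 1 := by cases l.2 <;> simp
    unfold litCode
    omega

theorem frame_sizeLE {l : List ℕ} {z : ℕ} (h : ∀ x ∈ l, x.size ≤ z) :
    SizeLE (frame (asBank l)) z := by
  intro b j
  unfold frame asBank
  split_ifs with hb
  · change (l.getD j 0).size ≤ z
    rcases lt_or_ge j l.length with hj | hj
    · rw [List.getD_eq_getElem _ _ hj]
      exact h _ (List.getElem_mem hj)
    · rw [List.getD_eq_default _ _ hj]
      exact (size_le_self 0).trans (Nat.zero_le _)
  · exact (size_le_self 0).trans (Nat.zero_le _)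

/-- With sufficiently many votes the errors of all the majorities sum up to one third at most. -/
theorem exists_votes (b : Bool) (β : ℕ) : ∃ c : ℕ, ∀ n : ℕ,
    (fuel b n β : ℝ≥0∞) * ((n + 3 : ℕ) * (8 / 9) ^ (16 * n + c)) ≤ 1 / 3 := by
  have hlim : Filter.Tendsto (fun c : ℕ => (8 / 9 : ℝ) ^ c) Filter.atTop (nhds 0) :=
    tendsto_pow_atTop_nhds_zero_of_lt_one (by norm_num) (by norm_num)
  obtain ⟨c, hc⟩ := (hlim.eventually (gt_mem_nhds
    (show (0 : ℝ) < 1 / (3 * (3 * (3 + β))) by positivity))).exists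
  refine ⟨c, fun n => ?_⟩
  -- The number of samples that may fail is at most a constant times `4 ^ n`, and `(8 / 9) ^ 16` is
  -- less than `1 / 4`.
  have h1 : ((8 / 9 : ℝ) ^ 16) ^ n ≤ (1 / 4) ^ n := by gcongr; norm_num
  have h2 : (fuel b n β : ℝ) ≤ (3 + β) * 2 ^ n := by
    have : fuel b n β ≤ (3 + β) * 2 ^ n := by
      have := Nat.lt_two_pow_self (n := n)
      have h1 : 1 ≤ 2 ^ n := Nat.one_le_two_pow
      have : fuel b n β ≤ 3 * n + β := by unfold fuel; split_ifs <;> omega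
      nlinarith
    exact_mod_cast this
  have h3 : ((n + 3 : ℕ) : ℝ) ≤ 3 * 2 ^ n := by
    have : n + 3 ≤ 3 * 2 ^ n := by
      have := Nat.lt_two_pow_self (n := n)
      omega
    exact_mod_cast this
  have hreal : (fuel b n β : ℝ) * ((n + 3 : ℕ) * (8 / 9) ^ (16 * n + c)) ≤ 1 / 3 := by
    rw [pow_add, pow_mul]
    calc _ ≤ ((3 + β) * 2 ^ n : ℝ) * ((3 * 2 ^ n) * ((1 / 4) ^ n *
          (1 / (3 * (3 * (3 + β)))))) := by gcongr
      _ = 1 / 3 * ((2 : ℝ) ^ n * 2 ^ n * (1 / 4) ^ n) := by field_simp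
      _ = 1 / 3 := by rw [← mul_pow, ← mul_pow]; norm_num
  have e : (fuel b n β : ℝ≥0∞) * ((n + 3 : ℕ) * (8 / 9) ^ (16 * n + c)) =
      ENNReal.ofReal ((fuel b n β : ℝ) * ((n + 3 : ℕ) * (8 / 9) ^ (16 * n + c))) := by
    rw [ENNReal.ofReal_mul (by positivity), ENNReal.ofReal_mul (by positivity),
      ENNReal.ofReal_pow (by positivity), ENNReal.ofReal_natCast, ENNReal.ofReal_natCast,
      ENNReal.ofReal_div_of_pos (by norm_num)]
    norm_num
  rw [e]
  refine (ENNReal.ofReal_le_ofReal hreal).trans ?_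
  rw [ENNReal.ofReal_div_of_pos (by norm_num)]
  norm_num

theorem Prog.Succeeds.mono {P : Prog} {w : List ℕ} {good : Config → Prop} {t t' : ℝ}
    (h : P.Succeeds w good t) (ht : t ≤ t') : P.Succeeds w good t' :=
  ⟨h.1, h.2.1, h.2.2.trans (ENNReal.ofReal_le_ofReal ht)⟩

/-- The reduction: an algorithm for strong simulation with a running time that is polynomial in the
size of the circuit times `X ^ (1 - δ)` yields a counting algorithm, with a running time polynomial
in the size of the formula times `Y ^ (1 - δ)`, if `X` is at most a constant multiple of `Y` for the
circuits that are simulated. The algorithm depends only on whether the steps are of length one or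
halve the distance, and on the constants `p`, `β` and `c₀`, but not on the error parameter. -/
theorem exists_countProg (A : Prog) (q : Polynomial ℕ) (p : ℕ) (b : Bool) {β : ℕ} (hβ : 1 ≤ β)
    {c₀ : ℕ} (hc₀ : 1 ≤ c₀) {δ : ℝ} (hδ : 0 < δ) (hδ' : δ ≤ 1) :
    ∃ (B : Prog) (P : Polynomial ℕ), ∀ (n : ℕ) (φ : CNF n) (γ Y : ℝ) (Sure Inv : ℕ → ℕ → Prop)
      (Out : ℕ → Prop), 0 < γ → γ < 1 / 2 → 1 ≤ Y →
      Plan b n (fun a => closeTo γ (Int.natAbs ((φ.count : ℤ) - (a % 2 ^ (n + 1) : ℕ)))) Sure Inv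
        Out → Sure (fuel b n β) 0 → Inv (fuel b n β) 0 →
      (∀ k a, Sure (k + 1) a → a.size ≤ p + 4 * n + 5 ∧ ∃ X : ℝ, 0 ≤ X ∧ X ≤ c₀ * Y ∧
        A.Succeeds (Circuit.encode (shiftCircuit p a φ) fun _ => false)
          (fun τ => MulApprox γ ((shiftCircuit p a φ).absAmplitude fun _ => false)
            ((τ.mem 0 0 : ℝ) / (τ.mem 0 1 : ℝ)))
          ((q.eval (shiftCircuit p a φ).size : ℕ) * X ^ (1 - δ))) →
      B.Succeeds φ.encode (fun τ => Out (τ.mem 0 0)) ((P.eval φ.size : ℕ) * Y ^ (1 - δ)) := by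
  obtain ⟨c, hc⟩ := exists_votes b β
  -- bounds on the length of the numbers in the inputs of the counting and of the search
  set z₁ : ℕ → ℕ := fun s => 2 * s + 2 with hz₁
  set z₂ : ℕ → ℕ := fun s => 2 * s + 2 + (p + 4 * s + 5) with hz₂
  have hz₁' : PolyBdd z₁ := by
    repeat first | exact .const _ | exact .id | apply PolyBdd.add | apply PolyBdd.mul
  have hz₂' : PolyBdd z₂ := by
    repeat first | exact .const _ | exact .id | apply PolyBdd.add | apply PolyBdd.mul
  obtain ⟨P, hP, hP'⟩ := countTime_polyTime β hz₁'
    (searchTime_polyTime c hz₂' (sampleTime_polyTime p hz₂'))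
  -- the bound on the size of the circuits
  set cs : ℕ → ℕ := fun s => 3 * s + p + 13 + 8 * (s + 3) ^ 4 with hcs
  have hcs' : PolyBdd cs := by
    repeat first | exact .const _ | exact .id | apply PolyBdd.add | apply PolyBdd.mul
  obtain ⟨R, hR⟩ := hP.mul ((PolyBdd.const 1).add ((hcs'.eval q).mul (.const c₀)))
  refine ⟨countProg b β (searchProg c (sampleProg p A)), R, ?_⟩
  intro n φ γ Y Sure Inv Out hγ hγ' hY hplan hsure hinv hA
  have hn : n ≤ φ.size := by unfold CNF.size; omega
  have hcount := φ.count_le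
  set U : ℝ := Y ^ (1 - δ) with hU
  have hU1 : 1 ≤ U := Real.one_le_rpow hY (by linarith)
  set t : ℝ := (q.eval (cs φ.size) * c₀ : ℕ) * U with ht
  have hB : ∀ k a, Sure (k + 1) a → Spec (searchProg c (sampleProg p A))
      (frame (asBank (φ.encode ++ [a])))
      (fun m => ∃ e < 2 ^ (n + 3), m 0 = Function.update (asBank (φ.encode ++ [a])) 0 e)
      (fun m => m 0 0 ∈ closeTo γ (Int.natAbs ((φ.count : ℤ) - (a % 2 ^ (n + 1) : ℕ))))
      ((n + 3 : ℕ) * (8 / 9) ^ (16 * n + c)) (searchTime φ.size c (z₂ φ.size)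
        (sampleTime p φ.size (z₂ φ.size) (ENNReal.ofReal t))) := by
    intro k a hs
    obtain ⟨hsize, X, hX0, hX, hA⟩ := hA k a hs
    have hz : SizeLE (frame (asBank (φ.encode ++ [a]))) (z₂ φ.size) := by
      refine frame_sizeLE fun x hx => ?_
      rw [List.mem_append, List.mem_singleton] at hx
      rcases hx with hx | rfl
      · have := (size_le_self x).trans (encode_le φ x hx)
        simp only [hz₂]
        omega
      · simp only [hz₂]
        omega
    have hAt := hA.mono (t' := t) (by
      -- The constant factor can be moved out of the power, which has an exponent in `[0, 1]`.
      have h1 : X ^ (1 - δ) ≤ c₀ * U := by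
        have hc1 : (1 : ℝ) ≤ c₀ := by exact_mod_cast hc₀
        calc X ^ (1 - δ) ≤ (c₀ * Y) ^ (1 - δ) := Real.rpow_le_rpow hX0 hX (by linarith)
          _ = (c₀ : ℝ) ^ (1 - δ) * U := Real.mul_rpow (by positivity) (by linarith)
          _ ≤ (c₀ : ℝ) ^ (1 : ℝ) * U := by
            gcongr
            linarith
          _ = c₀ * U := by rw [Real.rpow_one]
      have h2 : q.eval (shiftCircuit p a φ).size ≤ q.eval (cs φ.size) :=
        natPolynomial_eval_mono q (shiftCircuit_size_le p a φ)
      have h3 : ((q.eval (shiftCircuit p a φ).size : ℕ) : ℝ) ≤ (q.eval (cs φ.size) : ℕ) :=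
        Nat.cast_le.2 h2
      calc _ ≤ ((q.eval (cs φ.size) : ℕ) : ℝ) * (c₀ * U) := by gcongr
        _ = t := by rw [ht, Nat.cast_mul, mul_assoc])
    refine (searchProg_spec (sampleProg_spec hγ hγ' hAt hz) (by simp [encode_eq, asBank])
      (closeTo_ordConnected _ _) ⟨Int.natAbs ((φ.count : ℤ) - (a % 2 ^ (n + 1) : ℕ)), ?_, ?_⟩
      hz).mono (fun _ => id) (fun _ _ => id) le_rfl (searchTime_mono hn)
    · simp only [closeTo, Set.mem_ofPred_eq, sub_self, abs_zero]
      positivity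
    · have h1 : 2 ^ (n + 1) = 2 * 2 ^ n := by ring
      have h2 : 2 ^ (n + 3) = 8 * 2 ^ n := by ring
      have := Nat.mod_lt a (Nat.two_pow_pos (n + 1))
      omega
  have hspec := countProg_spec hplan hB hβ hsure hinv
    (frame_sizeLE (z := z₁ φ.size) fun x hx => (size_le_self x).trans (encode_le φ x hx))
  refine hspec.succeeds (hc n) ((hP' φ.size (ENNReal.ofReal t)).trans ?_)
  have h0 : (0 : ℝ) ≤ t := by positivity
  have e1 : (1 : ℝ≥0∞) + ENNReal.ofReal t = ENNReal.ofReal (1 + t) := by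
    rw [ENNReal.ofReal_add (by norm_num) h0, ENNReal.ofReal_one]
  rw [e1, ← ENNReal.ofReal_natCast, ← ENNReal.ofReal_mul (by positivity)]
  refine ENNReal.ofReal_le_ofReal ?_
  have h1 : ((P φ.size * (1 + q.eval (cs φ.size) * c₀) : ℕ) : ℝ) ≤ (R.eval φ.size : ℕ) :=
    Nat.cast_le.2 (hR φ.size)
  calc (P φ.size : ℝ) * (1 + t) ≤ P φ.size * (U + t) := by gcongr
    _ = ((P φ.size * (1 + q.eval (cs φ.size) * c₀) : ℕ) : ℝ) * U := by
      rw [ht]; push_cast; ring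
    _ ≤ _ := by gcongr

/-! ### The two reductions -/

theorem one_le_approxTime (n : ℕ) (γ h : ℝ) : 1 ≤ approxTime n γ h := le_max_left _ _

theorem approxTime_le_two_pow {N : ℕ} {γ h : ℝ} (hγ : 1 / 2 ^ N ≤ γ) (h1 : 1 ≤ γ * h) :
    approxTime N γ h ≤ 2 ^ N := by
  have hN : (1 : ℝ) ≤ 2 ^ N := one_le_pow₀ (by norm_num)
  have hγ0 : 0 < γ := lt_of_lt_of_le (by positivity) hγ
  have hh : 0 < h := by
    by_contra hh
    nlinarith
  have hγN : 1 ≤ γ * 2 ^ N := (div_le_iff₀ (by positivity)).1 hγ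
  refine max_le hN ?_
  rw [one_div, inv_mul_le_iff₀ hγ0]
  refine Real.sqrt_le_iff.2 ⟨by positivity, ?_⟩
  rw [div_le_iff₀ hh]
  calc (2 : ℝ) ^ N - h ≤ 2 ^ N * 1 := by linarith
    _ ≤ 2 ^ N * (γ * h) := by gcongr
    _ = (γ * 2 ^ N) * 1 * h := by ring
    _ ≤ (γ * 2 ^ N) * (γ * 2 ^ N) * h := by gcongr
    _ = (γ * 2 ^ N) ^ 2 * h := by ring

/-- The base of the power in the time bound of a strong simulation on `N` qubits. -/
def simBound (N : ℕ) (γ h : ℝ) : ℝ := if 1 ≤ γ * h then approxTime N γ h else 2 ^ N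

theorem one_le_simBound (N : ℕ) (γ h : ℝ) : 1 ≤ simBound N γ h := by
  unfold simBound
  split_ifs
  · exact one_le_approxTime _ _ _
  · exact one_le_pow₀ (by norm_num)

theorem simBound_le_two_pow {N : ℕ} {γ : ℝ} (hγ : 1 / 2 ^ N ≤ γ) (h : ℝ) :
    simBound N γ h ≤ 2 ^ N := by
  unfold simBound
  split_ifs with h1
  · exact approxTime_le_two_pow hγ h1
  · exact le_rfl

/-- If `h` is large, a shift of `h` by at most `1 / γ` changes the time bound by a constant factor
only, even though the circuit has more qubits than the formula has variables. Here `h` stands for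
the number of satisfying assignments, and the `K` idle qubits ensure that `1 ≤ γ * ĥ` for the
quantity `ĥ = (h - a) * 2 ^ (K + 3)` that the time bound of the simulation refers to. -/
theorem simBound_shift_le {n K : ℕ} {γ h a : ℝ} (hγ : 0 < γ) (hK : 1 < γ * (K + 1))
    (hKh : (K : ℝ) + 1 ≤ h) (ha : a ≤ K) :
    simBound (n + 5 + K) γ ((h - a) * 2 ^ (K + 3)) ≤ 8 * (K + 1) ^ 2 * approxTime n γ h := by
  set s : ℝ := K + 1 with hs
  have hK0 : (0 : ℝ) ≤ K := by positivity
  have hs1 : 1 ≤ s := by linarith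
  have hh : 0 < h := by linarith
  -- At least the fraction `1 / (K + 1)` of `h` survives the shift.
  have hv : h ≤ s * (h - a) := by
    have : 0 ≤ K * (h - s) := mul_nonneg hK0 (by linarith)
    nlinarith
  have hv0 : 0 < h - a := by linarith
  have hpow : s ≤ 2 ^ (K + 3) := by
    have : K + 1 ≤ 2 ^ (K + 3) := by
      have := Nat.lt_two_pow_self (n := K + 3)
      omega
    rw [hs]
    exact_mod_cast this
  have hA := one_le_approxTime n γ h
  have hlarge : 1 ≤ γ * ((h - a) * 2 ^ (K + 3)) := by
    calc 1 ≤ γ * s := hK.le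
      _ ≤ γ * h := by gcongr
      _ ≤ γ * (s * (h - a)) := by gcongr
      _ ≤ γ * (2 ^ (K + 3) * (h - a)) := by gcongr
      _ = _ := by ring
  unfold simBound
  rw [if_pos hlarge]
  refine max_le (by nlinarith) ?_
  have hsqrt8 : Real.sqrt (8 * s) ≤ 8 * s := by
    refine Real.sqrt_le_iff.2 ⟨by positivity, ?_⟩
    nlinarith
  have hle : ((2 : ℝ) ^ (n + 5 + K) - (h - a) * 2 ^ (K + 3)) / ((h - a) * 2 ^ (K + 3)) ≤
      4 * 2 ^ n * s / h := by
    have e : (2 : ℝ) ^ (n + 5 + K) = 4 * 2 ^ n * 2 ^ (K + 3) := by ring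
    rw [e, ← sub_mul, mul_div_mul_right _ _ (by positivity), div_le_div_iff₀ hv0 hh]
    calc (4 * 2 ^ n - (h - a)) * h ≤ (4 * 2 ^ n) * h := by gcongr; linarith
      _ ≤ (4 * 2 ^ n) * (s * (h - a)) := by gcongr
      _ = _ := by ring
  -- If `h` is at most half of `2 ^ n`, then `2 ^ n` and `2 ^ n - h` are comparable. Otherwise `h`
  -- and `2 ^ n` are, and the square root is bounded, as is `1 / γ`.
  rcases le_total (2 * h) (2 ^ n) with hcase | hcase
  · have h2 : 4 * 2 ^ n * s / h ≤ 8 * s * ((2 ^ n - h) / h) := by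
      rw [← mul_div_assoc]
      gcongr ?_ / h
      nlinarith
    calc _ ≤ 1 / γ * Real.sqrt (8 * s * ((2 ^ n - h) / h)) := by
          gcongr
          exact hle.trans h2
      _ = Real.sqrt (8 * s) * (1 / γ * Real.sqrt ((2 ^ n - h) / h)) := by
          rw [Real.sqrt_mul (by positivity)]
          ring
      _ ≤ (8 * s) * approxTime n γ h := by
          gcongr
          exact le_max_right _ _
      _ ≤ 8 * s ^ 2 * approxTime n γ h := by
          gcongr
          nlinarith
  · have h2 : 4 * 2 ^ n * s / h ≤ 8 * s := by
      rw [div_le_iff₀ hh]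
      nlinarith
    calc _ ≤ s * Real.sqrt (8 * s) := by
          gcongr
          · rw [div_le_iff₀ hγ]
            linarith
          · exact hle.trans h2
      _ ≤ s * (8 * s) * 1 := by rw [mul_one]; gcongr
      _ ≤ s * (8 * s) * approxTime n γ h := by gcongr
      _ = 8 * s ^ 2 * approxTime n γ h := by ring

/-- The time bound of the simulation for a circuit that encodes a shifted number of satisfying
assignments; the exponent is replaced by a nonnegative one. -/
theorem shiftCircuit_succeeds {A : Prog} {q : Polynomial ℕ} {n p : ℕ} {γ δ : ℝ}
    (hA : ∀ (C : Circuit (wires n p)) (x : Fin (wires n p) → Bool),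
      A.Succeeds (C.encode x)
        (fun τ => MulApprox γ (C.absAmplitude x) ((τ.mem 0 0 : ℝ) / (τ.mem 0 1 : ℝ)))
        ((q.eval C.size : ℕ) * (if 1 ≤ γ * (C.absAmplitude x * 2 ^ wires n p)
          then approxTime (wires n p) γ (C.absAmplitude x * 2 ^ wires n p)
          else 2 ^ wires n p) ^ (1 - δ)))
    (a : ℕ) (φ : CNF n) :
    A.Succeeds (Circuit.encode (shiftCircuit p a φ) fun _ => false)
      (fun τ => MulApprox γ ((shiftCircuit p a φ).absAmplitude fun _ => false)
        ((τ.mem 0 0 : ℝ) / (τ.mem 0 1 : ℝ)))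
      ((q.eval (shiftCircuit p a φ).size : ℕ) * simBound (n + 5 + p) γ
        (|(φ.count : ℝ) - (a % 2 ^ (n + 1) : ℕ)| * 2 ^ (p + 3)) ^ (1 - min δ 1)) := by
  have hw : wires n p = n + 5 + p := by unfold wires; omega
  have e : (shiftCircuit p a φ).absAmplitude (fun _ => false) * 2 ^ wires n p =
      |(φ.count : ℝ) - (a % 2 ^ (n + 1) : ℕ)| * 2 ^ (p + 3) := by
    rw [shiftCircuit_absAmplitude, hw, show n + 5 + p = (n + 2) + (p + 3) by omega,
      pow_add (2 : ℝ) (n + 2)]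
    field_simp
  refine (hA (shiftCircuit p a φ) fun _ => false).mono ?_
  rw [e]
  refine mul_le_mul_of_nonneg_left ?_ (by positivity)
  have h1 := one_le_simBound (wires n p) γ
    (|(φ.count : ℝ) - (a % 2 ^ (n + 1) : ℕ)| * 2 ^ (p + 3))
  rw [← hw]
  exact Real.rpow_le_rpow_of_exponent_le h1 (by linarith [min_le_left δ 1])

theorem natAbs_sub_mod {n h a : ℕ} (hn : h ≤ 2 ^ n) (ha : a ≤ h) :
    Int.natAbs ((h : ℤ) - (a % 2 ^ (n + 1) : ℕ)) = h - a := by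
  have : 2 ^ (n + 1) = 2 * 2 ^ n := by ring
  have := Nat.two_pow_pos n
  rw [Nat.mod_eq_of_lt (by omega)]
  omega

theorem mulApprox_self {γ v : ℝ} (hγ : 0 < γ) (hv : 0 ≤ v) : MulApprox γ v v := by
  unfold MulApprox
  split_ifs with h
  · exact h
  · have : 0 < v := lt_of_le_of_ne hv (Ne.symm h)
    constructor <;> nlinarith

/-- A good estimate is zero exactly if the distance is: for `v ≥ 1`, `(1 - γ) * v` exceeds `1 / 2`.
-/
theorem eq_zero_of_mem_closeTo {γ : ℝ} {v e : ℕ} (hγ : γ < 1 / 2) (he : e ∈ closeTo γ v) :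
    e = 0 ↔ v = 0 := by
  simp only [closeTo, Set.mem_ofPred_eq, abs_lt] at he
  constructor
  · rintro rfl
    by_contra hv
    have : (1 : ℝ) ≤ v := by exact_mod_cast Nat.one_le_iff_ne_zero.2 hv
    have := he.1
    push_cast at this
    nlinarith
  · rintro rfl
    by_contra hv
    have : (1 : ℝ) ≤ e := by exact_mod_cast Nat.one_le_iff_ne_zero.2 hv
    have := he.2
    push_cast at this
    linarith

/-- For a constant error parameter, the numbers `0, 1, …, K` with `K = ⌊1 / γ⌋` are subtracted in
turn. Either a difference is zero, and then the number of satisfying assignments is known exactly,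
or it is the sum of `K` and a positive number, and `K` makes up for the error of rounding. -/
theorem constant_plan {n K h : ℕ} {γ : ℝ} (hγ : 0 < γ) (hγ' : γ < 1 / 2) (hK : 1 < γ * (K + 1))
    (hn : h ≤ 2 ^ n) :
    Plan false n (fun a => closeTo γ (Int.natAbs ((h : ℤ) - (a % 2 ^ (n + 1) : ℕ))))
      (fun k a => a + k = K + 1) (fun _ a => a ≤ h) (fun d => MulApprox γ h d) where
  sure k a e hs _ := by
    simp only [advance, Bool.false_eq_true, if_false]
    omega
  go k a e _ ha he he0 _ := by
    rw [natAbs_sub_mod hn ha] at he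
    have := mt (eq_zero_of_mem_closeTo hγ' he).2 he0
    simp only [advance, Bool.false_eq_true, if_false]
    omega
  halt k a e hs ha he hek := by
    rw [natAbs_sub_mod hn ha] at he
    by_cases hv : h - a = 0
    · have h1 : a = h := by omega
      rw [(eq_zero_of_mem_closeTo hγ' he).2 hv, h1, add_zero]
      exact mulApprox_self hγ (by positivity)
    · have he0 := mt (eq_zero_of_mem_closeTo hγ' he).1 hv
      have hk : k = 0 := by tauto
      have haK : a = K := by omega
      have h0 : (h : ℝ) ≠ 0 := by
        have : h ≠ 0 := by omega
        exact_mod_cast this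
      simp only [closeTo, Set.mem_ofPred_eq, abs_lt] at he
      rw [Nat.cast_sub ha] at he
      -- The error is less than `γ * (h - K) + 1 / 2`, and `γ * K > 1 - γ > 1 / 2`.
      unfold MulApprox
      rw [if_neg h0, haK, Nat.cast_add]
      rw [haK] at he
      constructor <;> nlinarith [he.1, he.2]

/-- Half of a good estimate of the distance `v`, rounded up, is between `v / 4` and `v`. -/
theorem advance_bounds {γ : ℝ} {v e : ℕ} (hγ : γ < 0.4999) (he : e ∈ closeTo γ v) (hv : v ≠ 0) :
    advance true e ≤ v ∧ v ≤ 4 * advance true e := by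
  have hv1 : (1 : ℝ) ≤ v := by exact_mod_cast Nat.one_le_iff_ne_zero.2 hv
  have hγv : γ * v ≤ 0.4999 * v := by gcongr
  simp only [closeTo, Set.mem_ofPred_eq, abs_lt] at he
  have h1 : (e : ℝ) < (2 * v : ℕ) := by
    push_cast
    linarith [he.2]
  have h2 : (v : ℝ) < (2 * e + 1 : ℕ) := by
    push_cast
    linarith [he.1]
  have h3 : e < 2 * v := by exact_mod_cast h1
  have h4 : v < 2 * e + 1 := by exact_mod_cast h2
  simp only [advance, if_true]
  omega

/-- If the error of the simulation is at most `0.4999`, then each step from `a` to `a` plus half the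
estimated distance reduces the distance by a factor `3 / 4` at least, and never overshoots. With one
step to go, the distance is less than one. What holds surely is that `a` is not too long a number.
-/
theorem halving_plan {n h : ℕ} {γ γ' : ℝ} (hγ : γ < 0.4999) (hγ' : 0 < γ') (hn : h ≤ 2 ^ n) :
    Plan true n (fun a => closeTo γ (Int.natAbs ((h : ℤ) - (a % 2 ^ (n + 1) : ℕ))))
      (fun k a => a + k * 2 ^ (n + 3) ≤ (3 * n + 2) * 2 ^ (n + 3))
      (fun k a => a ≤ h ∧ (h - a) * 3 ^ (k - 1) < 4 ^ (k - 1)) (fun d => MulApprox γ' h d) where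
  sure k a e hs he := by
    have h1 : advance true e ≤ 2 ^ (n + 3) := by
      simp only [advance, if_true]
      omega
    have h2 : (k + 2) * 2 ^ (n + 3) = (k + 1) * 2 ^ (n + 3) + 2 ^ (n + 3) := by ring
    omega
  go k a e _ hi he he0 hk := by
    obtain ⟨ha, hi⟩ := hi
    rw [natAbs_sub_mod hn ha] at he
    obtain ⟨h1, h2⟩ := advance_bounds hγ he
      (mt (eq_zero_of_mem_closeTo (by linarith) he).2 he0)
    obtain ⟨j, rfl⟩ := Nat.exists_eq_succ_of_ne_zero hk
    refine ⟨by omega, ?_⟩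
    have h3 : 4 * (h - (a + advance true e)) ≤ 3 * (h - a) := by omega
    simp only [Nat.succ_eq_add_one, Nat.add_sub_cancel] at hi ⊢
    rw [pow_succ, pow_succ] at hi
    have h4 := Nat.mul_le_mul_right (3 ^ j) h3
    nlinarith
  halt k a e _ hi he hek := by
    obtain ⟨ha, hi⟩ := hi
    rw [natAbs_sub_mod hn ha] at he
    have hv : h - a = 0 := by
      rcases hek with he0 | hk
      · exact (eq_zero_of_mem_closeTo (by linarith) he).1 he0
      · rw [hk] at hi
        simpa using hi
    have h1 : a = h := by omega
    rw [(eq_zero_of_mem_closeTo (by linarith) he).2 hv, h1, add_zero]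
    exact mulApprox_self hγ' (by positivity)

/-- For a constant error parameter the same one is used for the simulation. -/
theorem strongSimulationHard_of_const {γ : ℝ} (hγ : 0 < γ) (hγ' : γ < 0.4999)
    (hQ : GammaSharpQSETH fun _ => γ) : StrongSimulationHard fun _ => γ := by
  rintro δ hδ ⟨A, q, hA⟩
  obtain ⟨c, -, hno⟩ := hQ (min δ 1) (lt_min hδ one_pos)
  apply hno
  set K := ⌊1 / γ⌋₊ with hK
  have hK1 : 1 < γ * (K + 1) := by
    have := Nat.lt_floor_add_one (1 / γ)
    rw [div_lt_iff₀ hγ] at this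
    linarith
  have hK2 : γ * K ≤ 1 := by
    have := Nat.floor_le (show 0 ≤ 1 / γ by positivity)
    rw [le_div_iff₀ hγ] at this
    linarith
  have hc₀ : 1 ≤ 8 * (K + 1) ^ 2 * 2 ^ (5 + K) :=
    Nat.succ_le_of_lt (by positivity)
  obtain ⟨B, P, hB⟩ := exists_countProg A q K false (β := K + 1) (by omega) hc₀
    (lt_min hδ one_pos) (min_le_right δ 1)
  refine ⟨B, P, fun n hn φ _ => ?_⟩
  set Y : ℝ := if 1 < γ * φ.count then approxTime n γ φ.count else 2 ^ n with hY
  have hY1 : 1 ≤ Y := by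
    rw [hY]
    split_ifs
    · exact one_le_approxTime _ _ _
    · exact one_le_pow₀ (by norm_num)
  have hN : (1 : ℝ) / 2 ^ (n + 5 + K) ≤ γ := by
    refine le_trans ?_ hn.1
    gcongr
    · norm_num
    · omega
  have hw : wires n K = n + 5 + K := by unfold wires; omega
  have hsim := hA (wires n K) ⟨by rw [hw]; exact hN, hγ'⟩
  refine hB n φ γ Y _ _ _ hγ (by linarith) hY1
    (constant_plan hγ (by linarith) hK1 φ.count_le) (by simp [fuel]) (Nat.zero_le _) ?_
  intro k a hs
  have haK : a ≤ K := by omega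
  refine ⟨(size_le_self a).trans (by omega), _, (zero_le_one.trans (one_le_simBound _ _ _)), ?_,
    shiftCircuit_succeeds hsim a φ⟩
  push_cast
  have h5 : (1 : ℝ) ≤ 2 ^ (5 + K) := one_le_pow₀ (by norm_num)
  have h8 : (1 : ℝ) ≤ 8 * (K + 1) ^ 2 := by nlinarith [(Nat.cast_nonneg K : (0 : ℝ) ≤ K)]
  -- Either the faster time is granted for both problems, or the slower one for counting.
  by_cases hlarge : 1 < γ * φ.count
  · have hKh : K < φ.count := by
      have : γ * K < γ * φ.count := by linarith
      exact_mod_cast lt_of_mul_lt_mul_left this hγ.le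
    have hc := φ.count_le
    have ha : a % 2 ^ (n + 1) = a := by
      have : 2 ^ (n + 1) = 2 * 2 ^ n := by ring
      exact Nat.mod_eq_of_lt (by omega)
    have ha' : (a : ℝ) ≤ K := by exact_mod_cast haK
    have hKh' : (K : ℝ) + 1 ≤ φ.count := by exact_mod_cast hKh
    rw [ha, abs_of_nonneg (by linarith)]
    rw [if_pos hlarge] at hY
    calc _ ≤ 8 * (K + 1 : ℝ) ^ 2 * Y := by
          rw [hY]
          exact simBound_shift_le hγ hK1 hKh' ha'
      _ ≤ 8 * (K + 1) ^ 2 * 2 ^ (5 + K) * Y := by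
          rw [mul_right_comm (8 * (K + 1 : ℝ) ^ 2)]
          exact le_mul_of_one_le_right (by positivity) h5
  · rw [if_neg hlarge] at hY
    calc _ ≤ (2 : ℝ) ^ (n + 5 + K) := simBound_le_two_pow hN _
      _ = 1 * 2 ^ (5 + K) * Y := by rw [hY]; ring
      _ ≤ 8 * (K + 1) ^ 2 * 2 ^ (5 + K) * Y := by gcongr

/-- Whatever the error parameter of the simulation is, its error is below `0.4999` and its time
bound is at most the `(1 - δ)`-th power of the dimension; nothing else is used. -/
theorem strongSimulationHard_of_forall
    (hQ : ∀ γ : ℕ → ℝ, (∀ᶠ n in Filter.atTop, γ n ∈ errorRange n) → GammaSharpQSETH γ)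
    {γ : ℕ → ℝ} (hγ : ∀ᶠ n in Filter.atTop, γ n ∈ errorRange n) : StrongSimulationHard γ := by
  classical
  rintro δ hδ ⟨A, q, hA⟩
  -- The number of satisfying assignments is found exactly, hence the smallest error is considered.
  -- The value zero excludes the `n` for which the simulation is not known to work.
  set γ' : ℕ → ℝ := fun n => if γ (n + 5) ∈ errorRange (n + 5) then 1 / 2 ^ n else 0 with hγ'
  have hev : ∀ᶠ n in Filter.atTop, γ' n ∈ errorRange n := by
    filter_upwards [(Filter.tendsto_add_atTop_nat 5).eventually hγ, Filter.eventually_ge_atTop 2]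
      with n hn hn2
    simp only [hγ', if_pos hn]
    refine ⟨le_rfl, ?_⟩
    calc (1 : ℝ) / 2 ^ n ≤ 1 / 2 ^ 2 := by gcongr; norm_num
      _ < 0.4999 := by norm_num
  obtain ⟨c, -, hno⟩ := hQ γ' hev (min δ 1) (lt_min hδ one_pos)
  apply hno
  obtain ⟨B, P, hB⟩ := exists_countProg A q 0 true (β := 2) (by omega) (c₀ := 32) (by omega)
    (lt_min hδ one_pos) (min_le_right δ 1)
  refine ⟨B, P, fun n hn φ _ => ?_⟩
  have hn' : γ (n + 5) ∈ errorRange (n + 5) := by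
    by_contra h
    have : γ' n = 0 := if_neg h
    have h0 := hn.1
    rw [this] at h0
    exact absurd h0 (not_le.2 (by positivity))
  have hval : γ' n = 1 / 2 ^ n := if_pos hn'
  have hc := φ.count_le
  have hc' : (φ.count : ℝ) ≤ 2 ^ n := by exact_mod_cast hc
  have hsmall : ¬1 < γ' n * φ.count := by
    rw [hval, not_lt, one_div, inv_mul_le_iff₀ (by positivity), mul_one]
    exact hc'
  rw [if_neg hsmall, hval]
  have hsim := hA (wires n 0) hn'
  have hpos : 0 < γ (n + 5) := lt_of_lt_of_le (by positivity) hn'.1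
  refine hB n φ (γ (n + 5)) (2 ^ n) _ _ _ hpos (by linarith [hn'.2])
    (one_le_pow₀ (by norm_num)) (halving_plan hn'.2 (by positivity) hc) (by simp [fuel])
    ⟨Nat.zero_le _, ?_⟩ ?_
  · -- The number of steps suffices because `2 * 3 ^ 3 < 4 ^ 3`.
    have e : fuel true n 2 - 1 = 3 * n + 1 := by simp [fuel]
    rw [e, Nat.sub_zero]
    calc φ.count * 3 ^ (3 * n + 1) ≤ 2 ^ n * 3 ^ (3 * n + 1) := Nat.mul_le_mul_right _ hc
      _ = 3 * (2 * 3 ^ 3) ^ n := by rw [pow_succ, pow_mul, mul_pow]; ring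
      _ ≤ 3 * (4 ^ 3) ^ n := by gcongr; norm_num
      _ < 4 * (4 ^ 3) ^ n := by gcongr; norm_num
      _ = 4 ^ (3 * n + 1) := by rw [pow_succ 4 (3 * n), pow_mul 4 3 n, mul_comm]
  · -- the length of the numbers `a`, and the time of the simulation
    intro k a hs
    refine ⟨Nat.size_le.2 ?_, _, (zero_le_one.trans (one_le_simBound _ _ _)), ?_,
      shiftCircuit_succeeds hsim a φ⟩
    · have h1 : 3 * n + 2 ≤ 2 * 4 ^ n := by
        have h2 : 2 * n < (2 ^ 2) ^ n := by rw [← pow_mul]; exact Nat.lt_two_pow_self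
        have h3 : n < 4 ^ n := Nat.lt_pow_self (by norm_num)
        norm_num at h2
        omega
      calc a ≤ (3 * n + 2) * 2 ^ (n + 3) := by omega
        _ ≤ (2 * 4 ^ n) * 2 ^ (n + 3) := Nat.mul_le_mul_right _ h1
        _ = 2 ^ (3 * n + 4) := by
          rw [show (4 : ℕ) = 2 ^ 2 by norm_num, ← pow_mul]; ring
        _ < 2 ^ (0 + 4 * n + 5) := Nat.pow_lt_pow_right (by norm_num) (by omega)
    · calc _ ≤ (2 : ℝ) ^ (n + 5 + 0) := simBound_le_two_pow hn'.1 _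
        _ = _ := by push_cast; ring

end QSim

end

theorem mainTheorem7 :
    -- a constant error parameter: the same one on both sides
    (∀ γ : ℝ, 0 < γ → γ < 0.4999 →
      QSim.GammaSharpQSETH (fun _ => γ) → QSim.StrongSimulationHard (fun _ => γ)) ∧
    -- error parameters that vary with the number of variables, or of qubits
    ((∀ γ : ℕ → ℝ, (∀ᶠ n in Filter.atTop, γ n ∈ QSim.errorRange n) →
        QSim.GammaSharpQSETH γ) →
      ∀ γ : ℕ → ℝ, (∀ᶠ n in Filter.atTop, γ n ∈ QSim.errorRange n) →
        QSim.StrongSimulationHard γ) := by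
  exact ⟨fun γ h0 h1 hQ => QSim.strongSimulationHard_of_const h0 h1 hQ,
    fun hQ γ hγ => QSim.strongSimulationHard_of_forall hQ hγ⟩
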